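/- Let $q(k;N)=N^k/(1+N)^{k+1}$, $k=0,1,2,\dots$, let $0<\theta<1$, $\bar n_B\ge 0$, and let $n$ be a non-negative integer. For $0<t<1$ let $\mathcal E_t$ be the single-mode lossy thermal-noise bosonic channel $\mathcal E_t[\rho]=\operatorname{Tr}_E\big[U_t(\rho\otimes\tau)U_t^\dagger\big]$, where $\tau=\sum_k q(k;\bar n_T)\,|k\rangle\langle k|$ is the thermal state with mean photon number $\bar n_T=\bar n_B/(1-t)$ and $U_t$ is the beamsplitter of transmittance $t$ between the signal mode $a$ and the environment mode $e$, i.e. $U_t^\dagger a U_t=\sqrt t\,a+\sqrt{1-t}\,e$. For $\bar n_S>0$ let $|\psi\rangle_{IS}=\sum_k\sqrt{q(k;\bar n_S)}\,|k\rangle_I|k\rangle_S$ be the two-mode squeezed vacuum and let $$\sigma(t)=(\mathrm{id}_I\otimes\mathcal E_t)^{\otimes n}\big[(|\psi\rangle\langle\psi|_{IS})^{\otimes n}\big]$$ be the joint state of the $n$ retained idlers and the $n$ returned probes. Let $\mathcal J_\theta=\operatorname{Tr}\{\Lambda^2\sigma(\theta)\}$ be its quantum Fisher information with respect to the transmittance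 at $t=\theta$ (with $\bar n_B$ and $\bar n_S$ fixed), where the symmetric logarithmic derivative $\Lambda$ is a densely defined Hermitian, possibly unbounded, operator with $\partial_t\sigma(t)|_{t=\theta}=\tfrac12(\Lambda\sigma(\theta)+\sigma(\theta)\Lambda)$. Then for every $\bar n_S>0$ the quantum Fisher information exists, does not depend on the choice of $\Lambda$, and equals $$\mathcal J_\theta=n\,\frac{\bar n_S\big(\bar n_B+1+(1-\theta)\bar n_S+\bar n_B\bar n_S\big)}{\theta(\bar n_B+1-\theta)\big(\bar n_B+1+\bar n_S(2\bar n_B+1-\theta)\big)},$$ and consequently $$\lim_{\bar n_S\to0^+}\frac{\mathcal J_\theta}{\bar n_S}=\frac{n}{\theta(\bar n_B+1-\theta)}.$$ -/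

import Mathlib

open Filter Topology
open scoped lp Nat ComplexConjugate

noncomputable section

/-! ### Fock-basis description of the probe, the channel and the output

A pattern `k : Fin n → ℕ` labels the Fock vector `|k 0, …, k (n-1)⟩` of `n` bosonic modes.  Operators
are first given by their (infinite) matrices `⟨x|ρ|y⟩` in the Fock basis. -/

/-- The Bose–Einstein probability `q(k; N)` with mean `N`. -/
def boseEinstein (N : ℝ) (k : ℕ) : ℝ := N ^ k / (1 + N) ^ (k + 1)

/-- The amplitude `⟨r, l| U_θ |s, k⟩` of the beamsplitter of transmittance `θ`, whose annihilation
operators satisfy `b = U† a U = √θ a + √(1-θ) e` (and `c = U† e U = -√(1-θ) a + √θ e`).  Here `s, k`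
are the photon numbers of the signal and the environment before, and `r, l` those of the returned
and the lost mode after the beamsplitter.  Equivalently
`U_θ |s, k⟩ = (s! k!)^(-1/2) (√θ a† - √(1-θ) e†)^s (√(1-θ) a† + √θ e†)^k |0, 0⟩`,
and `(a†)^r (e†)^l |0, 0⟩ = √(r! l!) |r, l⟩`.  The product is homogeneous of degree `s + k`, so its
coefficient at `(a†)^r (e†)^l` is read off after setting `e† = 1`. -/
def beamsplitterAmp (θ : ℝ) (r l s k : ℕ) : ℝ :=
  if r + l = s + k then
    √(((r ! : ℝ) * (l ! : ℝ)) / ((s ! : ℝ) * (k ! : ℝ))) *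
      ((Polynomial.C √θ * Polynomial.X - Polynomial.C √(1 - θ)) ^ s *
        (Polynomial.C √(1 - θ) * Polynomial.X + Polynomial.C √θ) ^ k).coeff r
  else 0

/-- The `n`-fold tensor power of the beamsplitter. -/
def beamsplitterAmpPow (n : ℕ) (θ : ℝ) (r l s k : Fin n → ℕ) : ℝ :=
  ∏ m, beamsplitterAmp θ (r m) (l m) (s m) (k m)

/-- The diagonal entries of the `n`-fold tensor power of the thermal state with mean `N`. -/
def thermalPow (n : ℕ) (N : ℝ) (k : Fin n → ℕ) : ℝ := ∏ m, boseEinstein N (k m)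

/-- `n` uses of the lossy thermal-noise bosonic channel on the signal modes and the identity on the
idler system (Fock labels `ι`):
`ρ ↦ Tr_E [(1 ⊗ U_θ^{⊗n}) (ρ ⊗ τ_{nT}^{⊗n}) (1 ⊗ U_θ^{⊗n})†]`.
The sum runs over `(k, l, s, s')`: the environment pattern `k` before the beamsplitters, the
environment pattern `l` that is traced out, and the signal patterns `s, s'`. -/
def lossyThermalChannel (n : ℕ) {ι : Type} (nT θ : ℝ)
    (ρ : Matrix (ι × (Fin n → ℕ)) (ι × (Fin n → ℕ)) ℂ) :
    Matrix (ι × (Fin n → ℕ)) (ι × (Fin n → ℕ)) ℂ := fun x y =>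
  ∑' p : (Fin n → ℕ) × (Fin n → ℕ) × (Fin n → ℕ) × (Fin n → ℕ),
    (beamsplitterAmpPow n θ x.2 p.2.1 p.2.2.1 p.1 : ℂ) *
      ((thermalPow n nT p.1 : ℂ) * ρ (x.1, p.2.2.1) (y.1, p.2.2.2)) *
      conj (beamsplitterAmpPow n θ y.2 p.2.1 p.2.2.2 p.1 : ℂ)

/-- The Fock amplitude at `(idler pattern, signal pattern)` of `n` two-mode squeezed vacua
`∑ₖ √q(k; nS) |k⟩_I |k⟩_S`. -/
def tmsvAmp (n : ℕ) (nS : ℝ) (x : (Fin n → ℕ) × (Fin n → ℕ)) : ℂ :=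
  ∏ m, if x.1 m = x.2 m then (√(boseEinstein nS (x.1 m)) : ℂ) else 0

/-- The input state `(|ψ⟩⟨ψ|_{IS})^{⊗n}`. -/
def tmsvState (n : ℕ) (nS : ℝ) :
    Matrix ((Fin n → ℕ) × (Fin n → ℕ)) ((Fin n → ℕ) × (Fin n → ℕ)) ℂ :=
  fun x y => tmsvAmp n nS x * conj (tmsvAmp n nS y)

/-- The state of the retained idlers and the returned probes as a function of the transmittance `t`;
the environment has mean photon number `nB / (1 - t)` per mode, with `nB` fixed. -/
def outputState (n : ℕ) (nB nS : ℝ) (t : ℝ) :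
    Matrix ((Fin n → ℕ) × (Fin n → ℕ)) ((Fin n → ℕ) × (Fin n → ℕ)) ℂ :=
  lossyThermalChannel n (nB / (1 - t)) t (tmsvState n nS)

/-! ### Quantum Fisher information -/

/-- The bounded operator `S` on `ℓ²(α)` has the matrix `M` in the standard basis. -/
def HasMatrix {α : Type} [DecidableEq α] (S : ℓ²(α, ℂ) →L[ℂ] ℓ²(α, ℂ)) (M : Matrix α α ℂ) : Prop :=
  ∀ a b : α, S (lp.single 2 b (1 : ℂ)) a = M a b

/-- `T` is of trace class with trace `t`: the diagonal sum converges absolutely to `t` in every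
orthonormal basis. -/
def HasTrace {H : Type} [NormedAddCommGroup H] [InnerProductSpace ℂ H] (T : H → H) (t : ℂ) : Prop :=
  ∀ (ι : Type) (e : HilbertBasis ι ℂ H), HasSum (fun i => inner ℂ (e i) (T (e i))) t

/-- `L` is a symmetric logarithmic derivative for the state `S` and the derivative `S'`: a densely
defined, possibly unbounded, Hermitian operator, defined on the range of `S`, such that
`S' = (L S + S L) / 2` on the domain of `L`. -/
structure IsSLD {H : Type} [NormedAddCommGroup H] [InnerProductSpace ℂ H]
    (S S' : H →L[ℂ] H) (L : H →ₗ.[ℂ] H) : Prop where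
  dense : Dense (L.domain : Set H)
  hermitian : ∀ x y : L.domain, inner ℂ (L x) (y : H) = inner ℂ (x : H) (L y)
  mem_domain : ∀ x : H, S x ∈ L.domain
  sld_eq : ∀ x : L.domain,
    S' (x : H) = (1 / 2 : ℂ) • (L ⟨S (x : H), mem_domain x⟩ + S (L x))

/-- The family of states with matrices `M t` has quantum Fisher information `J` at `θ`: near `θ` the
matrices are those of bounded operators `S t`, which are differentiable in operator norm at `θ`, there is
a symmetric logarithmic derivative `L` at `θ`, and `L² S(θ)` is everywhere defined and of trace class
with trace `J`. -/
def HasQFI {α : Type} [DecidableEq α] (M : ℝ → Matrix α α ℂ) (θ J : ℝ) : Prop :=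
  ∃ (S : ℝ → ℓ²(α, ℂ) →L[ℂ] ℓ²(α, ℂ)) (S' : ℓ²(α, ℂ) →L[ℂ] ℓ²(α, ℂ))
    (L : ℓ²(α, ℂ) →ₗ.[ℂ] ℓ²(α, ℂ)) (h : IsSLD (S θ) S' L)
    (h₂ : ∀ x, L ⟨S θ x, h.mem_domain x⟩ ∈ L.domain),
    (∀ᶠ t in 𝓝 θ, HasMatrix (S t) (M t)) ∧
    HasDerivAt S S' θ ∧
    HasTrace (fun x => L ⟨L ⟨S θ x, h.mem_domain x⟩, h₂ x⟩) (J : ℂ)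

open Classical in
/-- The quantum Fisher information of the family `M` at `θ` (`0` if it does not exist). -/
def qfi {α : Type} [DecidableEq α] (M : ℝ → Matrix α α ℂ) (θ : ℝ) : ℝ :=
  if h : ∃ J, HasQFI M θ J then h.choose else 0

end

/-! Write `a`, `b` for the idler and probe modes of one pair, `q = nT / (1 + nT)` for the geometric
ratio of the environment and `λ = nS / (1 + nS)`. The beamsplitter amplitudes obey creation and
annihilation relations. Summed against the weight `q ^ k` these close up, and the one-pair output
`σ` satisfies `a σ = A b† σ + B σ a` and `b σ = A a† σ + D σ b` with `A = √λ √t / (1 + nB)`, `B = λ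
(1 - t + nB) / (1 + nB)`, `D = nB / (1 + nB)` (`isSqueezedThermal_modeState`). Because `nB` is held
fixed, neither `D` nor the vacuum entry depends on `t`. Everything else follows from these
relations.

By induction on the photon number the entries decay geometrically, locally uniformly in `t`, and `∂σ
= A' (a† b† σ + σ a b) + B' a† σ a`. The ansatz `Λ = c₀ + c₁ a†a + c₂ b†b + c₃ (a b + a† b†)` turns
`2 ∂σ = Λ σ + σ Λ` into linear equations for the coefficients (`IsSqueezedThermal.quadraticOp_add`).
For `n` pairs both sides obey the Leibniz rule, so sums of one-pair operators suffice.

The value needs no fourth moments: `Tr Λ² σ = Tr Λ ∂σ` is the derivative of `Tr Λ σ(t)` with `Λ`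
frozen at `θ`, and this trace only involves `⟨a†a⟩ = nS`, `⟨b†b⟩ = nS t + nB` and `⟨a b⟩ = √λ √t (1
+ nS)`.

Analytically, `Λ` acts on the vectors decaying faster than any power of the photon number. The state
maps all of `ℓ²` into this domain, and every operator that occurs has an absolutely summable matrix,
which gives norm differentiability and the trace class property (`hasQFI_of_localOp`).

For uniqueness, let `A` now denote the difference of `L S` for two logarithmic derivatives. It is
bounded and anticommutes with `S ≥ 0`, hence vanishes; a basis adapted to `ker S` then shows that
the traces of `L² S` agree (`IsSLD.trace_unique`). -/

/-! ### Uniqueness of the quantum Fisher information -/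

section Uniqueness

variable {H : Type} [NormedAddCommGroup H] [InnerProductSpace ℂ H]

/-- The everywhere defined operator `L S`, for `L` defined on the range of `S`. -/
noncomputable def LinearPMap.compRange (L : H →ₗ.[ℂ] H) (S : H →L[ℂ] H) (h : ∀ x, S x ∈ L.domain) :
    H →ₗ[ℂ] H :=
  L.toFun ∘ₗ (S : H →ₗ[ℂ] H).codRestrict L.domain h

variable [CompleteSpace H]

/-- Closed graph theorem: tested against the dense domain of `L`, hermiticity turns `L S` into the
pairing of `S` with `L z`, which is continuous, so limits along the graph are identified. -/
theorem IsSLD.continuous_compRange {S S' : H →L[ℂ] H} {L : H →ₗ.[ℂ] H} (h : IsSLD S S' L) :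
    Continuous (L.compRange S h.mem_domain) := by
  refine LinearMap.continuous_of_seq_closed_graph _ fun u x y hu hy => ?_
  refine h.dense.eq_of_inner_right (𝕜 := ℂ) fun z hz => ?_
  lift z to L.domain using hz
  have h1 : Tendsto (fun k => inner ℂ (z : H) (L.compRange S h.mem_domain (u k))) atTop
      (𝓝 (inner ℂ (z : H) y)) := tendsto_const_nhds.inner hy
  have h2 : Tendsto (fun k => inner ℂ (L z) (S (u k))) atTop (𝓝 (inner ℂ (L z) (S x))) :=
    tendsto_const_nhds.inner ((S.continuous.tendsto x).comp hu)
  have h3 : ∀ v, inner ℂ (z : H) (L.compRange S h.mem_domain v) = inner ℂ (L z) (S v) := fun v =>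
    (h.hermitian z ⟨S v, h.mem_domain v⟩).symm
  rw [h3]
  simp only [h3] at h1
  exact tendsto_nhds_unique h1 h2

/-- Anticommuting with `S` means commuting with `S²`, hence, by functional calculus, with `S =
√(S²)`. Commuting and anticommuting together leave only zero. -/
theorem mul_eq_zero_of_anticommute_nonneg {S A : H →L[ℂ] H} (hS : 0 ≤ S) (h : A * S = -(S * A)) :
    A * S = 0 := by
  have hc : Commute (S * S) A := by
    change S * S * A = A * (S * S)
    rw [← mul_assoc, h, neg_mul, mul_assoc S A S, h, mul_neg, neg_neg, mul_assoc]
  have hc' : Commute S A := by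
    have := hc.cfcₙ_real Real.sqrt
    rwa [← CFC.sqrt_eq_real_sqrt _ (by
      simpa [(IsSelfAdjoint.of_nonneg hS).star_eq] using star_mul_self_nonneg S),
      CFC.sqrt_mul_self S hS] at this
  rw [hc'.eq] at h
  have h2 : (2 : ℂ) • (A * S) = 0 := by rw [two_smul]; exact add_eq_zero_iff_eq_neg.mpr h
  exact (smul_eq_zero.mp h2).resolve_left two_ne_zero

/-- Two symmetric logarithmic derivatives agree on the range of the state. -/
theorem IsSLD.apply_range_unique {S S' : H →L[ℂ] H} (hS : 0 ≤ S) {L₁ L₂ : H →ₗ.[ℂ] H}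
    (h₁ : IsSLD S S' L₁) (h₂ : IsSLD S S' L₂) (x : H) :
    L₁ ⟨S x, h₁.mem_domain x⟩ = L₂ ⟨S x, h₂.mem_domain x⟩ := by
  let A : H →L[ℂ] H := ⟨L₁.compRange S h₁.mem_domain - L₂.compRange S h₂.mem_domain,
    h₁.continuous_compRange.sub h₂.continuous_compRange⟩
  have hA : ∀ v, A v = L₁ ⟨S v, h₁.mem_domain v⟩ - L₂ ⟨S v, h₂.mem_domain v⟩ := fun v => rfl
  have hanti : A * S = -(S * A) := by
    ext v
    have e₁ := h₁.sld_eq ⟨S v, h₁.mem_domain v⟩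
    have e₂ := h₂.sld_eq ⟨S v, h₂.mem_domain v⟩
    have e := smul_right_injective H (by norm_num : (1 / 2 : ℂ) ≠ 0) (e₁.symm.trans e₂)
    simp only at e
    change A (S v) = -(S (A v))
    rw [hA, hA, map_sub, neg_sub, sub_eq_sub_iff_add_eq_add, e, add_comm]
  have hAS := mul_eq_zero_of_anticommute_nonneg hS hanti
  have hSsymm : ∀ u v, inner ℂ (S u) v = inner ℂ u (S v) :=
    ((ContinuousLinearMap.nonneg_iff_isPositive S).mp hS).isSymmetric
  have hker : A = 0 := by
    have hr : ∀ y, y ∈ (LinearMap.ker (S : H →ₗ[ℂ] H)) → A y = 0 := by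
      intro y hy
      have hy' : S y = 0 := hy
      have e₁ : (⟨S y, h₁.mem_domain y⟩ : L₁.domain) = 0 := Subtype.ext hy'
      have e₂ : (⟨S y, h₂.mem_domain y⟩ : L₂.domain) = 0 := Subtype.ext hy'
      rw [hA, e₁, e₂, LinearPMap.map_zero, LinearPMap.map_zero, sub_zero]
    -- `A` kills both the range and the kernel of `S`. A vector orthogonal to `ker A` is orthogonal
    -- to the range, so it lies in `ker S ⊆ ker A` and is orthogonal to itself.
    have hz : (LinearMap.ker (A : H →ₗ[ℂ] H))ᗮ = ⊥ := by
      rw [eq_bot_iff]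
      intro z hz
      have hzk : z ∈ LinearMap.ker (S : H →ₗ[ℂ] H) := by
        change S z = 0
        refine ext_inner_left ℂ fun v => ?_
        rw [inner_zero_right, ← hSsymm]
        exact hz (S v) (show A (S v) = 0 from congrArg (· v) hAS)
      have : inner ℂ z z = 0 := hz z (hr z hzk)
      simpa using this
    have hcl : IsClosed ((LinearMap.ker (A : H →ₗ[ℂ] H) : Submodule ℂ H) : Set H) := A.isClosed_ker
    have : CompleteSpace (LinearMap.ker (A : H →ₗ[ℂ] H)) := hcl.completeSpace_coe
    have htop := (Submodule.orthogonal_eq_bot_iff (K := LinearMap.ker (A : H →ₗ[ℂ] H))).mp hz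
    ext v
    have : v ∈ LinearMap.ker (A : H →ₗ[ℂ] H) := htop ▸ Submodule.mem_top
    exact this
  have := hA x
  rw [hker] at this
  exact (sub_eq_zero.mp this.symm)

/-- A Hilbert basis of `Kᗮ` is extended to one of `H`; the added vectors are orthogonal to all of
`Kᗮ`, hence lie in `Kᗮᗮ = K`. With `K = ker S` this is the basis in which the two traces are
compared. -/
theorem exists_hilbertBasis_mem_or_mem_orthogonal (K : Submodule ℂ H) (hK : IsClosed (K : Set H)) :
    ∃ (ι : Type) (b : HilbertBasis ι ℂ H), ∀ i, b i ∈ K ∨ b i ∈ Kᗮ := by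
  have : CompleteSpace K := hK.completeSpace_coe
  obtain ⟨s, b, hb⟩ := exists_hilbertBasis ℂ Kᗮ
  have hs : Orthonormal ℂ (Subtype.val : (((↑) : Kᗮ → H) '' s) → H) := by
    have h1 : Orthonormal ℂ (fun i : s => ((i : Kᗮ) : H)) := by
      have := b.orthonormal.comp_linearIsometry Kᗮ.subtypeₗᵢ
      rw [hb] at this
      exact this
    have h2 := h1.toSubtypeRange
    convert h2 using 2 <;> simp [Set.image_eq_range]
  obtain ⟨t, c, hst, hc⟩ := hs.exists_hilbertBasis_extension
  refine ⟨t, c, fun i => ?_⟩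
  by_cases hi : (i : H) ∈ (((↑) : Kᗮ → H) '' s)
  · right
    obtain ⟨y, -, hy⟩ := hi
    rw [hc, ← hy]
    exact y.2
  · left
    rw [← K.orthogonal_orthogonal]
    intro z hz
    have hrep := b.hasSum_repr ⟨z, hz⟩
    have hrep' := hrep.mapL (Kᗮ.subtypeL)
    have hin := (hrep'.mapL (innerSL ℂ (c i)))
    have h0 : ∀ j : s, (innerSL ℂ (c i)) (Kᗮ.subtypeL (b.repr ⟨z, hz⟩ j • b j)) = 0 := by
      intro j
      have hj : ((b j : Kᗮ) : H) ∈ t := hst ⟨b j, by rw [hb]; exact j.2, rfl⟩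
      have hne : i ≠ ⟨_, hj⟩ := by
        intro h
        apply hi
        rw [h]
        exact ⟨b j, by rw [hb]; exact j.2, rfl⟩
      have := c.orthonormal.2 hne
      rw [map_smul, map_smul]
      simp only [innerSL_apply_apply, Submodule.subtypeL_apply]
      have e : ((b j : Kᗮ) : H) = c ⟨_, hj⟩ := by rw [hc]
      rw [e, this, smul_zero]
    have := hin.unique (by simpa only [h0] using hasSum_zero)
    rw [innerSL_apply_apply] at this
    exact inner_eq_zero_symm.mp this

/-- The trace of `L² S` does not depend on the symmetric logarithmic derivative `L`. -/
theorem IsSLD.trace_unique {S S' T T' : H →L[ℂ] H} (hS : 0 ≤ S) {L₁ L₂ : H →ₗ.[ℂ] H}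
    (hST : S = T) (hST' : S' = T') (h₁ : IsSLD S S' L₁) (h₂ : IsSLD T T' L₂)
    (d₁ : ∀ x, L₁ ⟨S x, h₁.mem_domain x⟩ ∈ L₁.domain)
    (d₂ : ∀ x, L₂ ⟨T x, h₂.mem_domain x⟩ ∈ L₂.domain) {t₁ t₂ : ℂ}
    (ht₁ : HasTrace (fun x => L₁ ⟨L₁ ⟨S x, h₁.mem_domain x⟩, d₁ x⟩) t₁)
    (ht₂ : HasTrace (fun x => L₂ ⟨L₂ ⟨T x, h₂.mem_domain x⟩, d₂ x⟩) t₂) : t₁ = t₂ := by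
  subst hST hST'
  have hSsymm : ∀ u v, inner ℂ (S u) v = inner ℂ u (S v) :=
    ((ContinuousLinearMap.nonneg_iff_isPositive S).mp hS).isSymmetric
  obtain ⟨ι, b, hb⟩ := exists_hilbertBasis_mem_or_mem_orthogonal (LinearMap.ker (S : H →ₗ[ℂ] H))
    S.isClosed_ker
  refine (ht₁ ι b).unique ?_
  convert ht₂ ι b using 2 with i
  beta_reduce
  rcases hb i with hi | hi
  · have hi' : S (b i) = 0 := hi
    have e₁ : (⟨L₁ ⟨S (b i), h₁.mem_domain _⟩, d₁ _⟩ : L₁.domain) = 0 := by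
      have : (⟨S (b i), h₁.mem_domain _⟩ : L₁.domain) = 0 := Subtype.ext hi'
      exact Subtype.ext (by simp [this])
    have e₂ : (⟨L₂ ⟨S (b i), h₂.mem_domain _⟩, d₂ _⟩ : L₂.domain) = 0 := by
      have : (⟨S (b i), h₂.mem_domain _⟩ : L₂.domain) = 0 := Subtype.ext hi'
      exact Subtype.ext (by simp [this])
    rw [e₁, e₂, LinearPMap.map_zero, LinearPMap.map_zero]
  -- Hermiticity gives `⟪S v, L² S b⟫ = ⟪L S v, L S b⟫`, which is the same for both operators. So
  -- the two values of `L² S b` differ by an element of `ker S`, invisible to a basis vector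
  -- orthogonal to `ker S`.
  · rw [← sub_eq_zero, ← inner_sub_right]
    refine inner_eq_zero_symm.mp (hi _ ?_)
    change S _ = 0
    refine ext_inner_left ℂ fun v => ?_
    rw [inner_zero_right, ← hSsymm, inner_sub_right, sub_eq_zero]
    have k₁ := h₁.hermitian ⟨S v, h₁.mem_domain v⟩ ⟨_, d₁ (b i)⟩
    have k₂ := h₂.hermitian ⟨S v, h₂.mem_domain v⟩ ⟨_, d₂ (b i)⟩
    simp only at k₁ k₂
    rw [← k₁, ← k₂, h₁.apply_range_unique hS h₂ v, h₁.apply_range_unique hS h₂ (b i)]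

end Uniqueness

theorem HasMatrix.unique {α : Type} [DecidableEq α] {S T : ℓ²(α, ℂ) →L[ℂ] ℓ²(α, ℂ)}
    {M : Matrix α α ℂ} (hS : HasMatrix S M) (hT : HasMatrix T M) : S = T := by
  ext1 x
  have hx := lp.hasSum_single (by norm_num : (2 : ENNReal) ≠ ⊤) x
  refine (hx.mapL S).unique ?_
  convert hx.mapL T using 2 with b
  have hb : lp.single 2 b (x b) = x b • (lp.single 2 b (1 : ℂ) : ℓ²(α, ℂ)) := by
    rw [← lp.single_smul, smul_eq_mul, mul_one]
  rw [hb, map_smul, map_smul]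
  congr 1
  ext a
  rw [hS a b, hT a b]

/-- The quantum Fisher information of a family of positive operators is unique. -/
theorem HasQFI.unique {α : Type} [DecidableEq α] {M : ℝ → Matrix α α ℂ} {θ J₁ J₂ : ℝ}
    (hpos : ∀ S : ℓ²(α, ℂ) →L[ℂ] ℓ²(α, ℂ), HasMatrix S (M θ) → 0 ≤ S)
    (h₁ : HasQFI M θ J₁) (h₂ : HasQFI M θ J₂) : J₁ = J₂ := by
  obtain ⟨S, S', L₁, hL₁, d₁, hm₁, hd₁, ht₁⟩ := h₁
  obtain ⟨T, T', L₂, hL₂, d₂, hm₂, hd₂, ht₂⟩ := h₂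
  have hST : S =ᶠ[𝓝 θ] T := by
    filter_upwards [hm₁, hm₂] with t h1 h2 using h1.unique h2
  have hθ : S θ = T θ := hST.eq_of_nhds
  have hd : S' = T' := hd₁.unique (hd₂.congr_of_eventuallyEq hST)
  exact_mod_cast IsSLD.trace_unique (hpos _ hm₁.self_of_nhds) hθ hd hL₁ hL₂ d₁ d₂ ht₁ ht₂

/-! ### Operators on `ℓ²` given by absolutely summable matrices -/

section MatrixOperators

variable {α : Type} [DecidableEq α]

/-- The matrix unit `|a⟩⟨b|`. -/
noncomputable def lpMatrixUnit (p : α × α) : ℓ²(α, ℂ) →L[ℂ] ℓ²(α, ℂ) :=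
  InnerProductSpace.rankOne ℂ (lp.single 2 p.1 (1 : ℂ) : ℓ²(α, ℂ)) (lp.single 2 p.2 (1 : ℂ) : ℓ²(α, ℂ))

theorem lpMatrixUnit_apply (p : α × α) (x : ℓ²(α, ℂ)) :
    lpMatrixUnit p x = x p.2 • lp.single 2 p.1 (1 : ℂ) := by
  simp [lpMatrixUnit, InnerProductSpace.rankOne_apply, lp.inner_single_left]

theorem norm_lpMatrixUnit (p : α × α) : ‖lpMatrixUnit p‖ = 1 := by
  rw [lpMatrixUnit, InnerProductSpace.norm_rankOne, lp.norm_single (by norm_num),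
    lp.norm_single (by norm_num)]
  simp

/-- The operator on `ℓ²(α)` with matrix `m`. -/
noncomputable def lpOfMatrix (m : α → α → ℂ) : ℓ²(α, ℂ) →L[ℂ] ℓ²(α, ℂ) :=
  ∑' p : α × α, m p.1 p.2 • lpMatrixUnit p

theorem hasSum_lpOfMatrix {m : α → α → ℂ} (hm : Summable fun p : α × α => ‖m p.1 p.2‖) :
    HasSum (fun p : α × α => m p.1 p.2 • lpMatrixUnit p) (lpOfMatrix m) := by
  refine Summable.hasSum (Summable.of_norm ?_)
  simpa only [norm_smul, norm_lpMatrixUnit, mul_one] using hm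

theorem lpOfMatrix_apply {m : α → α → ℂ} (hm : Summable fun p : α × α => ‖m p.1 p.2‖)
    (x : ℓ²(α, ℂ)) (a : α) : lpOfMatrix m x a = ∑' b, m a b * x b := by
  have h := ((hasSum_lpOfMatrix hm).mapL (ContinuousLinearMap.apply ℂ _ x)).mapL
    (lp.evalCLM ℂ (fun _ : α => ℂ) 2 a)
  have hinj : Function.Injective fun b : α => (a, b) := fun b c h => (Prod.ext_iff.mp h).2
  have h' := (hinj.hasSum_iff ?_).mpr h
  · refine (h'.tsum_eq.symm.trans ?_)
    refine tsum_congr fun b => ?_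
    simp [lp.evalCLM, lpMatrixUnit_apply]
  · rintro ⟨c, b⟩ hc
    have hca : c ≠ a := fun h => hc ⟨b, by simp [h]⟩
    simp [lp.evalCLM, lpMatrixUnit_apply, hca.symm]

theorem hasMatrix_lpOfMatrix {m : α → α → ℂ} (hm : Summable fun p : α × α => ‖m p.1 p.2‖) :
    HasMatrix (lpOfMatrix m) m := by
  intro a b
  rw [lpOfMatrix_apply hm, tsum_eq_single b]
  · simp
  · intro c hc
    simp [hc]

/-- Matrix units have norm one, so a summable bound on the differentiated entries allows termwise
differentiation in operator norm. -/
theorem hasDerivAt_lpOfMatrix {m m' : ℝ → α → α → ℂ} {u : α × α → ℝ} {U : Set ℝ} {θ : ℝ}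
    (hu : Summable u) (hU : IsOpen U) (hU' : IsPreconnected U) (hθ : θ ∈ U)
    (hd : ∀ a b, ∀ t ∈ U, HasDerivAt (fun t => m t a b) (m' t a b) t)
    (hb : ∀ a b, ∀ t ∈ U, ‖m' t a b‖ ≤ u (a, b))
    (hm : Summable fun p : α × α => ‖m θ p.1 p.2‖) :
    HasDerivAt (fun t => lpOfMatrix (m t)) (lpOfMatrix (m' θ)) θ := by
  have key := hasDerivAt_tsum_of_isPreconnected (y₀ := θ) (y := θ)
    (g := fun (p : α × α) t => m t p.1 p.2 • lpMatrixUnit p)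
    (g' := fun (p : α × α) t => m' t p.1 p.2 • lpMatrixUnit p)
    hu hU hU' (fun p t ht => HasDerivAt.smul_const (hd p.1 p.2 t ht) (lpMatrixUnit p)) (fun p t ht => ?_) hθ
    (hasSum_lpOfMatrix hm).summable hθ
  · exact key
  · rw [norm_smul, norm_lpMatrixUnit, mul_one]
    exact hb _ _ _ ht

/-- An operator with an absolutely summable matrix is of trace class. -/
theorem hasTrace_lpOfMatrix {m : α → α → ℂ} (hm : Summable fun p : α × α => ‖m p.1 p.2‖) {J : ℂ}
    (hJ : HasSum (fun a => m a a) J) : HasTrace (lpOfMatrix m) J := by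
  intro ι e
  set δ : α → ℓ²(α, ℂ) := fun a => lp.single 2 a (1 : ℂ) with hδ
  have hδn : ∀ a, ‖δ a‖ = 1 := fun a => by
    rw [hδ]; simp only; rw [lp.norm_single (by norm_num)]; simp
  -- Fubini for the matrix entries against an arbitrary orthonormal basis `e`. By `2xy ≤ x² + y²`
  -- and Bessel, the sum over `e` attached to each matrix unit is at most one in absolute value, so
  -- `F` is as summable as the matrix.
  let F : (α × α) × ι → ℂ := fun q =>
    m q.1.1 q.1.2 * (inner ℂ (δ q.1.2) (e q.2) * inner ℂ (e q.2) (δ q.1.1))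
  have hsq : ∀ a, Summable fun i => ‖inner ℂ (e i) (δ a)‖ ^ 2 := fun a =>
    e.orthonormal.inner_products_summable (δ a)
  have hsq1 : ∀ a, ∑' i, ‖inner ℂ (e i) (δ a)‖ ^ 2 ≤ 1 := fun a => by
    simpa [hδn] using e.orthonormal.tsum_inner_products_le (δ a)
  have hle : ∀ a b i, ‖inner ℂ (δ b) (e i) * inner ℂ (e i) (δ a)‖ ≤
      1 / 2 * ‖inner ℂ (e i) (δ b)‖ ^ 2 + 1 / 2 * ‖inner ℂ (e i) (δ a)‖ ^ 2 := by
    intro a b i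
    rw [norm_mul, norm_inner_symm (δ b)]
    nlinarith [sq_nonneg (‖inner ℂ (e i) (δ b)‖ - ‖inner ℂ (e i) (δ a)‖)]
  have hrow : ∀ a b, Summable fun i => ‖inner ℂ (δ b) (e i) * inner ℂ (e i) (δ a)‖ := fun a b =>
    Summable.of_nonneg_of_le (fun _ => norm_nonneg _) (hle a b)
      (((hsq b).mul_left _).add ((hsq a).mul_left _))
  have hrow1 : ∀ a b, ∑' i, ‖inner ℂ (δ b) (e i) * inner ℂ (e i) (δ a)‖ ≤ 1 := by
    intro a b
    refine ((hrow a b).tsum_le_tsum (hle a b)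
      (((hsq b).mul_left _).add ((hsq a).mul_left _))).trans ?_
    rw [((hsq b).mul_left _).tsum_add ((hsq a).mul_left _), tsum_mul_left, tsum_mul_left]
    linarith [hsq1 a, hsq1 b]
  have hF : Summable F := by
    refine Summable.of_norm ?_
    refine (summable_prod_of_nonneg fun _ => norm_nonneg _).mpr ⟨fun p => ?_, ?_⟩
    · simp only [F, norm_mul]
      simpa only [norm_mul] using (hrow p.1 p.2).mul_left ‖m p.1 p.2‖
    · refine Summable.of_nonneg_of_le (fun p => tsum_nonneg fun _ => norm_nonneg _) (fun p => ?_) hm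
      simp only [F]
      simp_rw [norm_mul (m p.1 p.2)]
      rw [tsum_mul_left]
      exact mul_le_of_le_one_right (norm_nonneg _) (hrow1 _ _)
  have h1 : HasSum (fun p : α × α => m p.1 p.2 * inner ℂ (δ p.2) (δ p.1)) (∑' q, F q) :=
    hF.hasSum.prod_fiberwise fun p => (e.hasSum_inner_mul_inner (δ p.2) (δ p.1)).mul_left _
  have h2 : HasSum (fun p : α × α => m p.1 p.2 * inner ℂ (δ p.2) (δ p.1)) J := by
    have hinj : Function.Injective fun a : α => (a, a) := fun b c h => (Prod.ext_iff.mp h).2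
    refine (hinj.hasSum_iff ?_).mp ?_
    · rintro ⟨a, b⟩ hab
      have hne : b ≠ a := fun h => hab ⟨a, by simp [h]⟩
      simp [hδ, lp.inner_single_left, hne]
    · convert hJ using 2 with a
      simp [hδ, lp.inner_single_left]
  rw [h2.unique h1]
  have h3 : HasSum (fun q : ι × (α × α) => F q.swap) (∑' q, F q) :=
    (Equiv.prodComm ι (α × α)).hasSum_iff.mpr hF.hasSum
  refine h3.prod_fiberwise fun i => ?_
  have h := ((hasSum_lpOfMatrix hm).mapL (ContinuousLinearMap.apply ℂ _ (e i))).mapL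
    (innerSL ℂ (e i))
  refine h.congr_fun fun p => ?_
  simp only [F, Prod.swap_prod_mk, ContinuousLinearMap.apply_apply,
    lpMatrixUnit_apply, map_smul, innerSL_apply_apply, smul_eq_mul, hδ, lp.inner_single_left]
  simp

open ComplexOrder in
/-- An operator whose matrix is a (possibly infinite) Gram matrix is positive. -/
theorem HasMatrix.nonneg_of_gram {S : ℓ²(α, ℂ) →L[ℂ] ℓ²(α, ℂ)} {M : Matrix α α ℂ}
    (hS : HasMatrix S M) {κ : Type} (G : κ → α → ℝ)
    (hG : ∀ a b, HasSum (fun j => ((G j a * G j b : ℝ) : ℂ)) (M a b)) : 0 ≤ S := by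
  rw [ContinuousLinearMap.nonneg_iff_isPositive, ContinuousLinearMap.isPositive_iff_complex]
  suffices h : ∀ x, 0 ≤ inner ℂ (S x) x by
    intro x
    obtain ⟨h1, h2⟩ := Complex.le_def.mp (h x)
    exact ⟨Complex.ext (by simp) (by simpa using h2), by simpa using h1⟩
  intro x
  have hx := lp.hasSum_single (by norm_num : (2 : ENNReal) ≠ ⊤) x
  -- Positivity is checked on finitely supported vectors and passes to the limit. There the
  -- quadratic form is a sum over `κ` of squared moduli.
  have hlim : Tendsto (fun s : Finset α => inner ℂ (S (∑ b ∈ s, lp.single 2 b (x b)))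
      (∑ b ∈ s, (lp.single 2 b (x b) : ℓ²(α, ℂ)))) atTop (𝓝 (inner ℂ (S x) x)) :=
    ((S.continuous.tendsto x).comp hx).inner hx
  refine ge_of_tendsto' hlim fun s => ?_
  have hval : inner ℂ (S (∑ b ∈ s, lp.single 2 b (x b))) (∑ b ∈ s, (lp.single 2 b (x b) : ℓ²(α, ℂ)))
      = ∑ a ∈ s, ∑ b ∈ s, M a b * (conj (x b) * x a) := by
    have hconj : ∀ a b, conj (M a b) = M a b := fun a b => by
      refine ((hG a b).map (starRingEnd ℂ) Complex.continuous_conj).unique ?_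
      convert hG a b using 2 with j
      simp
    rw [inner_sum]
    refine Finset.sum_congr rfl fun a _ => ?_
    rw [lp.inner_single_right, map_sum, lp.coeFn_sum, Finset.sum_apply, sum_inner]
    refine Finset.sum_congr rfl fun b _ => ?_
    have hb : lp.single 2 b (x b) = x b • (lp.single 2 b (1 : ℂ) : ℓ²(α, ℂ)) := by
      rw [← lp.single_smul, smul_eq_mul, mul_one]
    rw [hb, map_smul, lp.coeFn_smul, Pi.smul_apply, hS a b]
    simp only [smul_eq_mul, RCLike.inner_apply, map_mul, hconj]
    ring
  rw [hval]
  have hsum : HasSum (fun j => ∑ a ∈ s, ∑ b ∈ s, ((G j a * G j b : ℝ) : ℂ) * (conj (x b) * x a))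
      (∑ a ∈ s, ∑ b ∈ s, M a b * (conj (x b) * x a)) :=
    hasSum_sum fun a _ => hasSum_sum fun b _ => (hG a b).mul_right _
  refine hsum.nonneg fun j => ?_
  have : ∑ a ∈ s, ∑ b ∈ s, ((G j a * G j b : ℝ) : ℂ) * (conj (x b) * x a) =
      conj (∑ a ∈ s, (G j a : ℂ) * x a) * ∑ a ∈ s, (G j a : ℂ) * x a := by
    rw [map_sum, mul_comm, Finset.sum_mul_sum]
    refine Finset.sum_congr rfl fun a _ => Finset.sum_congr rfl fun b _ => ?_
    simp only [map_mul, Complex.conj_ofReal, Complex.ofReal_mul]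
    ring
  rw [this]
  exact star_mul_self_nonneg _

end MatrixOperators

/-! ### Rapidly decaying vectors and matrices -/

section RapidDecay

variable {α : Type}

/-- `f` decays faster than every power of the weight `w`. -/
def RapidDecay (w : α → ℝ) (f : α → ℂ) : Prop :=
  ∀ N : ℕ, ∃ C, ∀ a, w a ^ N * ‖f a‖ ≤ C

/-- The matrix `X` decays faster than every power of the weight `w` in both indices. -/
def JointDecay (w : α → ℝ) (X : α → α → ℂ) : Prop :=
  ∀ N : ℕ, ∃ C, ∀ a b, w a ^ N * w b ^ N * ‖X a b‖ ≤ C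

/-- A weight `w ≥ 1` some inverse power of which is summable. -/
structure IsSummableWeight (w : α → ℝ) (d : ℕ) : Prop where
  one_le : ∀ a, 1 ≤ w a
  summable : Summable fun a => (w a ^ d)⁻¹

variable {w : α → ℝ} {d : ℕ}

theorem IsSummableWeight.pos (hw : IsSummableWeight w d) (a : α) : 0 < w a :=
  one_pos.trans_le (hw.one_le a)

theorem IsSummableWeight.pow_pos (hw : IsSummableWeight w d) (N : ℕ) (a : α) : 0 < w a ^ N :=
  _root_.pow_pos (hw.pos a) N

theorem IsSummableWeight.one_le_pow (hw : IsSummableWeight w d) (N : ℕ) (a : α) : 1 ≤ w a ^ N :=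
  one_le_pow₀ (hw.one_le a)

theorem IsSummableWeight.summable_norm_of_bound (hw : IsSummableWeight w d) {f : α → ℂ} {C : ℝ}
    (hf : ∀ a, w a ^ d * ‖f a‖ ≤ C) : Summable fun a => ‖f a‖ := by
  refine Summable.of_nonneg_of_le (fun _ => norm_nonneg _) (fun a => ?_) (hw.summable.mul_left C)
  rw [← div_eq_mul_inv, le_div_iff₀ (hw.pow_pos d a), mul_comm]
  exact hf a

theorem IsSummableWeight.norm_le_of_bound (hw : IsSummableWeight w d) {X : α → α → ℂ} {C : ℝ}
    (hX : ∀ a b, w a ^ d * w b ^ d * ‖X a b‖ ≤ C) (a b : α) :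
    ‖X a b‖ ≤ C * ((w a ^ d)⁻¹ * (w b ^ d)⁻¹) := by
  rw [← mul_inv, ← div_eq_mul_inv, le_div_iff₀ (mul_pos (hw.pow_pos d a) (hw.pow_pos d b)), mul_comm]
  exact hX a b

theorem IsSummableWeight.summable_prod (hw : IsSummableWeight w d) (C : ℝ) :
    Summable fun p : α × α => C * ((w p.1 ^ d)⁻¹ * (w p.2 ^ d)⁻¹) :=
  (hw.summable.mul_of_nonneg hw.summable (fun a => (inv_pos.mpr (hw.pow_pos d a)).le)
    (fun a => (inv_pos.mpr (hw.pow_pos d a)).le)).mul_left C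

theorem JointDecay.summable_norm (hw : IsSummableWeight w d) {X : α → α → ℂ} (hX : JointDecay w X) :
    Summable fun p : α × α => ‖X p.1 p.2‖ := by
  obtain ⟨C, hC⟩ := hX d
  exact Summable.of_nonneg_of_le (fun _ => norm_nonneg _)
    (fun p => hw.norm_le_of_bound hC p.1 p.2) (hw.summable_prod C)

theorem JointDecay.swap {X : α → α → ℂ} (hX : JointDecay w X) :
    JointDecay w fun a b => X b a := fun N => by
  obtain ⟨C, hC⟩ := hX N
  exact ⟨C, fun a b => by simpa only [mul_comm (w a ^ N)] using hC b a⟩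

theorem JointDecay.row (hw : IsSummableWeight w d) {X : α → α → ℂ} (hX : JointDecay w X) (a : α) :
    RapidDecay w (X a) := fun N => by
  obtain ⟨C, hC⟩ := hX N
  refine ⟨C, fun b => le_trans ?_ (hC a b)⟩
  rw [mul_assoc]
  exact le_mul_of_one_le_left (mul_nonneg (hw.pow_pos N b).le (norm_nonneg _)) (hw.one_le_pow N a)

theorem JointDecay.diag_summable (hw : IsSummableWeight w d) {X : α → α → ℂ}
    (hX : JointDecay w X) : Summable fun a => X a a := by
  obtain ⟨C, hC⟩ := hX d
  refine Summable.of_norm (hw.summable_norm_of_bound (C := C) fun a => le_trans ?_ (hC a a))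
  rw [mul_assoc]
  exact le_mul_of_one_le_left (mul_nonneg (hw.pow_pos d a).le (norm_nonneg _)) (hw.one_le_pow d a)

theorem RapidDecay.summable_norm (hw : IsSummableWeight w d) {f : α → ℂ} (hf : RapidDecay w f) :
    Summable fun a => ‖f a‖ :=
  (hf d).elim fun _ h => hw.summable_norm_of_bound h

theorem RapidDecay.memℓp (hw : IsSummableWeight w d) {f : α → ℂ} (hf : RapidDecay w f) :
    Memℓp f 2 := by
  have h : Memℓp f 1 := memℓp_gen (by simpa using hf.summable_norm hw)
  exact h.of_exponent_ge (by norm_num)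

theorem RapidDecay.mul_jointDecay (hw : IsSummableWeight w d) {f g : α → ℂ} (hf : RapidDecay w f)
    (hg : RapidDecay w g) : JointDecay w fun a b => f a * g b := fun N => by
  obtain ⟨C, hC⟩ := hf N
  obtain ⟨D, hD⟩ := hg N
  refine ⟨C * D, fun a b => ?_⟩
  have h0 : 0 ≤ w a ^ N * ‖f a‖ := mul_nonneg (hw.pow_pos N a).le (norm_nonneg _)
  have h1 : 0 ≤ w b ^ N * ‖g b‖ := mul_nonneg (hw.pow_pos N b).le (norm_nonneg _)
  rw [norm_mul]
  calc w a ^ N * w b ^ N * (‖f a‖ * ‖g b‖) = w a ^ N * ‖f a‖ * (w b ^ N * ‖g b‖) := by ring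
    _ ≤ C * D := mul_le_mul (hC a) (hD b) h1 (h0.trans (hC a))

theorem RapidDecay.conj {f : α → ℂ} (hf : RapidDecay w f) : RapidDecay w fun a => conj (f a) :=
  fun N => (hf N).imp fun C hC a => by simpa using hC a

/-- The rapidly decaying vectors in `ℓ²`. -/
def decaySubmodule (w : α → ℝ) (hw : ∀ a, 0 ≤ w a) : Submodule ℂ ℓ²(α, ℂ) where
  carrier := {x | RapidDecay w x}
  zero_mem' := fun N => ⟨0, fun a => by simp⟩
  add_mem' := by
    intro x y hx hy N
    obtain ⟨C, hC⟩ := hx N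
    obtain ⟨D, hD⟩ := hy N
    refine ⟨C + D, fun a => ?_⟩
    refine (mul_le_mul_of_nonneg_left (norm_add_le _ _) (pow_nonneg (hw a) N)).trans ?_
    rw [mul_add]
    exact add_le_add (hC a) (hD a)
  smul_mem' := by
    intro c x hx N
    obtain ⟨C, hC⟩ := hx N
    refine ⟨‖c‖ * C, fun a => ?_⟩
    change w a ^ N * ‖c • x a‖ ≤ _
    rw [norm_smul, mul_left_comm]
    exact mul_le_mul_of_nonneg_left (hC a) (norm_nonneg _)

theorem dense_decaySubmodule [DecidableEq α] (hw : ∀ a, 0 ≤ w a) :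
    Dense (decaySubmodule w hw : Set ℓ²(α, ℂ)) := by
  intro x
  refine mem_closure_of_tendsto (lp.hasSum_single (by norm_num : (2 : ENNReal) ≠ ⊤) x)
    (Eventually.of_forall fun s => ?_)
  refine Submodule.sum_mem _ fun b _ => ?_
  intro N
  refine ⟨w b ^ N * ‖x b‖, fun a => ?_⟩
  rcases eq_or_ne a b with rfl | h
  · simp
  · simp [h]
    exact mul_nonneg (pow_nonneg (hw b) N) (norm_nonneg _)

end RapidDecay

/-! ### Operators with finitely many matrix elements in each row -/

section LocalOperators

variable {α J : Type} [Fintype J]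

/-- The operator `f ↦ (a ↦ ∑ j, v j a * f (ν j a))`. -/
noncomputable def localOp (v : J → α → ℝ) (ν : J → α → α) : (α → ℂ) →ₗ[ℂ] (α → ℂ) where
  toFun f a := ∑ j, (v j a : ℂ) * f (ν j a)
  map_add' f g := by ext a; simp [mul_add, Finset.sum_add_distrib]
  map_smul' c f := by
    ext a
    simp only [Pi.smul_apply, smul_eq_mul, RingHom.id_apply, Finset.mul_sum]
    exact Finset.sum_congr rfl fun j _ => by ring

theorem localOp_apply (v : J → α → ℝ) (ν : J → α → α) (f : α → ℂ) (a : α) :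
    localOp v ν f a = ∑ j, (v j a : ℂ) * f (ν j a) := rfl

/-- The coefficients of the local operator grow at most linearly in the weight `w`, and the weight
changes by bounded factors only; the operator is symmetric. -/
structure IsSymmLocal (w : α → ℝ) (v : J → α → ℝ) (ν : J → α → α) : Prop where
  bound : ∃ K : ℝ, 0 ≤ K ∧ ∀ j a, |v j a| ≤ K * w a ∧ w a ≤ K * w (ν j a)
  trace_symm : ∀ X : α → α → ℂ, JointDecay w X →
    ∑' a, localOp v ν (fun b => X b a) a = ∑' a, localOp v ν (X a) a

variable {w : α → ℝ} {d : ℕ} {v : J → α → ℝ} {ν : J → α → α}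

/-- A local operator costs one power of the weight. The constant depends neither on `f` nor on `C`,
so the bound can be used uniformly in a second matrix index and in the transmittance. -/
theorem IsSymmLocal.exists_bound (hΛ : IsSymmLocal w v ν) (hw : IsSummableWeight w d) (N : ℕ) :
    ∃ K : ℝ, 0 ≤ K ∧ ∀ (f : α → ℂ) (C : ℝ), (∀ a, w a ^ (N + 1) * ‖f a‖ ≤ C) →
      ∀ a, w a ^ N * ‖localOp v ν f a‖ ≤ K * C := by
  obtain ⟨K, hK0, hK⟩ := hΛ.bound
  refine ⟨Fintype.card J * (K * K ^ (N + 1)), by positivity, fun f C hf a => ?_⟩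
  have hj : ∀ j, w a ^ N * ‖(v j a : ℂ) * f (ν j a)‖ ≤ K * K ^ (N + 1) * C := by
    intro j
    obtain ⟨h1, h2⟩ := hK j a
    have hwa := hw.pos a
    have hwν := hw.pos (ν j a)
    rw [norm_mul, Complex.norm_real, Real.norm_eq_abs]
    calc w a ^ N * (|v j a| * ‖f (ν j a)‖) ≤ w a ^ N * (K * w a * ‖f (ν j a)‖) := by gcongr
      _ = K * (w a ^ (N + 1) * ‖f (ν j a)‖) := by ring
      _ ≤ K * ((K * w (ν j a)) ^ (N + 1) * ‖f (ν j a)‖) := by gcongr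
      _ = K * K ^ (N + 1) * (w (ν j a) ^ (N + 1) * ‖f (ν j a)‖) := by ring
      _ ≤ K * K ^ (N + 1) * C := by gcongr; exact hf _
  rw [localOp_apply]
  calc w a ^ N * ‖∑ j, (v j a : ℂ) * f (ν j a)‖
      ≤ w a ^ N * ∑ j, ‖(v j a : ℂ) * f (ν j a)‖ :=
        mul_le_mul_of_nonneg_left (norm_sum_le _ _) (hw.pow_pos N a).le
    _ = ∑ j, w a ^ N * ‖(v j a : ℂ) * f (ν j a)‖ := Finset.mul_sum _ _ _
    _ ≤ ∑ _j : J, K * K ^ (N + 1) * C := Finset.sum_le_sum fun j _ => hj j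
    _ = Fintype.card J * (K * K ^ (N + 1)) * C := by simp [mul_assoc]

theorem IsSymmLocal.rapidDecay (hΛ : IsSymmLocal w v ν) (hw : IsSummableWeight w d) {f : α → ℂ}
    (hf : RapidDecay w f) : RapidDecay w (localOp v ν f) := fun N => by
  obtain ⟨K, -, hK⟩ := hΛ.exists_bound hw N
  obtain ⟨C, hC⟩ := hf (N + 1)
  exact ⟨K * C, hK f C hC⟩

theorem IsSymmLocal.jointDecay (hΛ : IsSymmLocal w v ν) (hw : IsSummableWeight w d)
    {X : α → α → ℂ} (hX : JointDecay w X) :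
    JointDecay w fun a b => localOp v ν (fun c => X c b) a := fun N => by
  obtain ⟨K, -, hK⟩ := hΛ.exists_bound hw N
  obtain ⟨C, hC⟩ := hX (N + 1)
  refine ⟨K * C, fun a b => ?_⟩
  -- The weight of the inactive index `b` is absorbed into the column before the one-index bound is
  -- applied.
  have h := hK (fun c => (w b ^ N : ℝ) * X c b) C (fun c => ?_) a
  · have e : localOp v ν (fun c => ((w b ^ N : ℝ) : ℂ) * X c b) =
        ((w b ^ N : ℝ) : ℂ) • localOp v ν (fun c => X c b) := by
      rw [← map_smul]; rfl
    rw [e, Pi.smul_apply, norm_smul, Complex.norm_real, Real.norm_of_nonneg (hw.pow_pos N b).le,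
      ← mul_assoc] at h
    exact h
  · refine le_trans ?_ (hC c b)
    rw [norm_mul, Complex.norm_real, Real.norm_of_nonneg (hw.pow_pos N b).le, ← mul_assoc]
    have := hw.one_le b
    have := hw.pos c
    gcongr
    exact Nat.le_succ N

/-- The rank-one case of `trace_symm`; it makes the unbounded operator Hermitian. -/
theorem IsSymmLocal.tsum_symm (hΛ : IsSymmLocal w v ν) (hw : IsSummableWeight w d) {f g : α → ℂ}
    (hf : RapidDecay w f) (hg : RapidDecay w g) :
    ∑' a, localOp v ν f a * g a = ∑' a, f a * localOp v ν g a := by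
  have h := hΛ.trace_symm _ (hf.mul_jointDecay hw hg)
  have e₁ : ∀ a, localOp v ν (fun b => f b * g a) a = localOp v ν f a * g a := fun a => by
    have : (fun b => f b * g a) = g a • f := by ext b; simp [mul_comm]
    rw [this, map_smul, Pi.smul_apply, smul_eq_mul, mul_comm]
  have e₂ : ∀ a, localOp v ν (fun b => f a * g b) a = f a * localOp v ν g a := fun a => by
    have : (fun b => f a * g b) = f a • g := by ext b; simp
    rw [this, map_smul, Pi.smul_apply, smul_eq_mul]
  simpa only [e₁, e₂] using h

theorem conj_localOp (f : α → ℂ) (a : α) :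
    conj (localOp v ν f a) = localOp v ν (fun b => conj (f b)) a := by
  simp [localOp_apply, map_sum, map_mul, Complex.conj_ofReal]

/-- The unbounded operator on `ℓ²` acting as a local operator on the rapidly decaying vectors. -/
noncomputable def IsSymmLocal.pmap (hΛ : IsSymmLocal w v ν) (hw : IsSummableWeight w d) :
    ℓ²(α, ℂ) →ₗ.[ℂ] ℓ²(α, ℂ) where
  domain := decaySubmodule w fun a => (hw.pos a).le
  toFun :=
    { toFun := fun x => ⟨localOp v ν x, (hΛ.rapidDecay hw x.2).memℓp hw⟩
      map_add' := fun x y => Subtype.ext (map_add (localOp v ν) (x : α → ℂ) y)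
      map_smul' := fun c x => Subtype.ext (map_smul (localOp v ν) c (x : α → ℂ)) }

theorem IsSymmLocal.pmap_apply (hΛ : IsSymmLocal w v ν) (hw : IsSummableWeight w d)
    (x : (hΛ.pmap hw).domain) (a : α) : hΛ.pmap hw x a = localOp v ν (x : ℓ²(α, ℂ)) a := rfl

theorem IsSymmLocal.pmap_mem (hΛ : IsSymmLocal w v ν) (hw : IsSummableWeight w d)
    (x : (hΛ.pmap hw).domain) : hΛ.pmap hw x ∈ (hΛ.pmap hw).domain :=
  hΛ.rapidDecay hw x.2

theorem JointDecay.lpOfMatrix_apply [DecidableEq α] (hw : IsSummableWeight w d) {X : α → α → ℂ}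
    (hX : JointDecay w X) (x : ℓ²(α, ℂ)) (a : α) : lpOfMatrix X x a = ∑' b, X a b * x b :=
  _root_.lpOfMatrix_apply (hX.summable_norm hw) x a

theorem JointDecay.hasTrace [DecidableEq α] (hw : IsSummableWeight w d) {X : α → α → ℂ}
    (hX : JointDecay w X) {t : ℂ} (ht : HasSum (fun a => X a a) t) : HasTrace (lpOfMatrix X) t :=
  hasTrace_lpOfMatrix (hX.summable_norm hw) ht

/-- This places the whole range of the state in the domain of the logarithmic derivative. Of the `N
+ d` powers available, `d` in the column index make the sum over `b` converge. -/
theorem JointDecay.rapidDecay_lpOfMatrix [DecidableEq α] (hw : IsSummableWeight w d) {X : α → α → ℂ}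
    (hX : JointDecay w X) (x : ℓ²(α, ℂ)) : RapidDecay w (lpOfMatrix X x) := fun N => by
  obtain ⟨C, hC⟩ := hX (N + d)
  have hC0 : ∀ a b, w a ^ N * ‖X a b * x b‖ ≤ C * ‖x‖ * (w b ^ d)⁻¹ := by
    intro a b
    have hx := lp.norm_apply_le_norm (by norm_num : (2 : ENNReal) ≠ 0) x b
    have hwa := hw.one_le a
    have hwb := hw.one_le b
    have hb := hw.pow_pos d b
    rw [← div_eq_mul_inv, le_div_iff₀ hb, norm_mul]
    calc w a ^ N * (‖X a b‖ * ‖x b‖) * w b ^ d ≤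
        w a ^ (N + d) * (‖X a b‖ * ‖x‖) * w b ^ (N + d) := by
          gcongr <;> omega
      _ = w a ^ (N + d) * w b ^ (N + d) * ‖X a b‖ * ‖x‖ := by ring
      _ ≤ C * ‖x‖ := by gcongr; exact hC a b
  refine ⟨∑' b, C * ‖x‖ * (w b ^ d)⁻¹, fun a => ?_⟩
  rw [hX.lpOfMatrix_apply hw]
  have hs : Summable fun b => w a ^ N * ‖X a b * x b‖ :=
    Summable.of_nonneg_of_le (fun b => mul_nonneg (hw.pow_pos N a).le (norm_nonneg _)) (hC0 a)
      (hw.summable.mul_left _)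
  have hs' : Summable fun b => ‖X a b * x b‖ :=
    (summable_mul_left_iff (hw.pow_pos N a).ne').mp hs
  calc w a ^ N * ‖∑' b, X a b * x b‖ ≤ w a ^ N * ∑' b, ‖X a b * x b‖ :=
        mul_le_mul_of_nonneg_left (norm_tsum_le_tsum_norm hs') (hw.pow_pos N a).le
    _ = ∑' b, w a ^ N * ‖X a b * x b‖ := tsum_mul_left.symm
    _ ≤ _ := hs.tsum_le_tsum (hC0 a) (hw.summable.mul_left _)

theorem JointDecay.summable_row_mul (hw : IsSummableWeight w d) {X : α → α → ℂ}
    (hX : JointDecay w X) (x : ℓ²(α, ℂ)) (a : α) : Summable fun b => X a b * x b := by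
  refine Summable.of_norm (Summable.of_nonneg_of_le (fun _ => norm_nonneg _) (fun b => ?_)
    (((hX.row hw a).summable_norm hw).mul_right ‖x‖))
  rw [norm_mul]
  exact mul_le_mul_of_nonneg_left (lp.norm_apply_le_norm (by norm_num) x b) (norm_nonneg _)

/-- Each row of `Λ` is finite, so `Λ` passes through the series. Hence `L S` and `L² S` are again
operators with rapidly decaying matrices. -/
theorem IsSymmLocal.localOp_lpOfMatrix [DecidableEq α] (hΛ : IsSymmLocal w v ν) (hw : IsSummableWeight w d)
    {X : α → α → ℂ} (hX : JointDecay w X) (x : ℓ²(α, ℂ)) :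
    localOp v ν (lpOfMatrix X x) = lpOfMatrix (fun a b => localOp v ν (fun c => X c b) a) x := by
  ext a
  rw [(hΛ.jointDecay hw hX).lpOfMatrix_apply hw, localOp_apply]
  simp only [localOp_apply, Finset.sum_mul, hX.lpOfMatrix_apply hw]
  rw [Summable.tsum_finsetSum]
  · refine Finset.sum_congr rfl fun j _ => ?_
    rw [← tsum_mul_left]
    exact tsum_congr fun b => by ring
  · intro j _
    simpa only [mul_assoc] using (hX.summable_row_mul hw x (ν j a)).mul_left (v j a : ℂ)

/-- Existence of the quantum Fisher information for a family of rapidly decaying matrices with a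
symmetric logarithmic derivative that is a local operator. -/
theorem hasQFI_of_localOp [DecidableEq α] (hΛ : IsSymmLocal w v ν) (hw : IsSummableWeight w d)
    {M : ℝ → Matrix α α ℂ} {m m' : ℝ → α → α → ℂ} {U : Set ℝ} {θ J : ℝ} {C : ℝ}
    (hU : IsOpen U) (hU' : IsPreconnected U) (hθ : θ ∈ U)
    (hM : ∀ t ∈ U, ∀ a b, M t a b = m t a b)
    (hd : ∀ a b, ∀ t ∈ U, HasDerivAt (fun t => m t a b) (m' t a b) t)
    (hm : ∀ t ∈ U, JointDecay w (m t)) (hm' : JointDecay w (m' θ))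
    (hb : ∀ t ∈ U, ∀ a b, w a ^ d * w b ^ d * ‖m' t a b‖ ≤ C)
    (hsld : ∀ a b, 2 * m' θ a b = localOp v ν (fun c => m θ c b) a + localOp v ν (m θ a) b)
    (hJ : HasSum (fun a => localOp v ν (fun c => localOp v ν (fun c' => m θ c' a) c) a) (J : ℂ)) :
    HasQFI M θ J := by
  have hmθ := hm θ hθ
  have hsld' : IsSLD (lpOfMatrix (m θ)) (lpOfMatrix (m' θ)) (hΛ.pmap hw) :=
    { dense := dense_decaySubmodule fun a => (hw.pos a).le
      hermitian := by
        intro x y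
        rw [lp.inner_eq_tsum, lp.inner_eq_tsum]
        simp only [RCLike.inner_apply, hΛ.pmap_apply, conj_localOp]
        have := hΛ.tsum_symm hw (RapidDecay.conj x.2) y.2
        simpa only [mul_comm] using this
      mem_domain := fun x => hmθ.rapidDecay_lpOfMatrix hw x
      sld_eq := by
        intro x
        ext a
        -- Symmetry moves `Λ` from the vector onto the row of the matrix, so that `S L` too acts
        -- through a matrix and the equation can be compared entrywise.
        have h1 : lpOfMatrix (m θ) (hΛ.pmap hw x) a = ∑' b, localOp v ν (m θ a) b * x.1 b := by
          rw [hmθ.lpOfMatrix_apply hw, hΛ.tsum_symm hw (hmθ.row hw a) x.2]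
          rfl
        have h2 : hΛ.pmap hw ⟨lpOfMatrix (m θ) x, hmθ.rapidDecay_lpOfMatrix hw x⟩ a =
            ∑' b, localOp v ν (fun c => m θ c b) a * x.1 b := by
          rw [hΛ.pmap_apply hw, hΛ.localOp_lpOfMatrix hw hmθ,
            (hΛ.jointDecay hw hmθ).lpOfMatrix_apply hw]
        have hs1 : Summable fun b => localOp v ν (m θ a) b * x.1 b :=
          (hΛ.jointDecay hw hmθ.swap).swap.summable_row_mul hw x.1 a
        have hs2 : Summable fun b => localOp v ν (fun c => m θ c b) a * x.1 b :=
          (hΛ.jointDecay hw hmθ).summable_row_mul hw x.1 a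
        change _ = (1 / 2 : ℂ) • (hΛ.pmap hw ⟨lpOfMatrix (m θ) x, _⟩ a +
          lpOfMatrix (m θ) (hΛ.pmap hw x) a)
        rw [h1, h2, hm'.lpOfMatrix_apply hw, ← hs2.tsum_add hs1, smul_eq_mul,
          ← tsum_mul_left]
        refine tsum_congr fun b => ?_
        rw [← add_mul, ← hsld]
        ring }
  refine ⟨fun t => lpOfMatrix (m t), lpOfMatrix (m' θ), hΛ.pmap hw, hsld',
    fun x => hΛ.pmap_mem hw _, ?_, ?_, ?_⟩
  · filter_upwards [hU.mem_nhds hθ] with t ht a b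
    rw [hM t ht, hasMatrix_lpOfMatrix ((hm t ht).summable_norm hw)]
  · exact hasDerivAt_lpOfMatrix (hw.summable_prod C) hU hU' hθ hd
      (fun a b t ht => hw.norm_le_of_bound (hb t ht) a b) (hmθ.summable_norm hw)
  · have hj1 := hΛ.jointDecay hw hmθ
    have hj2 := hΛ.jointDecay hw hj1
    have ht := hj2.hasTrace hw hJ
    convert ht using 1
    ext x a
    rw [hΛ.pmap_apply hw]
    change localOp v ν (localOp v ν (lpOfMatrix (m θ) x)) a = _
    rw [hΛ.localOp_lpOfMatrix hw hmθ, hΛ.localOp_lpOfMatrix hw hj1]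

end LocalOperators

/-! ### Ladder relations of the beamsplitter amplitudes -/

section Beamsplitter

open Polynomial in
/-- `(τ X - ρ)^s (ρ X + τ)^k` -/
noncomputable def ladderPoly (τ ρ : ℝ) (s k : ℕ) : Polynomial ℝ :=
  (C τ * X - C ρ) ^ s * (C ρ * X + C τ) ^ k

open Polynomial in
theorem ladderPoly_succ_left (τ ρ : ℝ) (s k : ℕ) :
    ladderPoly τ ρ (s + 1) k = C τ * (ladderPoly τ ρ s k * X) - C ρ * ladderPoly τ ρ s k := by
  unfold ladderPoly; ring

open Polynomial in
theorem ladderPoly_succ_right (τ ρ : ℝ) (s k : ℕ) :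
    ladderPoly τ ρ s (k + 1) = C ρ * (ladderPoly τ ρ s k * X) + C τ * ladderPoly τ ρ s k := by
  unfold ladderPoly; ring

open Polynomial in
theorem derivative_ladderPoly (τ ρ : ℝ) (s k : ℕ) :
    derivative (ladderPoly τ ρ s k) = C (s * τ) * ladderPoly τ ρ (s - 1) k +
      C (k * ρ) * ladderPoly τ ρ s (k - 1) := by
  unfold ladderPoly
  simp only [derivative_mul, derivative_pow, derivative_sub, derivative_add, derivative_C,
    derivative_X, map_mul, map_natCast]
  ring

open Polynomial in
-- Euler's identity: the polynomial is a form of degree `s + k` in `(a†, e†)` restricted to `e† =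
-- 1`, and degree minus `X d/dX` is its derivative in `e†`.
theorem ladderPoly_euler (τ ρ : ℝ) (s k : ℕ) :
    C ((s + k : ℕ) : ℝ) * ladderPoly τ ρ s k - derivative (ladderPoly τ ρ s k) * X =
      C (-(s * ρ)) * ladderPoly τ ρ (s - 1) k + C (k * τ) * ladderPoly τ ρ s (k - 1) := by
  rw [derivative_ladderPoly]
  have h1 : C (s : ℝ) * ladderPoly τ ρ s k =
      C (s : ℝ) * (C τ * (ladderPoly τ ρ (s - 1) k * X) - C ρ * ladderPoly τ ρ (s - 1) k) := by
    rcases s with _ | s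
    · simp
    · rw [ladderPoly_succ_left]; simp
  have h2 : C (k : ℝ) * ladderPoly τ ρ s k =
      C (k : ℝ) * (C ρ * (ladderPoly τ ρ s (k - 1) * X) + C τ * ladderPoly τ ρ s (k - 1)) := by
    rcases k with _ | k
    · simp
    · rw [ladderPoly_succ_right]; simp
  push_cast [map_add, map_mul, map_neg] at *
  linear_combination h1 + h2

open Polynomial in
theorem natDegree_ladderPoly_le (τ ρ : ℝ) (s k : ℕ) : (ladderPoly τ ρ s k).natDegree ≤ s + k := by
  unfold ladderPoly
  refine natDegree_mul_le.trans (add_le_add ?_ ?_)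
  · refine natDegree_pow_le.trans ?_
    have : (C τ * X - C ρ).natDegree ≤ 1 := by compute_degree
    nlinarith
  · refine natDegree_pow_le.trans ?_
    have : (C ρ * X + C τ).natDegree ≤ 1 := by compute_degree
    nlinarith

theorem sqrt_factorial_succ (x : ℕ) : √((x + 1)! : ℝ) = √(x + 1 : ℝ) * √(x ! : ℝ) := by
  rw [Nat.factorial_succ, Nat.cast_mul, Real.sqrt_mul (by positivity)]
  push_cast; rfl

theorem beamsplitterAmp_of_eq (θ : ℝ) {r l s k : ℕ} (h : r + l = s + k) :
    beamsplitterAmp θ r l s k = √(r ! : ℝ) * √(l ! : ℝ) / (√(s ! : ℝ) * √(k ! : ℝ)) *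
      (ladderPoly √θ √(1 - θ) s k).coeff r := by
  rw [beamsplitterAmp, if_pos h, Real.sqrt_div (by positivity), Real.sqrt_mul (by positivity),
    Real.sqrt_mul (by positivity)]
  rfl

theorem beamsplitterAmp_of_ne (θ : ℝ) {r l s k : ℕ} (h : r + l ≠ s + k) :
    beamsplitterAmp θ r l s k = 0 := if_neg h

/-- Splitting off one linear factor of the generating polynomial: `U a† = (√θ a† - √(1-θ) e†) U`. -/
theorem beamsplitterAmp_succ_signal (θ : ℝ) (r l s k : ℕ) :
    √(s + 1 : ℝ) * beamsplitterAmp θ r l (s + 1) k =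
      √θ * (√(r : ℝ) * beamsplitterAmp θ (r - 1) l s k) -
        √(1 - θ) * (√(l : ℝ) * beamsplitterAmp θ r (l - 1) s k) := by
  have hs : √(s ! : ℝ) ≠ 0 := by positivity
  have hk : √(k ! : ℝ) ≠ 0 := by positivity
  have hs1 : √(s + 1 : ℝ) ≠ 0 := by positivity
  by_cases h : r + l = s + 1 + k
  · rw [beamsplitterAmp_of_eq θ h, ladderPoly_succ_left, sqrt_factorial_succ s]
    rcases r with _ | r
    · rcases l with _ | l
      · omega
      · rw [beamsplitterAmp_of_eq θ (by omega : 0 + (l + 1 - 1) = s + k), sqrt_factorial_succ l]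
        simp
        field_simp
    · rw [beamsplitterAmp_of_eq θ (by omega : r + 1 - 1 + l = s + k), sqrt_factorial_succ r]
      rcases l with _ | l
      -- With `l = 0` one has `r = s + k`, so this coefficient lies just above the degree, matching
      -- the factor `√l = 0`.
      · have h0 : (ladderPoly √θ √(1 - θ) s k).coeff (r + 1) = 0 :=
          Polynomial.coeff_eq_zero_of_natDegree_lt
            ((natDegree_ladderPoly_le _ _ _ _).trans_lt (by omega))
        simp [h0]
        field_simp
      · rw [beamsplitterAmp_of_eq θ (by omega : r + 1 + (l + 1 - 1) = s + k), sqrt_factorial_succ l,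
          sqrt_factorial_succ r]
        simp
        field_simp
  · rw [beamsplitterAmp_of_ne θ h]
    rcases r with _ | r
    · rcases l with _ | l
      · simp
      · rw [beamsplitterAmp_of_ne θ (l := l + 1 - 1) (by omega)]; simp
    · rw [beamsplitterAmp_of_ne θ (r := r + 1 - 1) (by omega)]
      rcases l with _ | l
      · simp
      · rw [beamsplitterAmp_of_ne θ (l := l + 1 - 1) (by omega)]; simp

theorem beamsplitterAmp_succ_env (θ : ℝ) (r l s k : ℕ) :
    √(k + 1 : ℝ) * beamsplitterAmp θ r l s (k + 1) =
      √(1 - θ) * (√(r : ℝ) * beamsplitterAmp θ (r - 1) l s k) +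
        √θ * (√(l : ℝ) * beamsplitterAmp θ r (l - 1) s k) := by
  have hs : √(s ! : ℝ) ≠ 0 := by positivity
  have hk : √(k ! : ℝ) ≠ 0 := by positivity
  have hk1 : √(k + 1 : ℝ) ≠ 0 := by positivity
  by_cases h : r + l = s + (k + 1)
  · rw [beamsplitterAmp_of_eq θ h, ladderPoly_succ_right, sqrt_factorial_succ k]
    rcases r with _ | r
    · rcases l with _ | l
      · omega
      · rw [beamsplitterAmp_of_eq θ (by omega : 0 + (l + 1 - 1) = s + k), sqrt_factorial_succ l]
        simp
        field_simp
    · rw [beamsplitterAmp_of_eq θ (by omega : r + 1 - 1 + l = s + k), sqrt_factorial_succ r]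
      rcases l with _ | l
      · have h0 : (ladderPoly √θ √(1 - θ) s k).coeff (r + 1) = 0 :=
          Polynomial.coeff_eq_zero_of_natDegree_lt
            ((natDegree_ladderPoly_le _ _ _ _).trans_lt (by omega))
        simp [h0]
        field_simp
      · rw [beamsplitterAmp_of_eq θ (by omega : r + 1 + (l + 1 - 1) = s + k), sqrt_factorial_succ l,
          sqrt_factorial_succ r]
        simp
        field_simp
  · rw [beamsplitterAmp_of_ne θ h]
    rcases r with _ | r
    · rcases l with _ | l
      · simp
      · rw [beamsplitterAmp_of_ne θ (l := l + 1 - 1) (by omega)]; simp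
    · rw [beamsplitterAmp_of_ne θ (r := r + 1 - 1) (by omega)]
      rcases l with _ | l
      · simp
      · rw [beamsplitterAmp_of_ne θ (l := l + 1 - 1) (by omega)]; simp

/-- The amplitude with the input photon number lowered, times the root of the photon number. -/
theorem sqrt_mul_beamsplitterAmp_pred_signal (θ : ℝ) {r l s k : ℕ} (h : r + l + 1 = s + k) :
    √(s : ℝ) * beamsplitterAmp θ r l (s - 1) k = √(r ! : ℝ) * √(l ! : ℝ) / (√(s ! : ℝ) * √(k ! : ℝ)) *
      (s * (ladderPoly √θ √(1 - θ) (s - 1) k).coeff r) := by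
  rcases s with _ | s
  · simp
  · have hs : √(s ! : ℝ) ≠ 0 := by positivity
    have hk : √(k ! : ℝ) ≠ 0 := by positivity
    have hs1 : √(s + 1 : ℝ) ≠ 0 := by positivity
    have hs2 : √(s + 1 : ℝ) ^ 2 = s + 1 := Real.sq_sqrt (by positivity)
    rw [beamsplitterAmp_of_eq θ (by omega : r + l = s + 1 - 1 + k), sqrt_factorial_succ s]
    simp only [Nat.add_sub_cancel, Nat.cast_add, Nat.cast_one]
    field_simp
    rw [hs2]

theorem sqrt_mul_beamsplitterAmp_pred_env (θ : ℝ) {r l s k : ℕ} (h : r + l + 1 = s + k) :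
    √(k : ℝ) * beamsplitterAmp θ r l s (k - 1) = √(r ! : ℝ) * √(l ! : ℝ) / (√(s ! : ℝ) * √(k ! : ℝ)) *
      (k * (ladderPoly √θ √(1 - θ) s (k - 1)).coeff r) := by
  rcases k with _ | k
  · simp
  · have hs : √(s ! : ℝ) ≠ 0 := by positivity
    have hk : √(k ! : ℝ) ≠ 0 := by positivity
    have hk1 : √(k + 1 : ℝ) ≠ 0 := by positivity
    have hk2 : √(k + 1 : ℝ) ^ 2 = k + 1 := Real.sq_sqrt (by positivity)
    rw [beamsplitterAmp_of_eq θ (by omega : r + l = s + (k + 1 - 1)), sqrt_factorial_succ k]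
    simp only [Nat.add_sub_cancel, Nat.cast_add, Nat.cast_one]
    field_simp
    rw [hk2]

theorem sqrt_mul_beamsplitterAmp_pred_of_ne (θ : ℝ) {r l s k : ℕ} (h : r + l + 1 ≠ s + k) :
    √(s : ℝ) * beamsplitterAmp θ r l (s - 1) k = 0 ∧
      √(k : ℝ) * beamsplitterAmp θ r l s (k - 1) = 0 := by
  constructor
  · rcases s with _ | s
    · simp
    · rw [beamsplitterAmp_of_ne θ (s := s + 1 - 1) (by omega), mul_zero]
  · rcases k with _ | k
    · simp
    · rw [beamsplitterAmp_of_ne θ (k := k + 1 - 1) (by omega), mul_zero]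

/-- Comparing coefficients in the derivative of the generating polynomial: `a U = U (√θ a + √(1-θ)
e)`. The lost mode is treated the same way with Euler's identity in place of the derivative. -/
theorem beamsplitterAmp_succ_returned (θ : ℝ) (r l s k : ℕ) :
    √(r + 1 : ℝ) * beamsplitterAmp θ (r + 1) l s k =
      √θ * (√(s : ℝ) * beamsplitterAmp θ r l (s - 1) k) +
        √(1 - θ) * (√(k : ℝ) * beamsplitterAmp θ r l s (k - 1)) := by
  by_cases h : r + l + 1 = s + k
  · have hr2 : √(r + 1 : ℝ) * √(r + 1 : ℝ) = r + 1 := Real.mul_self_sqrt (by positivity)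
    have hd := congrArg (fun p => Polynomial.coeff p r) (derivative_ladderPoly √θ √(1 - θ) s k)
    simp only [Polynomial.coeff_derivative, Polynomial.coeff_add, Polynomial.coeff_C_mul] at hd
    rw [sqrt_mul_beamsplitterAmp_pred_signal θ h, sqrt_mul_beamsplitterAmp_pred_env θ h,
      beamsplitterAmp_of_eq θ (by omega : r + 1 + l = s + k), sqrt_factorial_succ r]
    linear_combination (√(r ! : ℝ) * √(l ! : ℝ) / (√(s ! : ℝ) * √(k ! : ℝ))) * hd +
      (√(r ! : ℝ) * √(l ! : ℝ) / (√(s ! : ℝ) * √(k ! : ℝ))) *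
        (ladderPoly √θ √(1 - θ) s k).coeff (r + 1) * hr2
  · obtain ⟨h1, h2⟩ := sqrt_mul_beamsplitterAmp_pred_of_ne θ h
    rw [h1, h2, beamsplitterAmp_of_ne θ (by omega)]
    simp

theorem beamsplitterAmp_succ_lost (θ : ℝ) (r l s k : ℕ) :
    √(l + 1 : ℝ) * beamsplitterAmp θ r (l + 1) s k =
      -(√(1 - θ) * (√(s : ℝ) * beamsplitterAmp θ r l (s - 1) k)) +
        √θ * (√(k : ℝ) * beamsplitterAmp θ r l s (k - 1)) := by
  by_cases h : r + l + 1 = s + k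
  · have hl2 : √(l + 1 : ℝ) * √(l + 1 : ℝ) = l + 1 := Real.mul_self_sqrt (by positivity)
    have hd := congrArg (fun p => Polynomial.coeff p r) (ladderPoly_euler √θ √(1 - θ) s k)
    have hx : (Polynomial.derivative (ladderPoly √θ √(1 - θ) s k) * Polynomial.X).coeff r =
        r * (ladderPoly √θ √(1 - θ) s k).coeff r := by
      rcases r with _ | r
      · simp
      · rw [Polynomial.coeff_mul_X, Polynomial.coeff_derivative]; push_cast; ring
    simp only [Polynomial.coeff_sub, Polynomial.coeff_add, Polynomial.coeff_C_mul, hx] at hd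
    -- Photon conservation replaces the degree `s + k` by `r + l + 1`, so the Euler factor minus `r`
    -- becomes `l + 1`.
    rw [← h] at hd
    push_cast at hd
    rw [sqrt_mul_beamsplitterAmp_pred_signal θ h, sqrt_mul_beamsplitterAmp_pred_env θ h,
      beamsplitterAmp_of_eq θ (by omega : r + (l + 1) = s + k), sqrt_factorial_succ l]
    linear_combination (√(r ! : ℝ) * √(l ! : ℝ) / (√(s ! : ℝ) * √(k ! : ℝ))) * hd +
      (√(r ! : ℝ) * √(l ! : ℝ) / (√(s ! : ℝ) * √(k ! : ℝ))) *
        (ladderPoly √θ √(1 - θ) s k).coeff r * hl2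
  · obtain ⟨h1, h2⟩ := sqrt_mul_beamsplitterAmp_pred_of_ne θ h
    rw [h1, h2, beamsplitterAmp_of_ne θ (by omega)]
    simp

/-- The beamsplitter is an isometry. -/
theorem sum_antidiagonal_beamsplitterAmp_sq {θ : ℝ} (h0 : 0 ≤ θ) (h1 : θ ≤ 1) (s k : ℕ) :
    ∑ p ∈ Finset.HasAntidiagonal.antidiagonal (s + k), beamsplitterAmp θ p.1 p.2 s k ^ 2 = 1 := by
  have hτ : √θ ^ 2 = θ := Real.sq_sqrt h0
  have hρ : √(1 - θ) ^ 2 = 1 - θ := Real.sq_sqrt (by linarith)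
  induction s with
  | zero =>
    induction k with
    | zero => simp [beamsplitterAmp]
    | succ k ih =>
      rw [← ih]
      have hk : √(k + 1 : ℝ) ≠ 0 := by positivity
      refine mul_left_cancel₀ hk ?_
      rw [Finset.mul_sum, Finset.mul_sum]
      have e : ∀ p : ℕ × ℕ, √(k + 1 : ℝ) * beamsplitterAmp θ p.1 p.2 0 (k + 1) ^ 2 =
          √(1 - θ) * (√(p.1 : ℝ) * beamsplitterAmp θ (p.1 - 1) p.2 0 k) *
            beamsplitterAmp θ p.1 p.2 0 (k + 1) +
          √θ * (√(p.2 : ℝ) * beamsplitterAmp θ p.1 (p.2 - 1) 0 k) *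
            beamsplitterAmp θ p.1 p.2 0 (k + 1) := fun p => by
        rw [← add_mul, ← beamsplitterAmp_succ_env]; ring
      rw [Finset.sum_congr rfl fun p _ => e p, Finset.sum_add_distrib, ← add_assoc,
        Finset.Nat.sum_antidiagonal_succ, Finset.Nat.sum_antidiagonal_succ']
      simp only [Nat.cast_zero, Real.sqrt_zero, zero_mul, mul_zero, zero_add,
        Nat.add_sub_cancel, ← Finset.sum_add_distrib]
      refine Finset.sum_congr rfl fun p _ => ?_
      have hr := beamsplitterAmp_succ_returned θ p.1 p.2 0 (k + 1)
      have hl := beamsplitterAmp_succ_lost θ p.1 p.2 0 (k + 1)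
      push_cast [Nat.add_sub_cancel] at hr hl ⊢
      linear_combination √(1 - θ) * beamsplitterAmp θ p.1 p.2 0 k * hr +
        √θ * beamsplitterAmp θ p.1 p.2 0 k * hl +
        √(k + 1 : ℝ) * beamsplitterAmp θ p.1 p.2 0 k ^ 2 * (hτ + hρ)
  | succ s ih =>
    rw [← ih]
    have hs : √(s + 1 : ℝ) ≠ 0 := by positivity
    refine mul_left_cancel₀ hs ?_
    rw [Finset.mul_sum, Finset.mul_sum]
    -- One of the two factors is expanded by the creation relation. After shifting the two sums, the
    -- annihilation relations act on the other factor; the cross terms cancel and `θ + (1 - θ) = 1`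
    -- remains.
    have e : ∀ p : ℕ × ℕ, √(s + 1 : ℝ) * beamsplitterAmp θ p.1 p.2 (s + 1) k ^ 2 =
        √θ * (√(p.1 : ℝ) * beamsplitterAmp θ (p.1 - 1) p.2 s k) *
          beamsplitterAmp θ p.1 p.2 (s + 1) k +
        -(√(1 - θ) * (√(p.2 : ℝ) * beamsplitterAmp θ p.1 (p.2 - 1) s k) *
          beamsplitterAmp θ p.1 p.2 (s + 1) k) := fun p => by
      rw [← sub_eq_add_neg, ← sub_mul, ← beamsplitterAmp_succ_signal]; ring
    rw [Finset.sum_congr rfl fun p _ => e p, Finset.sum_add_distrib, add_right_comm,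
      Finset.Nat.sum_antidiagonal_succ, Finset.Nat.sum_antidiagonal_succ']
    simp only [Nat.cast_zero, Real.sqrt_zero, zero_mul, mul_zero, zero_add, neg_zero,
      Nat.add_sub_cancel, ← Finset.sum_add_distrib]
    refine Finset.sum_congr rfl fun p _ => ?_
    have hr := beamsplitterAmp_succ_returned θ p.1 p.2 (s + 1) k
    have hl := beamsplitterAmp_succ_lost θ p.1 p.2 (s + 1) k
    push_cast [Nat.add_sub_cancel] at hr hl ⊢
    linear_combination √θ * beamsplitterAmp θ p.1 p.2 s k * hr -
      √(1 - θ) * beamsplitterAmp θ p.1 p.2 s k * hl +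
      √(s + 1 : ℝ) * beamsplitterAmp θ p.1 p.2 s k ^ 2 * (hτ + hρ)

theorem abs_beamsplitterAmp_le_one {θ : ℝ} (h0 : 0 ≤ θ) (h1 : θ ≤ 1) (r l s k : ℕ) :
    |beamsplitterAmp θ r l s k| ≤ 1 := by
  by_cases h : r + l = s + k
  · rw [← sq_le_one_iff_abs_le_one, ← sum_antidiagonal_beamsplitterAmp_sq h0 h1 s k]
    exact Finset.single_le_sum (f := fun p : ℕ × ℕ => beamsplitterAmp θ p.1 p.2 s k ^ 2)
      (fun _ _ => sq_nonneg _) (Finset.HasAntidiagonal.mem_antidiagonal.mpr h : (r, l) ∈ _)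
  · simp [beamsplitterAmp_of_ne θ h]

end Beamsplitter

/-! ### The trace over a thermal environment -/

section Environment

/-- Photon conservation leaves at most one `l` for each `k`, so the double series is a geometric
series with a linear factor. -/
theorem summable_of_support_diag {h : ℕ × ℕ → ℝ} {q : ℝ} (hq0 : 0 ≤ q) (hq1 : q < 1) {r i : ℕ}
    (hsupp : ∀ k l, r + l ≠ i + k → h (k, l) = 0)
    (hb : ∀ k l, |h (k, l)| ≤ q ^ k * (k + l + 1 : ℕ)) : Summable h := by
  -- The truncated difference leaves the support line when `i + k < r`; this is harmless, since the
  -- map stays injective and the bound holds everywhere.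
  have hinj : Function.Injective fun k : ℕ => (k, i + k - r) := fun a b hab => (Prod.ext_iff.mp hab).1
  refine (hinj.summable_iff ?_).mp ?_
  · rintro ⟨k, l⟩ hkl
    refine hsupp k l fun e => hkl ⟨k, ?_⟩
    simp only [Prod.mk.injEq, true_and]
    omega
  · have hq : ‖q‖ < 1 := by rwa [Real.norm_of_nonneg hq0]
    have h1 := (summable_pow_mul_geometric_of_norm_lt_one 1 hq).mul_left 2
    have h0 := (summable_geometric_of_norm_lt_one hq).mul_left ((i : ℝ) + 1)
    refine Summable.of_norm_bounded (h1.add h0) fun k => ?_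
    refine (hb k (i + k - r)).trans ?_
    have : ((k + (i + k - r) + 1 : ℕ) : ℝ) ≤ 2 * k + i + 1 := by
      exact_mod_cast (by omega : k + (i + k - r) + 1 ≤ 2 * k + i + 1)
    calc q ^ k * ((k + (i + k - r) + 1 : ℕ) : ℝ) ≤ q ^ k * (2 * k + i + 1) := by gcongr
      _ = _ := by ring

theorem sqrt_natCast_le (l : ℕ) : √(l : ℝ) ≤ l := by
  rcases l with _ | l
  · simp
  · rw [Real.sqrt_le_left (by positivity)]
    push_cast
    nlinarith [(Nat.cast_nonneg l : (0 : ℝ) ≤ l)]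

/-- `∑ q^k ⟨r, l|U|i, k⟩ ⟨s, l|U|j, k⟩` over the environment photon numbers `k, l`. -/
noncomputable def envOverlap (q θ : ℝ) (i r j s : ℕ) : ℝ :=
  ∑' p : ℕ × ℕ, q ^ p.1 * (beamsplitterAmp θ r p.2 i p.1 * beamsplitterAmp θ s p.2 j p.1)

/-- The overlap with a photon created in the lost mode on the left. -/
noncomputable def envOverlapLost (q θ : ℝ) (i r j s : ℕ) : ℝ :=
  ∑' p : ℕ × ℕ, q ^ p.1 *
    (√(p.2 : ℝ) * beamsplitterAmp θ r (p.2 - 1) i p.1 * beamsplitterAmp θ s p.2 j p.1)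

/-- The overlap with a photon created in the environment on the right. -/
noncomputable def envOverlapEnv (q θ : ℝ) (i r i' r' : ℕ) : ℝ :=
  ∑' p : ℕ × ℕ, q ^ p.1 *
    (beamsplitterAmp θ r p.2 i p.1 * (√(p.1 : ℝ) * beamsplitterAmp θ r' p.2 i' (p.1 - 1)))

variable {q θ : ℝ}

theorem envOverlap_symm (i r i' r' : ℕ) : envOverlap q θ i r i' r' = envOverlap q θ i' r' i r :=
  tsum_congr fun p => by ring

theorem summable_envOverlap (hq0 : 0 ≤ q) (hq1 : q < 1) (h0 : 0 ≤ θ) (h1 : θ ≤ 1)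
    (i r i' r' : ℕ) : Summable fun p : ℕ × ℕ => q ^ p.1 *
      (beamsplitterAmp θ r p.2 i p.1 * beamsplitterAmp θ r' p.2 i' p.1) := by
  refine summable_of_support_diag hq0 hq1 (r := r) (i := i) (fun k l h => ?_) fun k l => ?_
  · simp [beamsplitterAmp_of_ne θ h]
  · rw [abs_mul, abs_of_nonneg (pow_nonneg hq0 k), abs_mul]
    have ha := abs_beamsplitterAmp_le_one h0 h1 r l i k
    have hb := abs_beamsplitterAmp_le_one h0 h1 r' l i' k
    have : |beamsplitterAmp θ r l i k| * |beamsplitterAmp θ r' l i' k| ≤ ((k + l + 1 : ℕ) : ℝ) := by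
      push_cast
      nlinarith [abs_nonneg (beamsplitterAmp θ r l i k), abs_nonneg (beamsplitterAmp θ r' l i' k),
        (Nat.cast_nonneg l : (0 : ℝ) ≤ l), (Nat.cast_nonneg k : (0 : ℝ) ≤ k)]
    exact mul_le_mul_of_nonneg_left this (pow_nonneg hq0 k)

theorem summable_envOverlapLost (hq0 : 0 ≤ q) (hq1 : q < 1) (h0 : 0 ≤ θ) (h1 : θ ≤ 1)
    (i r i' r' : ℕ) : Summable fun p : ℕ × ℕ => q ^ p.1 *
      (√(p.2 : ℝ) * beamsplitterAmp θ r (p.2 - 1) i p.1 * beamsplitterAmp θ r' p.2 i' p.1) := by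
  refine summable_of_support_diag hq0 hq1 (r := r') (i := i') (fun k l h => ?_) fun k l => ?_
  · simp [beamsplitterAmp_of_ne θ h]
  · rw [abs_mul, abs_of_nonneg (pow_nonneg hq0 k), abs_mul, abs_mul,
      abs_of_nonneg (Real.sqrt_nonneg _)]
    have ha := abs_beamsplitterAmp_le_one h0 h1 r (l - 1) i k
    have hb := abs_beamsplitterAmp_le_one h0 h1 r' l i' k
    have hl := sqrt_natCast_le l
    have : √(l : ℝ) * |beamsplitterAmp θ r (l - 1) i k| * |beamsplitterAmp θ r' l i' k| ≤
        ((k + l + 1 : ℕ) : ℝ) := by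
      calc _ ≤ (l : ℝ) * 1 * 1 := by gcongr
        _ ≤ _ := by push_cast; linarith [(Nat.cast_nonneg k : (0 : ℝ) ≤ k)]
    exact mul_le_mul_of_nonneg_left this (pow_nonneg hq0 k)

theorem summable_envOverlapEnv (hq0 : 0 ≤ q) (hq1 : q < 1) (h0 : 0 ≤ θ) (h1 : θ ≤ 1)
    (i r i' r' : ℕ) : Summable fun p : ℕ × ℕ => q ^ p.1 *
      (beamsplitterAmp θ r p.2 i p.1 * (√(p.1 : ℝ) * beamsplitterAmp θ r' p.2 i' (p.1 - 1))) := by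
  refine summable_of_support_diag hq0 hq1 (r := r) (i := i) (fun k l h => ?_) fun k l => ?_
  · simp [beamsplitterAmp_of_ne θ h]
  · rw [abs_mul, abs_of_nonneg (pow_nonneg hq0 k), abs_mul, abs_mul,
      abs_of_nonneg (Real.sqrt_nonneg _)]
    have ha := abs_beamsplitterAmp_le_one h0 h1 r l i k
    have hb := abs_beamsplitterAmp_le_one h0 h1 r' l i' (k - 1)
    have hk := sqrt_natCast_le k
    have : |beamsplitterAmp θ r l i k| * (√(k : ℝ) * |beamsplitterAmp θ r' l i' (k - 1)|) ≤
        ((k + l + 1 : ℕ) : ℝ) := by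
      calc _ ≤ 1 * ((k : ℝ) * 1) := by gcongr
        _ ≤ _ := by push_cast; linarith [(Nat.cast_nonneg l : (0 : ℝ) ≤ l)]
    exact mul_le_mul_of_nonneg_left this (pow_nonneg hq0 k)

theorem envOverlap_succ_signal_aux (hq0 : 0 ≤ q) (hq1 : q < 1) (h0 : 0 ≤ θ) (h1 : θ ≤ 1)
    (i r i' r' : ℕ) : √(i + 1 : ℝ) * envOverlap q θ (i + 1) r i' r' =
      √θ * √(r : ℝ) * envOverlap q θ i (r - 1) i' r' - √(1 - θ) * envOverlapLost q θ i r i' r' := by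
  unfold envOverlap envOverlapLost
  rw [← tsum_mul_left, ← tsum_mul_left, ← tsum_mul_left, ← Summable.tsum_sub
    ((summable_envOverlap hq0 hq1 h0 h1 _ _ _ _).mul_left _)
    ((summable_envOverlapLost hq0 hq1 h0 h1 _ _ _ _).mul_left _)]
  refine tsum_congr fun p => ?_
  linear_combination q ^ p.1 * beamsplitterAmp θ r' p.2 i' p.1 *
    beamsplitterAmp_succ_signal θ r p.2 i p.1

/-- The photon created in the lost mode on the left is moved across the partial trace, by shifting
`l`, and annihilated on the right. -/
theorem envOverlapLost_eq (hq0 : 0 ≤ q) (hq1 : q < 1) (h0 : 0 ≤ θ) (h1 : θ ≤ 1)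
    (i r i' r' : ℕ) : envOverlapLost q θ i r i' r' =
      -(√(1 - θ) * √(i' : ℝ) * envOverlap q θ i r (i' - 1) r') + √θ * envOverlapEnv q θ i r i' r' := by
  have hinj : Function.Injective fun p : ℕ × ℕ => (p.1, p.2 + 1) := fun a b hab => by
    simpa [Prod.ext_iff] using hab
  unfold envOverlapLost
  rw [← hinj.tsum_eq]
  · unfold envOverlap envOverlapEnv
    rw [← tsum_mul_left, ← tsum_mul_left, ← tsum_neg, ← Summable.tsum_add
      ((summable_envOverlap hq0 hq1 h0 h1 _ _ _ _).mul_left _).neg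
      ((summable_envOverlapEnv hq0 hq1 h0 h1 _ _ _ _).mul_left _)]
    refine tsum_congr fun p => ?_
    simp only [Nat.add_sub_cancel, Nat.cast_add, Nat.cast_one]
    linear_combination q ^ p.1 * beamsplitterAmp θ r p.2 i p.1 *
      beamsplitterAmp_succ_lost θ r' p.2 i' p.1
  · rintro ⟨k, l⟩ hkl
    rcases l with _ | l
    · simp at hkl
    · exact ⟨(k, l), rfl⟩

/-- Shifting `k` is the relation `e τ = q τ e` of a thermal state, whence the factor `q`; the
creation relation for the environment then applies on the left. -/
theorem envOverlapEnv_eq (hq0 : 0 ≤ q) (hq1 : q < 1) (h0 : 0 ≤ θ) (h1 : θ ≤ 1)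
    (i r i' r' : ℕ) : envOverlapEnv q θ i r i' r' =
      q * (√(1 - θ) * √(r : ℝ) * envOverlap q θ i (r - 1) i' r' +
        √θ * envOverlapLost q θ i r i' r') := by
  have hinj : Function.Injective fun p : ℕ × ℕ => (p.1 + 1, p.2) := fun a b hab => by
    simpa [Prod.ext_iff] using hab
  unfold envOverlapEnv
  rw [← hinj.tsum_eq]
  · unfold envOverlap envOverlapLost
    rw [← tsum_mul_left, ← tsum_mul_left, ← Summable.tsum_add
      ((summable_envOverlap hq0 hq1 h0 h1 _ _ _ _).mul_left _)
      ((summable_envOverlapLost hq0 hq1 h0 h1 _ _ _ _).mul_left _), ← tsum_mul_left]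
    refine tsum_congr fun p => ?_
    simp only [Nat.add_sub_cancel, Nat.cast_add, Nat.cast_one]
    linear_combination q ^ (p.1 + 1) * beamsplitterAmp θ r' p.2 i' p.1 *
      beamsplitterAmp_succ_env θ r p.2 i p.1
  · rintro ⟨k, l⟩ hkl
    rcases k with _ | k
    · simp at hkl
    · exact ⟨(k, l), rfl⟩

theorem envOverlap_succ_returned_aux (hq0 : 0 ≤ q) (hq1 : q < 1) (h0 : 0 ≤ θ) (h1 : θ ≤ 1)
    (i r i' r' : ℕ) : √(r + 1 : ℝ) * envOverlap q θ i (r + 1) i' r' =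
      √θ * √(i : ℝ) * envOverlap q θ (i - 1) r i' r' + √(1 - θ) * envOverlapEnv q θ i' r' i r := by
  unfold envOverlap envOverlapEnv
  rw [← tsum_mul_left, ← tsum_mul_left, ← tsum_mul_left, ← Summable.tsum_add
    ((summable_envOverlap hq0 hq1 h0 h1 _ _ _ _).mul_left _)
    ((summable_envOverlapEnv hq0 hq1 h0 h1 _ _ _ _).mul_left _)]
  refine tsum_congr fun p => ?_
  linear_combination q ^ p.1 * beamsplitterAmp θ r' p.2 i' p.1 *
    beamsplitterAmp_succ_returned θ r p.2 i p.1

/-- The two preceding relations form a linear system for the lost-mode and environment overlaps,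
whose determinant is `1 - q θ`. -/
theorem envOverlapLost_solve (hq0 : 0 ≤ q) (hq1 : q < 1) (h0 : 0 ≤ θ) (h1 : θ ≤ 1)
    (i r i' r' : ℕ) : (1 - q * θ) * envOverlapLost q θ i r i' r' =
      √(1 - θ) * (q * √θ * √(r : ℝ) * envOverlap q θ i (r - 1) i' r' -
        √(i' : ℝ) * envOverlap q θ i r (i' - 1) r') := by
  have hτ : √θ * √θ = θ := Real.mul_self_sqrt h0
  have e1 := envOverlapLost_eq hq0 hq1 h0 h1 i r i' r'
  have e2 := envOverlapEnv_eq hq0 hq1 h0 h1 i r i' r'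
  linear_combination e1 + √θ * e2 + q * envOverlapLost q θ i r i' r' * hτ

theorem one_sub_mul_pos (hq0 : 0 ≤ q) (hq1 : q < 1) (h1 : θ ≤ 1) : 0 < 1 - q * θ := by
  nlinarith [mul_nonneg hq0 (sub_nonneg.mpr h1)]

theorem envOverlap_succ_signal (hq0 : 0 ≤ q) (hq1 : q < 1) (h0 : 0 ≤ θ) (h1 : θ ≤ 1)
    (i r i' r' : ℕ) : √(i + 1 : ℝ) * envOverlap q θ (i + 1) r i' r' =
      √θ * ((1 - q) / (1 - q * θ)) * √(r : ℝ) * envOverlap q θ i (r - 1) i' r' +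
        (1 - θ) / (1 - q * θ) * √(i' : ℝ) * envOverlap q θ i r (i' - 1) r' := by
  have hne := (one_sub_mul_pos hq0 hq1 h1).ne'
  have hρ : √(1 - θ) * √(1 - θ) = 1 - θ := Real.mul_self_sqrt (by linarith)
  have e := envOverlapLost_solve hq0 hq1 h0 h1 i r i' r'
  rw [envOverlap_succ_signal_aux hq0 hq1 h0 h1]
  have ha : (1 - q * θ) * ((1 - q) / (1 - q * θ)) = 1 - q := mul_div_cancel₀ _ hne
  have hb : (1 - q * θ) * ((1 - θ) / (1 - q * θ)) = 1 - θ := mul_div_cancel₀ _ hne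
  refine mul_left_cancel₀ hne ?_
  linear_combination -√(1 - θ) * e - √θ * √(r : ℝ) * envOverlap q θ i (r - 1) i' r' * ha -
    √(i' : ℝ) * envOverlap q θ i r (i' - 1) r' * hb + (√(i' : ℝ) * envOverlap q θ i r (i' - 1) r' -
    q * √θ * √(r : ℝ) * envOverlap q θ i (r - 1) i' r') * hρ

theorem envOverlap_succ_returned (hq0 : 0 ≤ q) (hq1 : q < 1) (h0 : 0 ≤ θ) (h1 : θ ≤ 1)
    (i r i' r' : ℕ) : √(r + 1 : ℝ) * envOverlap q θ i (r + 1) i' r' =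
      √θ * ((1 - q) / (1 - q * θ)) * √(i : ℝ) * envOverlap q θ (i - 1) r i' r' +
        q * ((1 - θ) / (1 - q * θ)) * √(r' : ℝ) * envOverlap q θ i r i' (r' - 1) := by
  have hne := (one_sub_mul_pos hq0 hq1 h1).ne'
  have hρ : √(1 - θ) * √(1 - θ) = 1 - θ := Real.mul_self_sqrt (by linarith)
  have hτ : √θ * √θ = θ := Real.mul_self_sqrt h0
  have e := envOverlapLost_solve hq0 hq1 h0 h1 i' r' i r
  rw [envOverlap_succ_returned_aux hq0 hq1 h0 h1, envOverlapEnv_eq hq0 hq1 h0 h1]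
  rw [envOverlap_symm i' (r' - 1), envOverlap_symm i' r'] at *
  have ha : (1 - q * θ) * ((1 - q) / (1 - q * θ)) = 1 - q := mul_div_cancel₀ _ hne
  have hb : (1 - q * θ) * ((1 - θ) / (1 - q * θ)) = 1 - θ := mul_div_cancel₀ _ hne
  refine mul_left_cancel₀ hne ?_
  linear_combination q * √θ * √(1 - θ) * e - √θ * √(i : ℝ) * envOverlap q θ (i - 1) r i' r' * ha -
    q * √(r' : ℝ) * envOverlap q θ i r i' (r' - 1) * hb + (q * (1 - q * θ) * √(r' : ℝ) *
    envOverlap q θ i r i' (r' - 1) + q * √θ * (q * √θ * √(r' : ℝ) * envOverlap q θ i r i' (r' - 1) -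
    √(i : ℝ) * envOverlap q θ (i - 1) r i' r')) * hρ +
    q ^ 2 * (1 - θ) * √(r' : ℝ) * envOverlap q θ i r i' (r' - 1) * hτ

/-- With vacuum in the signal before and after, only `k = l` contributes, with amplitude `√θ ^ k`.
-/
theorem envOverlap_zero (hq0 : 0 ≤ q) (hq1 : q < 1) (h0 : 0 ≤ θ) (h1 : θ ≤ 1) :
    envOverlap q θ 0 0 0 0 = (1 - q * θ)⁻¹ := by
  have hinj : Function.Injective fun k : ℕ => (k, k) := fun a b hab => (Prod.ext_iff.mp hab).1
  unfold envOverlap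
  rw [← hinj.tsum_eq]
  · have hlt : q * θ < 1 := by linarith [one_sub_mul_pos hq0 hq1 h1]
    rw [← tsum_geometric_of_lt_one (mul_nonneg hq0 h0) hlt]
    refine tsum_congr fun k => ?_
    have : beamsplitterAmp θ 0 k 0 k = √θ ^ k := by
      simp [beamsplitterAmp, Polynomial.coeff_zero_eq_eval_zero,
        div_self (by positivity : (k ! : ℝ) ≠ 0)]
    simp only [this]
    rw [mul_pow, ← mul_pow, Real.mul_self_sqrt h0]
  · rintro ⟨k, l⟩ hkl
    refine ⟨k, ?_⟩
    by_contra h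
    apply hkl
    simp only
    rw [beamsplitterAmp_of_ne θ (by simpa using fun e => h (by simp [e]))]
    simp

end Environment

/-! ### Matrices of two-mode squeezed thermal states -/

section SqueezedThermal

/-- The ladder relations `a σ = A b† σ + B σ a`, `b σ = A a† σ + D σ b` of a two-mode squeezed
thermal state, for its Fock matrix `g i r i' r' = ⟨i, r|σ|i', r'⟩`. -/
structure IsSqueezedThermal (A B D : ℝ) (g : ℕ → ℕ → ℕ → ℕ → ℝ) : Prop where
  symm : ∀ i r i' r' : ℕ, g i r i' r' = g i' r' i r
  succ_idler : ∀ i r i' r' : ℕ, √(i + 1 : ℝ) * g (i + 1) r i' r' =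
    A * √(r : ℝ) * g i (r - 1) i' r' + B * √(i' : ℝ) * g i r (i' - 1) r'
  succ_probe : ∀ i r i' r' : ℕ, √(r + 1 : ℝ) * g i (r + 1) i' r' =
    A * √(i : ℝ) * g (i - 1) r i' r' + D * √(r' : ℝ) * g i r i' (r' - 1)

variable {A B D : ℝ} {g : ℕ → ℕ → ℕ → ℕ → ℝ}

/-- The ladder relation in number-operator form: the prefactor `√i` makes it trivial at `i = 0`, so
the truncated `i - 1` does no harm. -/
theorem IsSqueezedThermal.idler (h : IsSqueezedThermal A B D g) (i r i' r' : ℕ) :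
    i * g i r i' r' = √(i : ℝ) * (A * √(r : ℝ) * g (i - 1) (r - 1) i' r' +
      B * √(i' : ℝ) * g (i - 1) r (i' - 1) r') := by
  rcases i with _ | i
  · simp
  · have hi : √(i + 1 : ℝ) * √(i + 1 : ℝ) = i + 1 := Real.mul_self_sqrt (by positivity)
    simp only [Nat.add_sub_cancel, Nat.cast_add, Nat.cast_one]
    rw [← h.succ_idler, ← mul_assoc, hi]

theorem IsSqueezedThermal.probe (h : IsSqueezedThermal A B D g) (i r i' r' : ℕ) :
    r * g i r i' r' = √(r : ℝ) * (A * √(i : ℝ) * g (i - 1) (r - 1) i' r' +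
      D * √(r' : ℝ) * g i (r - 1) i' (r' - 1)) := by
  rcases r with _ | r
  · simp
  · have hi : √(r + 1 : ℝ) * √(r + 1 : ℝ) = r + 1 := Real.mul_self_sqrt (by positivity)
    simp only [Nat.add_sub_cancel, Nat.cast_add, Nat.cast_one]
    rw [← h.succ_probe, ← mul_assoc, hi]

theorem IsSqueezedThermal.idler_right (h : IsSqueezedThermal A B D g) (i r i' r' : ℕ) :
    i' * g i r i' r' = √(i' : ℝ) * (A * √(r' : ℝ) * g i r (i' - 1) (r' - 1) +
      B * √(i : ℝ) * g (i - 1) r (i' - 1) r') := by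
  rw [h.symm i r i' r', h.idler, h.symm (i' - 1) (r' - 1), h.symm (i' - 1) r']

theorem IsSqueezedThermal.probe_right (h : IsSqueezedThermal A B D g) (i r i' r' : ℕ) :
    r' * g i r i' r' = √(r' : ℝ) * (A * √(i' : ℝ) * g i r (i' - 1) (r' - 1) +
      D * √(r : ℝ) * g i (r - 1) i' (r' - 1)) := by
  rw [h.symm i r i' r', h.probe, h.symm (i' - 1) (r' - 1), h.symm i' (r' - 1)]

/-- Positive semidefiniteness of the matrix with diagonal `p, s` and off-diagonal entries `-a`. -/
theorem two_mul_le_of_sq_le_mul {p s a : ℝ} (hp : 0 ≤ p) (hs : 0 ≤ s) (h : a ^ 2 ≤ p * s)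
    (x y : ℝ) : 2 * a * x * y ≤ p * x ^ 2 + s * y ^ 2 := by
  have ha : |a| ≤ √p * √s := by
    rw [← Real.sqrt_mul hp]; exact Real.abs_le_sqrt h
  have h1 : 2 * a * x * y ≤ 2 * (√p * √s) * |x| * |y| := by
    calc 2 * a * x * y ≤ |2 * a * x * y| := le_abs_self _
      _ = 2 * |a| * |x| * |y| := by rw [abs_mul, abs_mul, abs_mul]; norm_num
      _ ≤ _ := by gcongr
  nlinarith [sq_nonneg (√p * |x| - √s * |y|), Real.sq_sqrt hp, Real.sq_sqrt hs, sq_abs x, sq_abs y]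

/-- Geometric decay of the entries. -/
theorem IsSqueezedThermal.abs_le (h : IsSqueezedThermal A B D g) (hA : 0 ≤ A) (hB : 0 ≤ B)
    (hD : 0 ≤ D) {ϱ : ℝ} (hϱ : 0 < ϱ) (hBϱ : B ≤ ϱ ^ 2) (hDϱ : D ≤ ϱ ^ 2)
    (hAϱ : A ^ 2 ≤ (ϱ ^ 2 - B) * (ϱ ^ 2 - D)) (i r i' r' : ℕ) :
    |g i r i' r'| ≤ |g 0 0 0 0| * ϱ ^ (i + r + i' + r') := by
  set G := |g 0 0 0 0| with hG
  have hG0 : 0 ≤ G := abs_nonneg _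
  have hx : 0 < ϱ ^ 2 := by positivity
  have hpow : ∀ m N : ℕ, m + 2 = N → ϱ ^ m = ϱ ^ N / ϱ ^ 2 := by
    rintro m N rfl
    rw [pow_add]; field_simp
  have hstep : ∀ {a b c u v e₁ e₂ y z : ℝ}, 0 < a → 0 ≤ u → 0 ≤ v → 0 ≤ b → 0 ≤ c →
      a * y = b * u * e₁ + c * v * e₂ → u * |e₁| ≤ u * (z / ϱ ^ 2) → v * |e₂| ≤ v * (z / ϱ ^ 2) →
      b * u + c * v ≤ ϱ ^ 2 * a → 0 ≤ z → |y| ≤ z := by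
    intro a b c u v e₁ e₂ y z ha hu hv hb hc he h1 h2 hle hz
    refine le_of_mul_le_mul_left ?_ ha
    calc a * |y| = |a * y| := by rw [abs_mul, abs_of_pos ha]
      _ ≤ b * (u * |e₁|) + c * (v * |e₂|) := by
        rw [he]
        refine (abs_add_le _ _).trans (le_of_eq ?_)
        rw [abs_mul, abs_mul, abs_mul, abs_mul, abs_of_nonneg hb, abs_of_nonneg hc,
          abs_of_nonneg hu, abs_of_nonneg hv]
        ring
      _ ≤ b * (u * (z / ϱ ^ 2)) + c * (v * (z / ϱ ^ 2)) := by gcongr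
      _ = (b * u + c * v) * (z / ϱ ^ 2) := by ring
      _ ≤ ϱ ^ 2 * a * (z / ϱ ^ 2) := by gcongr
      _ = a * z := by field_simp
  induction hN : i + r + i' + r' using Nat.strong_induction_on generalizing i r i' r' with
  | _ N ih =>
  have hz : 0 ≤ G * ϱ ^ N := by positivity
  have hlow : ∀ j s j' s', j + s + j' + s' + 2 = N → |g j s j' s'| ≤ G * ϱ ^ N / ϱ ^ 2 := by
    intro j s j' s' hj
    rw [mul_div_assoc, ← hpow _ _ hj]
    exact ih _ (by omega) _ _ _ _ rfl
  have hI : ∀ j s j' s', j + s + j' + s' = N → 0 < √(j : ℝ) →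
      A * √(s : ℝ) + B * √(j' : ℝ) ≤ ϱ ^ 2 * √(j : ℝ) → |g j s j' s'| ≤ G * ϱ ^ N := by
    intro j s j' s' hj hpos hle
    rcases j with _ | j
    · simp at hpos
    · push_cast at hpos hle
      refine hstep hpos (Real.sqrt_nonneg _) (Real.sqrt_nonneg _) hA hB (h.succ_idler j s j' s')
        ?_ ?_ hle hz
      · rcases s with _ | s
        · simp
        · exact mul_le_mul_of_nonneg_left (hlow _ _ _ _ (by omega)) (Real.sqrt_nonneg _)
      · rcases j' with _ | j'
        · simp
        · exact mul_le_mul_of_nonneg_left (hlow _ _ _ _ (by omega)) (Real.sqrt_nonneg _)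
  have hP : ∀ j s j' s', j + s + j' + s' = N → 0 < √(s : ℝ) →
      A * √(j : ℝ) + D * √(s' : ℝ) ≤ ϱ ^ 2 * √(s : ℝ) → |g j s j' s'| ≤ G * ϱ ^ N := by
    intro j s j' s' hj hpos hle
    rcases s with _ | s
    · simp at hpos
    · push_cast at hpos hle
      refine hstep hpos (Real.sqrt_nonneg _) (Real.sqrt_nonneg _) hA hD (h.succ_probe j s j' s')
        ?_ ?_ hle hz
      · rcases j with _ | j
        · simp
        · exact mul_le_mul_of_nonneg_left (hlow _ _ _ _ (by omega)) (Real.sqrt_nonneg _)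
      · rcases s' with _ | s'
        · simp
        · exact mul_le_mul_of_nonneg_left (hlow _ _ _ _ (by omega)) (Real.sqrt_nonneg _)
  -- Each of the four relations bounds the entry by entries with two photons fewer, so the estimate
  -- can fail only if all four of the inequalities like `A √r + B √i' ≤ ϱ² √i` fail at nonzero
  -- labels. Weighting the failures by `√i, √r, √i', √r'` and adding contradicts the
  -- semidefiniteness expressed by `hAϱ`.
  by_contra hcon
  have c1 := fun hpos => not_le.mp (mt (hI i r i' r' hN hpos) hcon)
  have c2 := fun hpos => not_le.mp (mt (hP i r i' r' hN hpos) hcon)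
  rw [h.symm] at hcon
  have c3 := fun hpos => not_le.mp (mt (hI i' r' i r (by omega) hpos) hcon)
  have c4 := fun hpos => not_le.mp (mt (hP i' r' i r (by omega) hpos) hcon)
  have hN0 : N ≠ 0 := by
    rintro rfl
    obtain ⟨rfl, rfl, rfl, rfl⟩ : i = 0 ∧ r = 0 ∧ i' = 0 ∧ r' = 0 := by omega
    simp [hG] at hcon
  have hpos' : ∀ n : ℕ, n ≠ 0 → 0 < √(n : ℝ) := fun n hn =>
    Real.sqrt_pos.mpr (by exact_mod_cast Nat.pos_of_ne_zero hn)
  have hmul : ∀ {u v : ℝ}, 0 ≤ u → (0 < u → ϱ ^ 2 * u < v) →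
      ϱ ^ 2 * u ^ 2 ≤ u * v ∧ (0 < u → ϱ ^ 2 * u ^ 2 < u * v) := by
    intro u v hu huv
    have hlt : 0 < u → ϱ ^ 2 * u ^ 2 < u * v := fun hp => by
      have := mul_lt_mul_of_pos_left (huv hp) hp
      linarith
    refine ⟨?_, hlt⟩
    rcases hu.eq_or_lt with rfl | hp
    · simp
    · exact (hlt hp).le
  obtain ⟨m1, s1⟩ := hmul (Real.sqrt_nonneg (i : ℝ)) c1
  obtain ⟨m2, s2⟩ := hmul (Real.sqrt_nonneg (r : ℝ)) c2
  obtain ⟨m3, s3⟩ := hmul (Real.sqrt_nonneg (i' : ℝ)) c3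
  obtain ⟨m4, s4⟩ := hmul (Real.sqrt_nonneg (r' : ℝ)) c4
  have q1 := two_mul_le_of_sq_le_mul (sub_nonneg.mpr hBϱ) (sub_nonneg.mpr hDϱ) hAϱ
    √(i : ℝ) √(r : ℝ)
  have q2 := two_mul_le_of_sq_le_mul (sub_nonneg.mpr hBϱ) (sub_nonneg.mpr hDϱ) hAϱ
    √(i' : ℝ) √(r' : ℝ)
  have q3 := mul_nonneg hB (sq_nonneg (√(i : ℝ) - √(i' : ℝ)))
  have q4 := mul_nonneg hD (sq_nonneg (√(r : ℝ) - √(r' : ℝ)))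
  have hor : i ≠ 0 ∨ r ≠ 0 ∨ i' ≠ 0 ∨ r' ≠ 0 := by omega
  rcases hor with hi | hi | hi | hi
  · have := s1 (hpos' _ hi); linarith
  · have := s2 (hpos' _ hi); linarith
  · have := s3 (hpos' _ hi); linarith
  · have := s4 (hpos' _ hi); linarith

/-- The derivative of the matrix in terms of the velocities of `A` and `B`. -/
noncomputable def squeezedThermalDeriv (A' B' : ℝ) (g : ℕ → ℕ → ℕ → ℕ → ℝ) (i r i' r' : ℕ) : ℝ :=
  A' * (√(i : ℝ) * √(r : ℝ) * g (i - 1) (r - 1) i' r' +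
    √(i' : ℝ) * √(r' : ℝ) * g i r (i' - 1) (r' - 1)) +
    B' * (√(i : ℝ) * √(i' : ℝ) * g (i - 1) r (i' - 1) r')

theorem IsSqueezedThermal.deriv_symm (h : IsSqueezedThermal A B D g) (A' B' : ℝ) (i r i' r' : ℕ) :
    squeezedThermalDeriv A' B' g i r i' r' = squeezedThermalDeriv A' B' g i' r' i r := by
  unfold squeezedThermalDeriv
  rw [h.symm (i - 1) (r - 1), h.symm i r (i' - 1), h.symm (i - 1) r]
  ring

/-- The candidate `A' (a† b† σ + σ a b) + B' a† σ a` satisfies what the product rule gives on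
differentiating `a σ = A b† σ + B σ a`. -/
theorem IsSqueezedThermal.deriv_succ_idler (h : IsSqueezedThermal A B D g) (A' B' : ℝ)
    (i r i' r' : ℕ) : √(i + 1 : ℝ) * squeezedThermalDeriv A' B' g (i + 1) r i' r' =
      A * √(r : ℝ) * squeezedThermalDeriv A' B' g i (r - 1) i' r' +
      B * √(i' : ℝ) * squeezedThermalDeriv A' B' g i r (i' - 1) r' +
      (A' * √(r : ℝ) * g i (r - 1) i' r' + B' * √(i' : ℝ) * g i r (i' - 1) r') := by
  have hi : √(i + 1 : ℝ) * √(i + 1 : ℝ) = i + 1 := Real.mul_self_sqrt (by positivity)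
  have e1 := h.succ_idler i r (i' - 1) (r' - 1)
  have e2 := h.idler i (r - 1) i' r'
  have e3 := h.idler i r (i' - 1) r'
  unfold squeezedThermalDeriv
  simp only [Nat.add_sub_cancel, Nat.cast_add, Nat.cast_one]
  linear_combination (A' * √(r : ℝ) * g i (r - 1) i' r' + B' * √(i' : ℝ) * g i r (i' - 1) r') * hi +
    A' * √(i' : ℝ) * √(r' : ℝ) * e1 + A' * √(r : ℝ) * e2 + B' * √(i' : ℝ) * e3

theorem IsSqueezedThermal.deriv_succ_probe (h : IsSqueezedThermal A B D g) (A' B' : ℝ)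
    (i r i' r' : ℕ) : √(r + 1 : ℝ) * squeezedThermalDeriv A' B' g i (r + 1) i' r' =
      A * √(i : ℝ) * squeezedThermalDeriv A' B' g (i - 1) r i' r' +
      D * √(r' : ℝ) * squeezedThermalDeriv A' B' g i r i' (r' - 1) +
      A' * √(i : ℝ) * g (i - 1) r i' r' := by
  have hr : √(r + 1 : ℝ) * √(r + 1 : ℝ) = r + 1 := Real.mul_self_sqrt (by positivity)
  have e1 := h.succ_probe i r (i' - 1) (r' - 1)
  have e2 := h.probe (i - 1) r i' r'
  have e3 := h.succ_probe (i - 1) r (i' - 1) r'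
  unfold squeezedThermalDeriv
  simp only [Nat.add_sub_cancel, Nat.cast_add, Nat.cast_one]
  linear_combination A' * √(i : ℝ) * g (i - 1) r i' r' * hr +
    A' * √(i' : ℝ) * √(r' : ℝ) * e1 + A' * √(i : ℝ) * e2 + B' * √(i : ℝ) * √(i' : ℝ) * e3

/-- Induction on the total photon number: a ladder relation expresses each entry through lower ones
and candidate and true derivative obey the same recursion. It starts from the constant vacuum entry
and needs `D` constant. -/
theorem hasDerivAt_squeezedThermal {A B A' B' : ℝ → ℝ} {g : ℝ → ℕ → ℕ → ℕ → ℕ → ℝ} {U : Set ℝ}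
    (hU : IsOpen U) (hg : ∀ t ∈ U, IsSqueezedThermal (A t) (B t) D (g t))
    (hA : ∀ t ∈ U, HasDerivAt A (A' t) t) (hB : ∀ t ∈ U, HasDerivAt B (B' t) t) {c : ℝ}
    (h0 : ∀ t ∈ U, g t 0 0 0 0 = c) (i r i' r' : ℕ) {t : ℝ} (ht : t ∈ U) :
    HasDerivAt (fun t => g t i r i' r') (squeezedThermalDeriv (A' t) (B' t) (g t) i r i' r') t := by
  have hUt : ∀ᶠ s in 𝓝 t, s ∈ U := hU.mem_nhds ht
  induction hN : i + r + i' + r' using Nat.strong_induction_on generalizing i r i' r' with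
  | _ N ih =>
  have hlow : ∀ (c : ℕ) j s j' s', (c ≠ 0 → j + s + j' + s' < N) →
      HasDerivAt (fun t => √(c : ℝ) * g t j s j' s')
        (√(c : ℝ) * squeezedThermalDeriv (A' t) (B' t) (g t) j s j' s') t := by
    intro c j s j' s' hc
    rcases eq_or_ne c 0 with rfl | hc0
    · simpa using hasDerivAt_const t (0 : ℝ)
    · exact (ih _ (hc hc0) j s j' s' rfl).const_mul _
  have hI : ∀ j s j' s', j + 1 + s + j' + s' = N → HasDerivAt (fun t => g t (j + 1) s j' s')
      (squeezedThermalDeriv (A' t) (B' t) (g t) (j + 1) s j' s') t := by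
    intro j s j' s' hj
    have hne : √(j + 1 : ℝ) ≠ 0 := by positivity
    have k1 := (hA t ht).mul (hlow s j (s - 1) j' s' (by omega))
    have k2 := (hB t ht).mul (hlow j' j s (j' - 1) s' (by omega))
    have k := (k1.add k2).const_mul (√(j + 1 : ℝ))⁻¹
    refine (k.congr_of_eventuallyEq ?_).congr_deriv ?_
    · filter_upwards [hUt] with u hu
      refine mul_left_cancel₀ hne ?_
      rw [(hg u hu).succ_idler]
      simp only [Pi.add_apply, Pi.mul_apply]
      field_simp
    · refine mul_left_cancel₀ hne ?_
      rw [(hg t ht).deriv_succ_idler]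
      field_simp
      ring
  have hP : ∀ j s j' s', j + (s + 1) + j' + s' = N → HasDerivAt (fun t => g t j (s + 1) j' s')
      (squeezedThermalDeriv (A' t) (B' t) (g t) j (s + 1) j' s') t := by
    intro j s j' s' hj
    have hne : √(s + 1 : ℝ) ≠ 0 := by positivity
    have k1 := (hA t ht).mul (hlow j (j - 1) s j' s' (by omega))
    have k2 := (hlow s' j s j' (s' - 1) (by omega)).const_mul D
    have k := (k1.add k2).const_mul (√(s + 1 : ℝ))⁻¹
    refine (k.congr_of_eventuallyEq ?_).congr_deriv ?_
    · filter_upwards [hUt] with u hu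
      refine mul_left_cancel₀ hne ?_
      rw [(hg u hu).succ_probe]
      simp only [Pi.add_apply, Pi.mul_apply]
      field_simp
    · refine mul_left_cancel₀ hne ?_
      rw [(hg t ht).deriv_succ_probe]
      field_simp
      ring
  have hsym : HasDerivAt (fun t => g t i' r' i r)
      (squeezedThermalDeriv (A' t) (B' t) (g t) i' r' i r) t → HasDerivAt (fun t => g t i r i' r')
      (squeezedThermalDeriv (A' t) (B' t) (g t) i r i' r') t := fun h => by
    rw [(hg t ht).deriv_symm]
    refine h.congr_of_eventuallyEq ?_
    filter_upwards [hUt] with u hu using (hg u hu).symm i r i' r'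
  rcases i with _ | i
  · rcases r with _ | r
    · rcases i' with _ | i'
      · rcases r' with _ | r'
        · have : squeezedThermalDeriv (A' t) (B' t) (g t) 0 0 0 0 = 0 := by
            simp [squeezedThermalDeriv]
          rw [this]
          refine (hasDerivAt_const t c).congr_of_eventuallyEq ?_
          filter_upwards [hUt] with u hu using h0 u hu
        · exact hsym (hP _ _ _ _ (by omega))
      · exact hsym (hI _ _ _ _ (by omega))
    · exact hP _ _ _ _ (by omega)
  · exact hI _ _ _ _ (by omega)

/-- The single-mode operator `c₀ + c₁ a†a + c₂ b†b + c₃ (a b + a†b†)` in the Fock basis. -/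
noncomputable def quadraticOp (c₀ c₁ c₂ c₃ : ℝ) (f : ℕ → ℕ → ℝ) (i r : ℕ) : ℝ :=
  (c₀ + c₁ * i + c₂ * r) * f i r + c₃ * (√(i + 1 : ℝ) * √(r + 1 : ℝ)) * f (i + 1) (r + 1) +
    c₃ * (√(i : ℝ) * √(r : ℝ)) * f (i - 1) (r - 1)

/-- `a b σ` in terms of lower entries. -/
theorem IsSqueezedThermal.succ_succ (h : IsSqueezedThermal A B D g) (i r i' r' : ℕ) :
    √(i + 1 : ℝ) * √(r + 1 : ℝ) * g (i + 1) (r + 1) i' r' = A * (r + 1) * g i r i' r' +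
      B * (A * (√(i : ℝ) * √(i' : ℝ) * g (i - 1) r (i' - 1) r') +
        D * (√(i' : ℝ) * √(r' : ℝ) * g i r (i' - 1) (r' - 1))) := by
  have hr : √(r + 1 : ℝ) * √(r + 1 : ℝ) = r + 1 := Real.mul_self_sqrt (by positivity)
  have e1 := h.succ_idler i (r + 1) i' r'
  have e2 := h.succ_probe i r (i' - 1) r'
  simp only [Nat.add_sub_cancel, Nat.cast_add, Nat.cast_one] at e1
  linear_combination A * g i r i' r' * hr + B * √(i' : ℝ) * e2 + √(r + 1 : ℝ) * e1

/-- The symmetric logarithmic derivative equation of a single mode. -/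
theorem IsSqueezedThermal.quadraticOp_add (h : IsSqueezedThermal A B D g) {A' B' c₀ c₁ c₂ c₃ : ℝ}
    (h₀ : c₀ + c₃ * A = 0) (h₂ : c₂ + c₃ * A = 0) (h₁ : B * (c₁ + c₃ * A) = B')
    (h₃ : A * c₁ + A * c₂ + c₃ * (1 + A ^ 2 + B * D) = 2 * A') (i r i' r' : ℕ) :
    quadraticOp c₀ c₁ c₂ c₃ (fun j s => g j s i' r') i r +
      quadraticOp c₀ c₁ c₂ c₃ (g i r) i' r' = 2 * squeezedThermalDeriv A' B' g i r i' r' := by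
  -- Once `a b σ` and `σ a† b†` are rewritten through lower entries, comparing the coefficients of
  -- `σ`, of the probe number, of `a† σ a` and of `a† b† σ` gives `h₀`, `h₂`, `h₁` and `h₃`; in `h₃`
  -- the terms `A c₂ + c₃ A²` cancel by `h₂`.
  have u1 := h.succ_succ i r i' r'
  have u2 := h.succ_succ i' r' i r
  have hs := h.symm
  rw [h.symm (i' + 1), h.symm i' r' i r, h.symm (i' - 1), h.symm i' r' (i - 1)] at u2
  have k1 := h.idler i r i' r'
  have k2 := h.probe i r i' r'
  have k3 := h.idler_right i r i' r'
  have k4 := h.probe_right i r i' r'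
  unfold quadraticOp squeezedThermalDeriv
  rw [← h₁]
  have hA' : A' = (A * c₁ + A * c₂ + c₃ * (1 + A ^ 2 + B * D)) / 2 := by linarith
  obtain rfl : c₀ = -(c₃ * A) := by linarith
  obtain rfl : c₂ = -(c₃ * A) := by linarith
  rw [hA']
  linear_combination c₃ * u1 + c₃ * u2 + c₁ * k1 + c₁ * k3

end SqueezedThermal

/-! ### Moments of squeezed thermal states -/

section Moments

theorem summable_of_le_geometric {h : ℕ × ℕ → ℝ} {q C : ℝ} (hq0 : 0 ≤ q) (hq1 : q < 1)
    (hb : ∀ i r, |h (i, r)| ≤ C * ((i + 1) * q ^ i * ((r + 1) * q ^ r))) : Summable h := by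
  have hq : ‖q‖ < 1 := by rwa [Real.norm_of_nonneg hq0]
  have h1 : Summable fun i : ℕ => ((i : ℝ) + 1) * q ^ i := by
    have := (summable_pow_mul_geometric_of_norm_lt_one 1 hq).add
      (summable_geometric_of_norm_lt_one hq)
    refine this.congr fun i => ?_
    ring
  have h0 : ∀ i : ℕ, 0 ≤ ((i : ℝ) + 1) * q ^ i := fun i => by positivity
  refine Summable.of_norm_bounded ((h1.mul_of_nonneg h1 h0 h0).mul_left C) fun p => hb p.1 p.2

variable {A B D : ℝ} {g : ℕ → ℕ → ℕ → ℕ → ℝ}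

/-- The trace of a quadratic operator against a squeezed thermal state, with the linear relations
that determine the second moments. -/
theorem IsSqueezedThermal.hasSum_quadraticOp (h : IsSqueezedThermal A B D g) {G ϱ : ℝ}
    (hϱ0 : 0 ≤ ϱ) (hϱ1 : ϱ < 1) (hg : ∀ i r i' r', |g i r i' r'| ≤ G * ϱ ^ (i + r + i' + r'))
    {T : ℝ} (hT : HasSum (fun x : ℕ × ℕ => g x.1 x.2 x.1 x.2) T) :
    ∃ nI nS k : ℝ, nI * (1 - B) = A * k + B * T ∧ nS * (1 - D) = A * k + D * T ∧
      k * (1 - B) = A * (nS + T) ∧ ∀ c₀ c₁ c₂ c₃ : ℝ,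
      HasSum (fun x : ℕ × ℕ => quadraticOp c₀ c₁ c₂ c₃ (fun j s => g j s x.1 x.2) x.1 x.2)
        (c₀ * T + c₁ * nI + c₂ * nS + 2 * c₃ * k) := by
  have hG : 0 ≤ G := by simpa using (abs_nonneg _).trans (hg 0 0 0 0)
  have hq0 : 0 ≤ ϱ ^ 2 := by positivity
  have hq1 : ϱ ^ 2 < 1 := by nlinarith
  have hdiag : ∀ i r, |g i r i r| ≤ G * ((ϱ ^ 2) ^ i * (ϱ ^ 2) ^ r) := fun i r => by
    refine (hg i r i r).trans (le_of_eq ?_)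
    rw [← pow_mul, ← pow_mul, ← pow_add]
    congr 2; ring
  have hoff : ∀ i r, |g (i + 1) (r + 1) i r| ≤ G * ((ϱ ^ 2) ^ i * (ϱ ^ 2) ^ r) := fun i r => by
    refine (hg _ _ _ _).trans ?_
    rw [← pow_mul, ← pow_mul, ← pow_add]
    exact mul_le_mul_of_nonneg_left (pow_le_pow_of_le_one hϱ0 hϱ1.le (by omega)) hG
  have hsI : Summable fun x : ℕ × ℕ => (x.1 : ℝ) * g x.1 x.2 x.1 x.2 := by
    refine summable_of_le_geometric (C := G) hq0 hq1 fun i r => ?_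
    rw [abs_mul, Nat.abs_cast]
    calc (i : ℝ) * |g i r i r| ≤ ((i + 1) * (r + 1)) * (G * ((ϱ ^ 2) ^ i * (ϱ ^ 2) ^ r)) := by
          gcongr
          · nlinarith [(Nat.cast_nonneg i : (0 : ℝ) ≤ i), (Nat.cast_nonneg r : (0 : ℝ) ≤ r)]
          · exact hdiag i r
      _ = _ := by ring
  have hsS : Summable fun x : ℕ × ℕ => (x.2 : ℝ) * g x.1 x.2 x.1 x.2 := by
    refine summable_of_le_geometric (C := G) hq0 hq1 fun i r => ?_
    rw [abs_mul, Nat.abs_cast]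
    calc (r : ℝ) * |g i r i r| ≤ ((i + 1) * (r + 1)) * (G * ((ϱ ^ 2) ^ i * (ϱ ^ 2) ^ r)) := by
          gcongr
          · nlinarith [(Nat.cast_nonneg i : (0 : ℝ) ≤ i), (Nat.cast_nonneg r : (0 : ℝ) ≤ r)]
          · exact hdiag i r
      _ = _ := by ring
  have hsK : Summable fun x : ℕ × ℕ =>
      √(x.1 + 1 : ℝ) * √(x.2 + 1 : ℝ) * g (x.1 + 1) (x.2 + 1) x.1 x.2 := by
    refine summable_of_le_geometric (C := G) hq0 hq1 fun i r => ?_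
    have h1 := sqrt_natCast_le (i + 1)
    have h2 := sqrt_natCast_le (r + 1)
    push_cast at h1 h2
    rw [abs_mul, abs_of_nonneg (by positivity)]
    calc √(i + 1 : ℝ) * √(r + 1 : ℝ) * |g (i + 1) (r + 1) i r| ≤
          ((i + 1) * (r + 1)) * (G * ((ϱ ^ 2) ^ i * (ϱ ^ 2) ^ r)) := by
          gcongr
          exact hoff i r
      _ = _ := by ring
  -- These are `Tr a†a σ`, `Tr b†b σ` and `Tr a b σ`. Index shifts, which play the role of cyclicity
  -- of the trace, turn the ladder relations into three linear equations between them.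
  obtain ⟨nI, hI⟩ := hsI
  obtain ⟨nS, hS⟩ := hsS
  obtain ⟨k, hK⟩ := hsK
  have inj11 : Function.Injective fun x : ℕ × ℕ => (x.1 + 1, x.2 + 1) := fun a b hab => by
    simpa [Prod.ext_iff] using hab
  have inj10 : Function.Injective fun x : ℕ × ℕ => (x.1 + 1, x.2) := fun a b hab => by
    simpa [Prod.ext_iff] using hab
  have inj01 : Function.Injective fun x : ℕ × ℕ => (x.1, x.2 + 1) := fun a b hab => by
    simpa [Prod.ext_iff] using hab
  have hK' : HasSum (fun x : ℕ × ℕ => √(x.1 : ℝ) * √(x.2 : ℝ) * g (x.1 - 1) (x.2 - 1) x.1 x.2) k := by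
    refine (inj11.hasSum_iff ?_).mp ?_
    · rintro ⟨i, r⟩ hx
      rcases i with _ | i
      · simp
      · rcases r with _ | r
        · simp
        · exact absurd ⟨(i, r), rfl⟩ hx
    · refine hK.congr_fun fun x => ?_
      simp only [Function.comp, Nat.add_sub_cancel, Nat.cast_add, Nat.cast_one]
      rw [h.symm x.1 x.2]
  have hI' : HasSum (fun x : ℕ × ℕ => (x.1 : ℝ) * g (x.1 - 1) x.2 (x.1 - 1) x.2) (nI + T) := by
    refine (inj10.hasSum_iff ?_).mp ?_
    · rintro ⟨i, r⟩ hx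
      rcases i with _ | i
      · simp
      · exact absurd ⟨(i, r), rfl⟩ hx
    · refine (hI.add hT).congr_fun fun x => ?_
      simp only [Function.comp, Nat.add_sub_cancel, Nat.cast_add, Nat.cast_one]
      ring
  have hS' : HasSum (fun x : ℕ × ℕ => (x.2 : ℝ) * g x.1 (x.2 - 1) x.1 (x.2 - 1)) (nS + T) := by
    refine (inj01.hasSum_iff ?_).mp ?_
    · rintro ⟨i, r⟩ hx
      rcases r with _ | r
      · simp
      · exact absurd ⟨(i, r), rfl⟩ hx
    · refine (hS.add hT).congr_fun fun x => ?_
      simp only [Function.comp, Nat.add_sub_cancel, Nat.cast_add, Nat.cast_one]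
      ring
  have hM : HasSum (fun x : ℕ × ℕ => √(x.1 : ℝ) * √(x.2 + 1 : ℝ) * g x.1 (x.2 + 1) (x.1 - 1) x.2) k := by
    refine (inj10.hasSum_iff ?_).mp ?_
    · rintro ⟨i, r⟩ hx
      rcases i with _ | i
      · simp
      · exact absurd ⟨(i, r), rfl⟩ hx
    · refine hK.congr_fun fun x => ?_
      simp only [Function.comp, Nat.add_sub_cancel, Nat.cast_add, Nat.cast_one]
  have hsq : ∀ n : ℕ, √(n : ℝ) * √(n : ℝ) = n := fun n => Real.mul_self_sqrt (Nat.cast_nonneg n)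
  refine ⟨nI, nS, k, ?_, ?_, ?_, fun c₀ c₁ c₂ c₃ => ?_⟩
  · have e : HasSum (fun x : ℕ × ℕ => (x.1 : ℝ) * g x.1 x.2 x.1 x.2) (A * k + B * (nI + T)) := by
      refine ((hK'.mul_left A).add (hI'.mul_left B)).congr_fun fun x => ?_
      linear_combination h.idler x.1 x.2 x.1 x.2 +
        B * g (x.1 - 1) x.2 (x.1 - 1) x.2 * hsq x.1
    linarith [hI.unique e]
  · have e : HasSum (fun x : ℕ × ℕ => (x.2 : ℝ) * g x.1 x.2 x.1 x.2) (A * k + D * (nS + T)) := by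
      refine ((hK'.mul_left A).add (hS'.mul_left D)).congr_fun fun x => ?_
      linear_combination h.probe x.1 x.2 x.1 x.2 +
        D * g x.1 (x.2 - 1) x.1 (x.2 - 1) * hsq x.2
    linarith [hS.unique e]
  · have e : HasSum (fun x : ℕ × ℕ =>
        √(x.1 + 1 : ℝ) * √(x.2 + 1 : ℝ) * g (x.1 + 1) (x.2 + 1) x.1 x.2) (A * (nS + T) + B * k) := by
      refine (((hS.add hT).mul_left A).add (hM.mul_left B)).congr_fun fun x => ?_
      have h1 := h.succ_idler x.1 (x.2 + 1) x.1 x.2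
      have h2 := hsq (x.2 + 1)
      simp only [Nat.add_sub_cancel, Nat.cast_add, Nat.cast_one] at h1 h2
      linear_combination √(x.2 + 1 : ℝ) * h1 + A * g x.1 x.2 x.1 x.2 * h2
    linarith [hK.unique e]
  · have e := ((((hT.mul_left c₀).add (hI.mul_left c₁)).add (hS.mul_left c₂)).add
      (hK.mul_left c₃)).add (hK'.mul_left c₃)
    have hv : c₀ * T + c₁ * nI + c₂ * nS + 2 * c₃ * k =
        c₀ * T + c₁ * nI + c₂ * nS + c₃ * k + c₃ * k := by ring
    rw [hv]
    refine e.congr_fun fun x => ?_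
    unfold quadraticOp
    ring

end Moments

/-! ### Sums of products over several modes -/

section PiSums

theorem hasSum_pi_prod {β : Type} {n : ℕ} {f : Fin n → β → ℝ} {s : Fin n → ℝ}
    (hf : ∀ m, HasSum (f m) (s m)) :
    HasSum (fun x : Fin n → β => ∏ m, f m (x m)) (∏ m, s m) := by
  induction n with
  | zero => simp
  | succ n ih =>
    have h1 := ih fun m => hf m.succ
    have hs : Summable fun p : β × (Fin n → β) => f 0 p.1 * ∏ m : Fin n, f m.succ (p.2 m) :=
      summable_mul_of_summable_norm (f := f 0) (g := fun x : Fin n → β => ∏ m : Fin n, f m.succ (x m))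
        (hf 0).summable.norm h1.summable.norm
    have h2 := (hf 0).mul h1 hs
    rw [Fin.prod_univ_succ, ← (Fin.consEquiv fun _ : Fin (n + 1) => β).hasSum_iff]
    refine h2.congr_fun fun p => ?_
    simp [Fin.prod_univ_succ]

end PiSums

/-! ### A single mode of the output state -/

section SingleMode

theorem boseEinstein_eq {N : ℝ} (k : ℕ) :
    boseEinstein N k = (1 + N)⁻¹ * (N / (1 + N)) ^ k := by
  rw [boseEinstein, div_pow, pow_succ]
  field_simp

theorem boseEinstein_nonneg {N : ℝ} (hN : 0 ≤ N) (k : ℕ) : 0 ≤ boseEinstein N k := by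
  unfold boseEinstein; positivity

theorem sqrt_boseEinstein_succ {N : ℝ} (hN : 0 ≤ N) (k : ℕ) :
    √(boseEinstein N (k + 1)) = √(N / (1 + N)) * √(boseEinstein N k) := by
  rw [← Real.sqrt_mul (by positivity), boseEinstein_eq, boseEinstein_eq, pow_succ]
  congr 1
  ring

theorem hasSum_boseEinstein {N : ℝ} (hN : 0 ≤ N) : HasSum (boseEinstein N) 1 := by
  have h1 : N / (1 + N) < 1 := by rw [div_lt_one (by positivity)]; linarith
  have h := (hasSum_geometric_of_lt_one (by positivity : 0 ≤ N / (1 + N)) h1).mul_left (1 + N)⁻¹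
  have e : (1 + N)⁻¹ * (1 - N / (1 + N))⁻¹ = 1 := by
    have : (1 : ℝ) + N ≠ 0 := by positivity
    rw [← mul_inv, mul_sub, mul_one, mul_div_cancel₀ _ this]
    simp
  rw [e] at h
  exact h.congr_fun fun k => boseEinstein_eq k

/-- The amplitude of the output with environment photon numbers `p = (k, l)` before and after. -/
noncomputable def krausAmp (nT nS t : ℝ) (p : ℕ × ℕ) (i r : ℕ) : ℝ :=
  √(boseEinstein nT p.1) * (√(boseEinstein nS i) * beamsplitterAmp t r p.2 i p.1)

/-- The Fock matrix of one idler-probe pair at the output. -/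
noncomputable def modeState (nB nS t : ℝ) (i r i' r' : ℕ) : ℝ :=
  √(boseEinstein nS i) * √(boseEinstein nS i') *
    ((1 + nB / (1 - t))⁻¹ * envOverlap (nB / (1 - t) / (1 + nB / (1 - t))) t i r i' r')

variable {nB nS t : ℝ}

theorem envMean_nonneg (hB : 0 ≤ nB) (h1 : t < 1) : 0 ≤ nB / (1 - t) :=
  div_nonneg hB (by linarith)

theorem envRatio_nonneg (hB : 0 ≤ nB) (h1 : t < 1) : 0 ≤ nB / (1 - t) / (1 + nB / (1 - t)) := by
  have := envMean_nonneg hB h1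
  positivity

theorem envRatio_lt_one (hB : 0 ≤ nB) (h1 : t < 1) : nB / (1 - t) / (1 + nB / (1 - t)) < 1 := by
  have := envMean_nonneg hB h1
  rw [div_lt_one (by positivity)]
  linarith

theorem envRatio_eq (h1 : t < 1) : nB / (1 - t) / (1 + nB / (1 - t)) = nB / (1 - t + nB) := by
  have : 1 - t ≠ 0 := by linarith
  field_simp

theorem hasSum_krausAmp (hB : 0 ≤ nB) (h0 : 0 ≤ t) (h1 : t < 1) (i r i' r' : ℕ) :
    HasSum (fun p => krausAmp (nB / (1 - t)) nS t p i r * krausAmp (nB / (1 - t)) nS t p i' r')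
      (modeState nB nS t i r i' r') := by
  have h := ((summable_envOverlap (envRatio_nonneg hB h1) (envRatio_lt_one hB h1) h0 h1.le
    i r i' r').hasSum.mul_left (1 + nB / (1 - t))⁻¹).mul_left
      (√(boseEinstein nS i) * √(boseEinstein nS i'))
  refine h.congr_fun fun p => ?_
  have e := Real.mul_self_sqrt (boseEinstein_nonneg (envMean_nonneg hB h1) p.1)
  have hk := boseEinstein_eq (N := nB / (1 - t)) p.1
  unfold krausAmp
  linear_combination (√(boseEinstein nS i) * √(boseEinstein nS i') * beamsplitterAmp t r p.2 i p.1 *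
    beamsplitterAmp t r' p.2 i' p.1) * (e + hk)

/-- The matrix of one output mode satisfies the ladder relations of a squeezed thermal state. -/
theorem isSqueezedThermal_modeState (hB : 0 ≤ nB) (hS : 0 ≤ nS) (h0 : 0 ≤ t) (h1 : t < 1) :
    IsSqueezedThermal (√(nS / (1 + nS)) * √t / (1 + nB)) (nS / (1 + nS) * (1 - t + nB) / (1 + nB))
      (nB / (1 + nB)) (modeState nB nS t) := by
  have hq0 := envRatio_nonneg hB h1
  have hq1 := envRatio_lt_one hB h1
  have h1t : 0 < 1 - t := by linarith
  have hd : 1 - t + nB ≠ 0 := by positivity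
  have hd' : 1 + nB ≠ 0 := by positivity
  have hden : 1 - nB / (1 - t + nB) * t = (1 - t) * (1 + nB) / (1 - t + nB) := by
    field_simp; ring
  -- Here the environment mean `nB / (1 - t)` pays off: the factor `1 - t` cancels, so that `D = nB
  -- / (1 + nB)` and the denominators do not depend on `t`.
  have ea : (1 - nB / (1 - t + nB)) / (1 - nB / (1 - t + nB) * t) = (1 + nB)⁻¹ := by
    rw [hden]; field_simp; ring
  have eb : (1 - t) / (1 - nB / (1 - t + nB) * t) = (1 - t + nB) / (1 + nB) := by
    rw [hden]; field_simp
  have hl : √(nS / (1 + nS)) * √(nS / (1 + nS)) = nS / (1 + nS) := Real.mul_self_sqrt (by positivity)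
  refine ⟨fun i r i' r' => ?_, fun i r i' r' => ?_, fun i r i' r' => ?_⟩
  · unfold modeState
    rw [envOverlap_symm]; ring
  · have e := envOverlap_succ_signal hq0 hq1 h0 h1.le i r i' r'
    rw [envRatio_eq h1, ea, eb] at e
    unfold modeState
    rw [envRatio_eq h1, sqrt_boseEinstein_succ hS]
    rcases i' with _ | i'
    · simp only [Nat.cast_zero, Real.sqrt_zero, mul_zero, zero_mul, add_zero] at e ⊢
      linear_combination √(nS / (1 + nS)) * √(boseEinstein nS i) * √(boseEinstein nS 0) *
        (1 + nB / (1 - t))⁻¹ * e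
    · rw [sqrt_boseEinstein_succ hS i']
      simp only [Nat.add_sub_cancel] at e ⊢
      linear_combination √(nS / (1 + nS)) * √(boseEinstein nS i) * √(nS / (1 + nS)) *
        √(boseEinstein nS i') * (1 + nB / (1 - t))⁻¹ * e +
        √(boseEinstein nS i) * √(boseEinstein nS i') * (1 + nB / (1 - t))⁻¹ *
        ((1 - t + nB) / (1 + nB)) * √((i' + 1 : ℕ) : ℝ) *
          envOverlap (nB / (1 - t + nB)) t i r i' r' * hl
  · have e := envOverlap_succ_returned hq0 hq1 h0 h1.le i r i' r'
    rw [envRatio_eq h1, ea, eb] at e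
    have ed : nB / (1 - t + nB) * ((1 - t + nB) / (1 + nB)) = nB / (1 + nB) := by field_simp
    rw [ed] at e
    unfold modeState
    rw [envRatio_eq h1]
    rcases i with _ | i
    · simp only [Nat.cast_zero, Real.sqrt_zero, mul_zero, zero_mul, zero_add] at e ⊢
      linear_combination √(boseEinstein nS 0) * √(boseEinstein nS i') * (1 + nB / (1 - t))⁻¹ * e
    · rw [sqrt_boseEinstein_succ hS i]
      simp only [Nat.add_sub_cancel] at e ⊢
      linear_combination √(nS / (1 + nS)) * √(boseEinstein nS i) * √(boseEinstein nS i') *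
        (1 + nB / (1 - t))⁻¹ * e

/-- `(1 + nT)(1 - q t) = 1 + nB`, so the vacuum entry is constant in `t`; it is the base case for
differentiating the entries. -/
theorem modeState_zero (hB : 0 ≤ nB) (hS : 0 ≤ nS) (h0 : 0 ≤ t) (h1 : t < 1) :
    modeState nB nS t 0 0 0 0 = (1 + nS)⁻¹ * (1 + nB)⁻¹ := by
  have h1t : 0 < 1 - t := by linarith
  have hd : 1 - t + nB ≠ 0 := by positivity
  have hd' : 1 + nB ≠ 0 := by positivity
  unfold modeState
  rw [envOverlap_zero (envRatio_nonneg hB h1) (envRatio_lt_one hB h1) h0 h1.le,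
    Real.mul_self_sqrt (boseEinstein_nonneg hS 0), envRatio_eq h1, ← mul_inv]
  have : (1 + nB / (1 - t)) * (1 - nB / (1 - t + nB) * t) = 1 + nB := by
    field_simp; ring
  rw [this]
  simp [boseEinstein]

theorem hasSum_beamsplitterAmp_sq (h0 : 0 ≤ t) (h1 : t ≤ 1) (s k : ℕ) :
    HasSum (fun p : ℕ × ℕ => beamsplitterAmp t p.1 p.2 s k ^ 2) 1 := by
  rw [← sum_antidiagonal_beamsplitterAmp_sq h0 h1 s k]
  refine hasSum_sum_of_ne_finset_zero fun p hp => ?_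
  rw [beamsplitterAmp_of_ne t (fun e => hp (Finset.HasAntidiagonal.mem_antidiagonal.mpr e))]
  simp

/-- Trace preservation by Tonelli: summing first over the output photon numbers uses the isometry,
and the input weights are probabilities. -/
theorem hasSum_modeState_diag (hB : 0 ≤ nB) (hS : 0 ≤ nS) (h0 : 0 ≤ t) (h1 : t < 1) :
    HasSum (fun x : ℕ × ℕ => modeState nB nS t x.1 x.2 x.1 x.2) 1 := by
  have hT := envMean_nonneg hB h1
  let F : (ℕ × ℕ) × (ℕ × ℕ) → ℝ := fun z =>
    boseEinstein nS z.1.1 * boseEinstein (nB / (1 - t)) z.1.2 *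
      beamsplitterAmp t z.2.1 z.2.2 z.1.1 z.1.2 ^ 2
  have hfib : ∀ y : ℕ × ℕ, HasSum (fun p => F (y, p))
      (boseEinstein nS y.1 * boseEinstein (nB / (1 - t)) y.2) := fun y => by
    simpa using (hasSum_beamsplitterAmp_sq h0 h1.le y.1 y.2).mul_left
      (boseEinstein nS y.1 * boseEinstein (nB / (1 - t)) y.2)
  have hout : HasSum (fun y : ℕ × ℕ => boseEinstein nS y.1 * boseEinstein (nB / (1 - t)) y.2) 1 := by
    have a := hasSum_boseEinstein hS
    have b := hasSum_boseEinstein hT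
    simpa using a.mul b (a.summable.mul_of_nonneg b.summable (boseEinstein_nonneg hS)
      (boseEinstein_nonneg hT))
  have hF0 : 0 ≤ F := fun z => mul_nonneg (mul_nonneg (boseEinstein_nonneg hS _)
    (boseEinstein_nonneg hT _)) (sq_nonneg _)
  have hsum : Summable F := (summable_prod_of_nonneg hF0).mpr
    ⟨fun y => (hfib y).summable, by simpa only [(hfib _).tsum_eq] using hout.summable⟩
  have hF : HasSum F 1 := by
    have := hsum.hasSum.prod_fiberwise hfib
    rw [hout.unique this]
    exact hsum.hasSum
  have hF' := (Equiv.prodProdProdComm ℕ ℕ ℕ ℕ).hasSum_iff.mpr hF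
  refine hF'.prod_fiberwise fun x => ?_
  refine (hasSum_krausAmp (nS := nS) hB h0 h1 x.1 x.2 x.1 x.2).congr_fun fun p => ?_
  have e1 := Real.mul_self_sqrt (boseEinstein_nonneg hS x.1)
  have e2 := Real.mul_self_sqrt (boseEinstein_nonneg hT p.1)
  simp only [F, Function.comp, Equiv.prodProdProdComm_apply, krausAmp]
  linear_combination -beamsplitterAmp t x.2 p.2 x.1 p.1 ^ 2 *
    (boseEinstein nS x.1 * e2 + √(boseEinstein (nB / (1 - t)) p.1) *
      √(boseEinstein (nB / (1 - t)) p.1) * e1)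

/-- Geometric decay of the matrix entries, uniformly near a given transmittance. -/
theorem exists_decay_rate (hB : 0 ≤ nB) (hS : 0 ≤ nS) {θ : ℝ} (h0 : 0 < θ) (h1 : θ < 1) :
    ∃ ϱ ε : ℝ, 0 < ϱ ∧ ϱ < 1 ∧ 0 < ε ∧ ∀ t ∈ Metric.ball θ ε, θ / 2 < t ∧ t < 1 ∧ ∀ i r i' r',
      |modeState nB nS t i r i' r'| ≤ ϱ ^ (i + r + i' + r') := by
  set lam := nS / (1 + nS) with hlam
  have hlam0 : 0 ≤ lam := by positivity
  have hlam1 : lam < 1 := by rw [hlam, div_lt_one (by positivity)]; linarith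
  let b : ℝ → ℝ := fun t => lam * (1 - t + nB) / (1 + nB)
  let d : ℝ := nB / (1 + nB)
  have hd1 : d < 1 := by simp only [d]; rw [div_lt_one (by positivity)]; linarith
  have hb1 : b θ < 1 := by
    simp only [b]
    rw [div_lt_one (by positivity)]
    nlinarith
  -- At `ϱ = 1` the determinant condition for geometric decay has the gap `(1 - lam) / (1 + nB) >
  -- 0`. All conditions are strict there, so they persist for `ϱ` slightly below one and `t` near
  -- `θ`.
  have hAB : lam * θ / (1 + nB) ^ 2 < (1 - b θ) * (1 - d) := by
    have hne : 1 + nB ≠ 0 := by positivity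
    have : (1 - b θ) * (1 - d) - lam * θ / (1 + nB) ^ 2 = (1 - lam) / (1 + nB) := by
      simp only [b, d]; field_simp; ring
    have h2 : 0 < (1 - lam) / (1 + nB) := div_pos (by linarith) (by positivity)
    linarith
  have hbc : Continuous b := by fun_prop
  have ev : ∀ᶠ z : ℝ × ℝ in 𝓝 (1, θ), 0 < z.1 ∧ b z.2 < z.1 ^ 2 ∧ d < z.1 ^ 2 ∧
      lam * z.2 / (1 + nB) ^ 2 < (z.1 ^ 2 - b z.2) * (z.1 ^ 2 - d) ∧ θ / 2 < z.2 ∧ z.2 < 1 := by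
    have c1 : Continuous fun z : ℝ × ℝ => b z.2 := hbc.comp continuous_snd
    refine (continuous_fst.tendsto _).eventually_const_lt (by norm_num) |>.and ?_
    refine ((c1.tendsto (1, θ)).eventually_lt ((continuous_fst.pow 2).tendsto _) (by simpa)).and ?_
    refine (((continuous_fst.pow 2).tendsto (1, θ)).eventually_const_lt (by simpa)).and ?_
    refine (Filter.Tendsto.eventually_lt
      (Continuous.tendsto (f := fun z : ℝ × ℝ => lam * z.2 / (1 + nB) ^ 2) (by fun_prop) (1, θ))
      (Continuous.tendsto (f := fun z : ℝ × ℝ => (z.1 ^ 2 - b z.2) * (z.1 ^ 2 - d))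
        (by fun_prop) (1, θ)) (by simpa using hAB)).and ?_
    exact ((continuous_snd.tendsto (1, θ)).eventually_const_lt (half_lt_self h0)).and
      ((continuous_snd.tendsto (1, θ)).eventually_lt_const h1)
  obtain ⟨ε, hε, hball⟩ := Metric.eventually_nhds_iff.mp ev
  set ϱ := 1 - min (ε / 2) (1 / 2) with hϱ
  have hmin : 0 < min (ε / 2) (1 / 2) := by positivity
  have hϱ0 : 0 < ϱ := by linarith [min_le_right (ε / 2) (1 / 2)]
  refine ⟨ϱ, ε, hϱ0, by linarith, hε, fun t ht => ?_⟩
  have hdist : dist (ϱ, t) ((1 : ℝ), θ) < ε := by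
    rw [Prod.dist_eq]
    refine max_lt ?_ ht
    change dist ϱ 1 < ε
    rw [Real.dist_eq, hϱ, abs_lt]
    constructor <;> linarith [min_le_left (ε / 2) (1 / 2)]
  obtain ⟨-, hb2, hd2, hA2, hθt, ht1⟩ := hball hdist
  refine ⟨hθt, ht1, fun i r i' r' => ?_⟩
  simp only at hb2 hd2 hA2 hθt ht1
  have ht0 : 0 < t := (half_pos h0).trans hθt
  have hz := modeState_zero hB hS ht0.le ht1
  have h := (isSqueezedThermal_modeState hB hS ht0.le ht1).abs_le (by positivity)
    (div_nonneg (mul_nonneg hlam0 (by linarith)) (by positivity)) (by positivity) hϱ0 hb2.le hd2.le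
    (by
      rw [div_pow, mul_pow, Real.sq_sqrt hlam0, Real.sq_sqrt ht0.le]
      exact hA2.le) i r i' r'
  have hle : |modeState nB nS t 0 0 0 0| ≤ 1 := by
    rw [hz, ← mul_inv, abs_of_nonneg (by positivity)]
    exact inv_le_one_of_one_le₀ (by nlinarith)
  exact h.trans (mul_le_of_le_one_left (by positivity) hle)

/-- The trace of a quadratic operator against one output mode. -/
theorem hasSum_quadraticOp_modeState (hB : 0 ≤ nB) (hS : 0 ≤ nS) (h0 : 0 < t) (h1 : t < 1)
    (c₀ c₁ c₂ c₃ : ℝ) :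
    HasSum (fun x : ℕ × ℕ =>
      quadraticOp c₀ c₁ c₂ c₃ (fun j s => modeState nB nS t j s x.1 x.2) x.1 x.2)
      (c₀ + c₁ * nS + c₂ * (nS * t + nB) + 2 * c₃ * (√(nS / (1 + nS)) * √t * (1 + nS))) := by
  obtain ⟨ϱ, ε, hϱ0, hϱ1, hε, hdec⟩ := exists_decay_rate hB hS h0 h1
  obtain ⟨-, -, hb⟩ := hdec t (Metric.mem_ball_self hε)
  obtain ⟨mI, mS, k, e1, e2, e3, hsum⟩ :=
    (isSqueezedThermal_modeState hB hS h0.le h1).hasSum_quadraticOp (G := 1) hϱ0.le hϱ1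
      (by simpa using hb) (hasSum_modeState_diag hB hS h0.le h1)
  convert hsum c₀ c₁ c₂ c₃ using 1
  have hs : (√(nS / (1 + nS)) * √t) * (√(nS / (1 + nS)) * √t) = nS / (1 + nS) * t := by
    rw [mul_mul_mul_comm, Real.mul_self_sqrt (by positivity), Real.mul_self_sqrt h0.le]
  set s := √(nS / (1 + nS)) * √t with hs_def
  have hB' : 1 + nB ≠ 0 := by positivity
  have hS' : 1 + nS ≠ 0 := by positivity
  set lam := nS / (1 + nS) with hlam
  have hl : lam * (1 + nS) = nS := by rw [hlam]; field_simp
  have f1 : mI * (1 + nB - lam * (1 - t + nB)) = s * k + lam * (1 - t + nB) := by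
    field_simp at e1; linarith
  have f2 : mS = s * k + nB := by
    field_simp at e2; linarith
  have f3 : k * (1 + nB - lam * (1 - t + nB)) = s * (mS + 1) := by
    field_simp at e3; linarith
  -- Eliminating the probe number leaves `1 + nB - lam (1 - t + nB) - s²` as coefficient of `k`, and
  -- `s² = lam t` factors it as `(1 + nB)(1 - lam)`.
  have g1 : k * (1 - lam) = s := by
    refine mul_left_cancel₀ hB' ?_
    rw [f2] at f3
    linear_combination f3 + k * hs
  have g2 : k = s * (1 + nS) := by linear_combination (1 + nS) * g1 + k * hl
  have g3 : mS = nS * t + nB := by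
    rw [f2, g2]; linear_combination (1 + nS) * hs + t * hl
  have g4 : mI = nS := by
    have hpos : 0 < 1 + nB - lam * (1 - t + nB) := by
      have : lam < 1 := by rw [hlam, div_lt_one (by positivity)]; linarith
      nlinarith
    refine mul_right_cancel₀ hpos.ne' ?_
    rw [f1, g2]
    linear_combination (1 + nS) * hs + (t + (1 - t + nB)) * hl
  rw [g2, g3, g4]
  ring

end SingleMode

/-! ### The Fisher information as the derivative of an expectation value -/

section LocalOperators

variable {α J : Type} [Fintype J] {w : α → ℝ} {d : ℕ} {v : J → α → ℝ} {ν : J → α → α}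

/-- If `2 X' = Λ X + X Λ` then `Tr (Λ² X) = Tr (Λ X')`. -/
theorem IsSymmLocal.tsum_localOp_localOp (hΛ : IsSymmLocal w v ν) (hw : IsSummableWeight w d)
    {X X' : α → α → ℂ} (hX : JointDecay w X) (hsymm : ∀ a b, X a b = X b a)
    (hX' : ∀ a b, 2 * X' a b = localOp v ν (fun c => X c b) a + localOp v ν (X a) b) :
    ∑' a, localOp v ν (fun c => localOp v ν (fun c' => X c' a) c) a =
      ∑' a, localOp v ν (fun c => X' c a) a := by
  have hY := hΛ.jointDecay hw hX
  have hs1 := (hΛ.jointDecay hw hY).diag_summable hw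
  have hs2 := (hΛ.jointDecay hw hY.swap).diag_summable hw
  have ht := hΛ.trace_symm _ hY
  -- Twice `Tr Λ X'` is `Tr Λ Λ X + Tr Λ X Λ`, and the two traces agree by `ht`.
  have e : ∀ a, (2 : ℂ) * localOp v ν (fun c => X' c a) a =
      localOp v ν (fun c => localOp v ν (fun c' => X c' a) c) a +
        localOp v ν (fun c => localOp v ν (fun c' => X c' c) a) a := by
    intro a
    have : (2 : ℂ) • (fun c => X' c a) = (fun c => localOp v ν (fun c' => X c' a) c) +
        fun c => localOp v ν (fun c' => X c' c) a := by
      ext c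
      have hc : X c = fun c' => X c' c := funext fun c' => hsymm c c'
      simp only [Pi.smul_apply, smul_eq_mul, Pi.add_apply, hX' c a]
      rw [← hc]
    rw [← smul_eq_mul, ← Pi.smul_apply, ← map_smul, this, map_add, Pi.add_apply]
  have h2 := (tsum_congr e).trans (hs1.tsum_add hs2)
  rw [tsum_mul_left, ← ht, ← two_mul] at h2
  exact (mul_left_cancel₀ two_ne_zero h2).symm

/-- Existence of the quantum Fisher information, with its value as the derivative of the expectation
of the symmetric logarithmic derivative. -/
theorem hasQFI_of_hasDerivAt_trace [DecidableEq α] (hΛ : IsSymmLocal w v ν)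
    (hw : IsSummableWeight w d) {M : ℝ → Matrix α α ℂ} {m m' : ℝ → α → α → ℂ} {U : Set ℝ} {θ J : ℝ}
    {τ : ℝ → ℝ} (hU : IsOpen U) (hU' : IsPreconnected U) (hθ : θ ∈ U)
    (hM : ∀ t ∈ U, ∀ a b, M t a b = m t a b)
    (hd : ∀ a b, ∀ t ∈ U, HasDerivAt (fun t => m t a b) (m' t a b) t)
    (hm : ∀ t ∈ U, JointDecay w (m t))
    (hm' : ∀ N : ℕ, ∃ C, ∀ t ∈ U, ∀ a b, w a ^ N * w b ^ N * ‖m' t a b‖ ≤ C)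
    (hsymm : ∀ a b, m θ a b = m θ b a)
    (hsld : ∀ a b, 2 * m' θ a b = localOp v ν (fun c => m θ c b) a + localOp v ν (m θ a) b)
    (hτ : ∀ t ∈ U, HasSum (fun a => localOp v ν (fun c => m t c a) a) (τ t : ℂ))
    (hJ : HasDerivAt τ J θ) : HasQFI M θ J := by
  obtain ⟨C, hC⟩ := hm' d
  refine hasQFI_of_localOp hΛ hw hU hU' hθ hM hd hm (fun N => ?_) hC hsld ?_
  · obtain ⟨C, hC⟩ := hm' N
    exact ⟨C, hC θ hθ⟩
  -- The expectation is differentiated term by term with the local operator kept fixed; `d + 1`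
  -- powers are needed because the operator consumes one.
  have hJ' : ∑' a, localOp v ν (fun c => m' θ c a) a = J := by
    obtain ⟨C, hC⟩ := hm' (d + 1)
    obtain ⟨K, -, hK⟩ := hΛ.exists_bound hw d
    have key := hasDerivAt_tsum_of_isPreconnected (y₀ := θ) (y := θ)
      (g := fun a t => localOp v ν (fun c => m t c a) a)
      (g' := fun a t => localOp v ν (fun c => m' t c a) a)
      (u := fun a => K * C * (w a ^ d)⁻¹) (hw.summable.mul_left _) hU hU' (fun a t ht => ?_)
      (fun a t ht => ?_) hθ (hτ θ hθ).summable hθ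
    · refine key.unique (hJ.ofReal_comp.congr_of_eventuallyEq ?_)
      filter_upwards [hU.mem_nhds hθ] with t ht using (hτ t ht).tsum_eq
    · simp only [localOp_apply]
      exact HasDerivAt.fun_sum fun j _ => (hd _ a t ht).const_mul _
    · rw [← div_eq_mul_inv, le_div_iff₀ (hw.pow_pos d a), mul_comm]
      refine hK _ C (fun c => ?_) a
      refine le_trans ?_ (hC t ht c a)
      rw [mul_right_comm]
      exact le_mul_of_one_le_right (mul_nonneg (hw.pow_pos _ c).le (norm_nonneg _))
        (hw.one_le_pow _ a)
  have hmθ := hm θ hθ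
  rw [← hJ', ← hΛ.tsum_localOp_localOp hw hmθ hsymm hsld]
  exact ((hΛ.jointDecay hw (hΛ.jointDecay hw hmθ)).diag_summable hw).hasSum

end LocalOperators

/-! ### Quadratic operators on several pairs of modes -/

section Fock

/-- Fock labels of `n` idler modes and `n` probe modes. -/
abbrev FockLabel (n : ℕ) : Type := (Fin n → ℕ) × (Fin n → ℕ)

variable {n : ℕ}

/-- The total photon number. -/
def FockLabel.size (x : FockLabel n) : ℕ := ∑ m, x.1 m + ∑ m, x.2 m

/-- One idler photon and one probe photon in the pair `m`. -/
def FockLabel.pair (m : Fin n) : FockLabel n := (Pi.single m 1, Pi.single m 1)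

/-- The weight `1 + total photon number`. -/
def fockWeight (x : FockLabel n) : ℝ := 1 + x.size

theorem FockLabel.size_add (x y : FockLabel n) : (x + y).size = x.size + y.size := by
  simp only [size, Prod.fst_add, Prod.snd_add, Pi.add_apply, Finset.sum_add_distrib]
  ring

theorem FockLabel.size_pair (m : Fin n) : (pair m).size = 2 := by
  simp [size, pair]

theorem FockLabel.size_le_size_sub (x : FockLabel n) (m : Fin n) :
    x.size ≤ (x - pair m).size + 2 := by
  rw [← size_pair m, ← size_add]
  unfold size
  refine add_le_add (Finset.sum_le_sum fun j _ => ?_) (Finset.sum_le_sum fun j _ => ?_)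
  · simp only [Prod.fst_add, Prod.fst_sub, Pi.add_apply, Pi.sub_apply]; omega
  · simp only [Prod.snd_add, Prod.snd_sub, Pi.add_apply, Pi.sub_apply]; omega

theorem FockLabel.mode_le_size (x : FockLabel n) (m : Fin n) : x.1 m + x.2 m ≤ x.size :=
  add_le_add (Finset.single_le_sum (f := x.1) (fun _ _ => Nat.zero_le _) (Finset.mem_univ m))
    (Finset.single_le_sum (f := x.2) (fun _ _ => Nat.zero_le _) (Finset.mem_univ m))

theorem one_add_mode_le_fockWeight (x : FockLabel n) (m : Fin n) :
    (1 : ℝ) + (x.1 m + x.2 m) ≤ fockWeight x := by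
  unfold fockWeight
  have := x.mode_le_size m
  have : ((x.1 m + x.2 m : ℕ) : ℝ) ≤ x.size := by exact_mod_cast this
  push_cast at this
  linarith

theorem hasSum_fock_prod {f : Fin n → ℕ × ℕ → ℝ} {s : Fin n → ℝ} (hf : ∀ m, HasSum (f m) (s m)) :
    HasSum (fun x : FockLabel n => ∏ m, f m (x.1 m, x.2 m)) (∏ m, s m) :=
  (Equiv.arrowProdEquivProdArrow (Fin n) (fun _ => ℕ) (fun _ => ℕ)).hasSum_iff.mp (hasSum_pi_prod hf)

/-- Four powers of the weight per pair dominate `(i + 1)² (r + 1)²`, and the product of the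
resulting one-mode series converges. -/
theorem isSummableWeight_fockWeight : IsSummableWeight (fockWeight (n := n)) (4 * n) where
  one_le x := by unfold fockWeight; linarith [(Nat.cast_nonneg x.size : (0 : ℝ) ≤ x.size)]
  summable := by
    have h1 : Summable fun i : ℕ => (((i : ℝ) + 1) ^ 2)⁻¹ := by
      have := (summable_nat_add_iff 1).mpr (Real.summable_nat_pow_inv.mpr (by norm_num : 1 < 2))
      simpa using this
    have h0 : ∀ i : ℕ, 0 ≤ (((i : ℝ) + 1) ^ 2)⁻¹ := fun i => by positivity
    have h2 := h1.mul_of_nonneg h1 h0 h0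
    have h3 := (hasSum_fock_prod (n := n) fun _ => h2.hasSum).summable
    refine Summable.of_nonneg_of_le (fun x => ?_) (fun x => ?_) h3
    · unfold fockWeight; positivity
    · simp only [← mul_inv]
      rw [Finset.prod_inv_distrib]
      refine inv_anti₀ (Finset.prod_pos fun m _ => by positivity) ?_
      have : fockWeight x ^ (4 * n) = ∏ _m : Fin n, fockWeight x ^ 4 := by
        rw [Finset.prod_const, Finset.card_univ, Fintype.card_fin, pow_mul]
      rw [this]
      refine Finset.prod_le_prod (fun m _ => by positivity) fun m _ => ?_
      have hm := one_add_mode_le_fockWeight x m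
      have hi : (0 : ℝ) ≤ x.1 m := Nat.cast_nonneg _
      have hr : (0 : ℝ) ≤ x.2 m := Nat.cast_nonneg _
      calc ((x.1 m : ℝ) + 1) ^ 2 * ((x.2 m : ℝ) + 1) ^ 2
          ≤ fockWeight x ^ 2 * fockWeight x ^ 2 := by gcongr <;> linarith
        _ = fockWeight x ^ 4 := by ring

theorem exists_pow_mul_geometric_le {ϱ : ℝ} (h0 : 0 < ϱ) (h1 : ϱ < 1) (N : ℕ) :
    ∃ C : ℝ, ∀ s : ℕ, (1 + s : ℝ) ^ N * ϱ ^ s ≤ C := by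
  have ht : Tendsto (fun s : ℕ => ((s : ℝ) ^ N * ϱ ^ s)) atTop (𝓝 0) :=
    tendsto_pow_const_mul_const_pow_of_lt_one N h0.le h1
  have hb := (ht.comp (tendsto_add_atTop_nat 1)).bddAbove_range
  obtain ⟨C, hC⟩ := hb
  -- `C` bounds the sequence at `s + 1`, which carries one extra factor `ϱ`.
  refine ⟨C / ϱ, fun s => ?_⟩
  have := hC ⟨s, rfl⟩
  simp only [Function.comp, Nat.cast_add, Nat.cast_one] at this
  rw [le_div_iff₀ h0]
  refine le_trans (le_of_eq ?_) this
  rw [pow_succ]; ring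

/-- The coefficients of `∑ₘ (c₀ + c₁ aₘ†aₘ + c₂ bₘ†bₘ + c₃ (aₘbₘ + aₘ†bₘ†))` in the Fock basis. -/
noncomputable def quadraticCoeff (c₀ c₁ c₂ c₃ : ℝ) (j : Fin n × Fin 3) (x : FockLabel n) : ℝ :=
  ![c₀ + c₁ * x.1 j.1 + c₂ * x.2 j.1, c₃ * (√(x.1 j.1 + 1 : ℝ) * √(x.2 j.1 + 1 : ℝ)),
    c₃ * (√(x.1 j.1 : ℝ) * √(x.2 j.1 : ℝ))] j.2

/-- The Fock labels coupled by a quadratic operator. -/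
def quadraticShift (j : Fin n × Fin 3) (x : FockLabel n) : FockLabel n :=
  ![x, x + FockLabel.pair j.1, x - FockLabel.pair j.1] j.2

theorem localOp_quadratic (c₀ c₁ c₂ c₃ : ℝ) (f : FockLabel n → ℂ) (x : FockLabel n) :
    localOp (quadraticCoeff c₀ c₁ c₂ c₃) quadraticShift f x =
      ∑ m, (((c₀ + c₁ * x.1 m + c₂ * x.2 m : ℝ) : ℂ) * f x +
        ((c₃ * (√(x.1 m + 1 : ℝ) * √(x.2 m + 1 : ℝ)) : ℝ) : ℂ) * f (x + FockLabel.pair m) +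
        ((c₃ * (√(x.1 m : ℝ) * √(x.2 m : ℝ)) : ℝ) : ℂ) * f (x - FockLabel.pair m)) := by
  rw [localOp_apply, Fintype.sum_prod_type]
  refine Finset.sum_congr rfl fun m _ => ?_
  rw [Fin.sum_univ_three]
  rfl

theorem prod_erase_congr_pair {β : Type} [CommMonoid β] (f : Fin n → ℕ → ℕ → β) {x y : FockLabel n}
    {m : Fin n} (h : ∀ j, j ≠ m → y.1 j = x.1 j ∧ y.2 j = x.2 j) :
    ∏ j, f j (y.1 j) (y.2 j) =
      (∏ j ∈ Finset.univ.erase m, f j (x.1 j) (x.2 j)) * f m (y.1 m) (y.2 m) := by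
  rw [← Finset.prod_erase_mul _ _ (Finset.mem_univ m)]
  congr 1
  refine Finset.prod_congr rfl fun j hj => ?_
  obtain ⟨h1, h2⟩ := h j (Finset.ne_of_mem_erase hj)
  rw [h1, h2]

/-- On a product vector a sum of one-pair operators acts by the Leibniz rule, one pair at a time. -/
theorem localOp_quadratic_prod (c₀ c₁ c₂ c₃ : ℝ) (f : Fin n → ℕ → ℕ → ℝ) (x : FockLabel n) :
    localOp (quadraticCoeff c₀ c₁ c₂ c₃) quadraticShift
      (fun y => ((∏ j, f j (y.1 j) (y.2 j) : ℝ) : ℂ)) x =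
      ((∑ m, (∏ j ∈ Finset.univ.erase m, f j (x.1 j) (x.2 j)) *
        quadraticOp c₀ c₁ c₂ c₃ (f m) (x.1 m) (x.2 m) : ℝ) : ℂ) := by
  rw [localOp_quadratic, Complex.ofReal_sum]
  refine Finset.sum_congr rfl fun m _ => ?_
  rw [prod_erase_congr_pair f (x := x) (y := x) (m := m) (fun j _ => ⟨rfl, rfl⟩),
    prod_erase_congr_pair f (x := x) (y := x + FockLabel.pair m) (m := m) (fun j hj => by
      simp [FockLabel.pair, hj]),
    prod_erase_congr_pair f (x := x) (y := x - FockLabel.pair m) (m := m) (fun j hj => by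
      simp [FockLabel.pair, hj])]
  simp only [FockLabel.pair, Prod.fst_add, Prod.snd_add, Prod.fst_sub, Prod.snd_sub, Pi.add_apply,
    Pi.sub_apply, Pi.single_eq_same, quadraticOp]
  push_cast
  ring

theorem FockLabel.add_pair_injective (m : Fin n) :
    Function.Injective fun x : FockLabel n => x + pair m := fun _ _ h => add_right_cancel h

theorem FockLabel.add_sub_pair (x : FockLabel n) (m : Fin n) : x + pair m - pair m = x := by
  ext j <;> simp

theorem FockLabel.sub_add_pair {x : FockLabel n} {m : Fin n} (h1 : x.1 m ≠ 0) (h2 : x.2 m ≠ 0) :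
    x - pair m + pair m = x := by
  ext j
  · rcases eq_or_ne j m with rfl | hj
    · simp [pair]; omega
    · simp [pair, hj]
  · rcases eq_or_ne j m with rfl | hj
    · simp [pair]; omega
    · simp [pair, hj]

/-- Moving a photon pair from one side of a matrix to the other. -/
theorem tsum_pair_shift (c : ℝ) (X : FockLabel n → FockLabel n → ℂ) (m : Fin n) :
    ∑' x : FockLabel n, ((c * (√(x.1 m + 1 : ℝ) * √(x.2 m + 1 : ℝ)) : ℝ) : ℂ) *
        X (x + FockLabel.pair m) x =
      ∑' x : FockLabel n, ((c * (√(x.1 m : ℝ) * √(x.2 m : ℝ)) : ℝ) : ℂ) *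
        X x (x - FockLabel.pair m) := by
  refine Eq.trans ?_ ((FockLabel.add_pair_injective m).tsum_eq
    (f := fun x : FockLabel n => ((c * (√(x.1 m : ℝ) * √(x.2 m : ℝ)) : ℝ) : ℂ) *
      X x (x - FockLabel.pair m)) ?_)
  · refine tsum_congr fun x => ?_
    rw [FockLabel.add_sub_pair]
    simp [FockLabel.pair]
  -- A label not obtained by adding a pair has an empty mode there, and its coefficient vanishes;
  -- truncated subtraction is thus never seen.
  · intro x hx
    refine ⟨x - FockLabel.pair m, FockLabel.sub_add_pair ?_ ?_⟩
    · intro h; apply hx; simp [h]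
    · intro h; apply hx; simp [h]

theorem quadratic_bound (c₀ c₁ c₂ c₃ : ℝ) : ∃ K : ℝ, 0 ≤ K ∧ ∀ (j : Fin n × Fin 3) (x : FockLabel n),
    |quadraticCoeff c₀ c₁ c₂ c₃ j x| ≤ K * fockWeight x ∧
      fockWeight x ≤ K * fockWeight (quadraticShift j x) := by
  -- The summand `3` covers the change of the weight when two photons are added or removed; the rest
  -- covers the coefficients, with `√p √q ≤ (p + q) / 2` for the pair terms.
  refine ⟨3 + (|c₀| + |c₁| + |c₂| + |c₃|), by positivity, ?_⟩
  rintro ⟨m, e⟩ x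
  have hw1 : ∀ y : FockLabel n, 1 ≤ fockWeight y := isSummableWeight_fockWeight.one_le
  have hw := one_add_mode_le_fockWeight x m
  have hi : (0 : ℝ) ≤ x.1 m := Nat.cast_nonneg _
  have hr : (0 : ℝ) ≤ x.2 m := Nat.cast_nonneg _
  have a0 := abs_nonneg c₀
  have a1 := abs_nonneg c₁
  have a2 := abs_nonneg c₂
  have a3 := abs_nonneg c₃
  have hK : ∀ {y : ℝ}, y ≤ (|c₀| + |c₁| + |c₂| + |c₃|) * fockWeight x →
      y ≤ (3 + (|c₀| + |c₁| + |c₂| + |c₃|)) * fockWeight x := fun h => by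
    nlinarith [hw1 x]
  have hK' : ∀ {y : FockLabel n}, fockWeight x ≤ 3 * fockWeight y →
      fockWeight x ≤ (3 + (|c₀| + |c₁| + |c₂| + |c₃|)) * fockWeight y := fun {y} h => by
    nlinarith [hw1 y, mul_nonneg (add_nonneg (add_nonneg (add_nonneg a0 a1) a2) a3)
      (zero_le_one.trans (hw1 y))]
  have hsq : ∀ p q : ℝ, 0 ≤ p → 0 ≤ q → √p * √q ≤ (p + q) / 2 := fun p q hp hq => by
    nlinarith [sq_nonneg (√p - √q), Real.sq_sqrt hp, Real.sq_sqrt hq]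
  fin_cases e
  · refine ⟨hK ?_, hK' ?_⟩
    · change |c₀ + c₁ * x.1 m + c₂ * x.2 m| ≤ _
      calc |c₀ + c₁ * x.1 m + c₂ * x.2 m| ≤ |c₀| + |c₁| * x.1 m + |c₂| * x.2 m := by
            refine (abs_add_three _ _ _).trans (le_of_eq ?_)
            rw [abs_mul, abs_mul, Nat.abs_cast, Nat.abs_cast]
        _ ≤ |c₀| * fockWeight x + |c₁| * fockWeight x + |c₂| * fockWeight x := by
            gcongr
            · nlinarith [hw1 x]
            · linarith
            · linarith
        _ ≤ _ := by nlinarith [hw1 x]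
    · change fockWeight x ≤ 3 * fockWeight x
      linarith [hw1 x]
  · refine ⟨hK ?_, hK' ?_⟩
    · change |c₃ * (√(x.1 m + 1 : ℝ) * √(x.2 m + 1 : ℝ))| ≤ _
      rw [abs_mul, abs_of_nonneg (by positivity : 0 ≤ √(x.1 m + 1 : ℝ) * √(x.2 m + 1 : ℝ))]
      have h1 := hsq (x.1 m + 1) (x.2 m + 1) (by positivity) (by positivity)
      calc |c₃| * (√(x.1 m + 1 : ℝ) * √(x.2 m + 1 : ℝ)) ≤ |c₃| * fockWeight x := by
            gcongr; linarith
        _ ≤ _ := by gcongr; linarith; linarith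
    · change fockWeight x ≤ 3 * fockWeight (x + FockLabel.pair m)
      have : (x + FockLabel.pair m).size = x.size + 2 := by
        rw [FockLabel.size_add, FockLabel.size_pair]
      unfold fockWeight
      rw [this]
      push_cast
      linarith [(Nat.cast_nonneg x.size : (0 : ℝ) ≤ x.size)]
  · refine ⟨hK ?_, hK' ?_⟩
    · change |c₃ * (√(x.1 m : ℝ) * √(x.2 m : ℝ))| ≤ _
      rw [abs_mul, abs_of_nonneg (by positivity : 0 ≤ √(x.1 m : ℝ) * √(x.2 m : ℝ))]
      have h1 := hsq (x.1 m) (x.2 m) hi hr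
      calc |c₃| * (√(x.1 m : ℝ) * √(x.2 m : ℝ)) ≤ |c₃| * fockWeight x := by
            gcongr; linarith
        _ ≤ _ := by gcongr; linarith; linarith
    · change fockWeight x ≤ 3 * fockWeight (x - FockLabel.pair m)
      have h1 : (x.size : ℝ) ≤ (x - FockLabel.pair m).size + 2 := by
        exact_mod_cast x.size_le_size_sub m
      unfold fockWeight
      linarith [(Nat.cast_nonneg (x - FockLabel.pair m).size : (0 : ℝ) ≤ (x - FockLabel.pair m).size)]

theorem summable_quadratic_term (c₀ c₁ c₂ c₃ : ℝ) {X : FockLabel n → FockLabel n → ℂ}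
    (hX : JointDecay fockWeight X) (j : Fin n × Fin 3) :
    Summable fun x => (quadraticCoeff c₀ c₁ c₂ c₃ j x : ℂ) * X (quadraticShift j x) x := by
  have hw := isSummableWeight_fockWeight (n := n)
  obtain ⟨K, hK0, hK⟩ := quadratic_bound (n := n) c₀ c₁ c₂ c₃
  obtain ⟨C, hC⟩ := hX (4 * n + 1)
  refine Summable.of_norm (hw.summable_norm_of_bound (C := K * C) fun x => ?_)
  rw [norm_mul, Complex.norm_real, Real.norm_eq_abs]
  have h1 := hw.pos x
  have h2 := hw.one_le_pow (4 * n + 1) (quadraticShift j x)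
  calc fockWeight x ^ (4 * n) * (|quadraticCoeff c₀ c₁ c₂ c₃ j x| * ‖X (quadraticShift j x) x‖)
      ≤ fockWeight x ^ (4 * n) * (K * fockWeight x * ‖X (quadraticShift j x) x‖) := by
        gcongr; exact (hK j x).1
    _ = K * (1 * fockWeight x ^ (4 * n + 1) * ‖X (quadraticShift j x) x‖) := by ring
    _ ≤ K * (fockWeight (quadraticShift j x) ^ (4 * n + 1) * fockWeight x ^ (4 * n + 1) *
          ‖X (quadraticShift j x) x‖) := by gcongr
    _ ≤ K * C := by gcongr; exact hC _ _

/-- Diagonal terms are symmetric, and `tsum_pair_shift`, applied to `X` and to its transpose,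
exchanges pair creation with pair annihilation. -/
theorem isSymmLocal_quadratic (c₀ c₁ c₂ c₃ : ℝ) :
    IsSymmLocal (fockWeight (n := n)) (quadraticCoeff c₀ c₁ c₂ c₃) quadraticShift where
  bound := quadratic_bound c₀ c₁ c₂ c₃
  trace_symm X hX := by
    simp only [localOp_apply]
    rw [Summable.tsum_finsetSum fun j _ => summable_quadratic_term c₀ c₁ c₂ c₃ hX j,
      Summable.tsum_finsetSum fun j _ => summable_quadratic_term c₀ c₁ c₂ c₃ hX.swap j,
      Fintype.sum_prod_type, Fintype.sum_prod_type]
    refine Finset.sum_congr rfl fun m _ => ?_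
    rw [Fin.sum_univ_three, Fin.sum_univ_three]
    have h1 := tsum_pair_shift c₃ X m
    have h2 := tsum_pair_shift c₃ (fun a b => X b a) m
    have h3 : ∀ p q r q' r' : ℂ, q = r' → q' = r → p + q + r = p + q' + r' := by
      rintro p q r q' r' rfl rfl
      ring
    exact h3 _ _ _ _ _ h1 h2

end Fock

/-! ### The output state of several modes -/

section OutputState

variable {n : ℕ} {nB nS t : ℝ}

theorem tmsvAmp_self (n : ℕ) (nS : ℝ) (s : Fin n → ℕ) :
    tmsvAmp n nS (s, s) = ((∏ m, √(boseEinstein nS (s m)) : ℝ) : ℂ) := by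
  simp [tmsvAmp]

theorem tmsvAmp_of_ne (n : ℕ) (nS : ℝ) {s s' : Fin n → ℕ} (h : s ≠ s') :
    tmsvAmp n nS (s, s') = 0 := by
  obtain ⟨m, hm⟩ := Function.ne_iff.mp h
  exact Finset.prod_eq_zero (Finset.mem_univ m) (if_neg hm)

/-- The Fock matrix of `n` idler-probe pairs. -/
noncomputable def fockState (nB nS t : ℝ) (x y : FockLabel n) : ℝ :=
  ∏ m, modeState nB nS t (x.1 m) (x.2 m) (y.1 m) (y.2 m)

/-- The amplitude of the output with given environment photon numbers. -/
noncomputable def krausAmpPow (nT nS t : ℝ) (p : Fin n → ℕ × ℕ) (x : FockLabel n) : ℝ :=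
  ∏ m, krausAmp nT nS t (p m) (x.1 m) (x.2 m)

theorem hasSum_krausAmpPow (hB : 0 ≤ nB) (h0 : 0 ≤ t) (h1 : t < 1) (x y : FockLabel n) :
    HasSum (fun p => ((krausAmpPow (nB / (1 - t)) nS t p x *
      krausAmpPow (nB / (1 - t)) nS t p y : ℝ) : ℂ)) (fockState nB nS t x y : ℂ) := by
  refine Complex.hasSum_ofReal.mpr ?_
  refine (hasSum_pi_prod fun m => hasSum_krausAmp (nS := nS) hB h0 h1 (x.1 m) (x.2 m) (y.1 m)
    (y.2 m)).congr_fun fun p => ?_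
  exact Finset.prod_mul_distrib.symm

theorem krausAmpPow_eq (nT nS t : ℝ) (p : Fin n → ℕ × ℕ) (x : FockLabel n) :
    krausAmpPow nT nS t p x = (∏ m, √(boseEinstein nT (p m).1)) *
      ((∏ m, √(boseEinstein nS (x.1 m))) *
        beamsplitterAmpPow n t x.2 (fun m => (p m).2) x.1 fun m => (p m).1) := by
  simp only [krausAmpPow, krausAmp, beamsplitterAmpPow, Finset.prod_mul_distrib]

/-- The squeezed vacuum is supported on equal idler and signal patterns, which forces `s = x.1` and
`s' = y.1`; the remaining sum over `(k, l)` factors over the modes. -/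
theorem outputState_eq_fockState (hB : 0 ≤ nB) (h0 : 0 ≤ t) (h1 : t < 1) (x y : FockLabel n) :
    outputState n nB nS t x y = fockState nB nS t x y := by
  have hN := envMean_nonneg hB h1
  have hinj : Function.Injective fun p : Fin n → ℕ × ℕ =>
      ((fun m => (p m).1, fun m => (p m).2, x.1, y.1) :
        (Fin n → ℕ) × (Fin n → ℕ) × (Fin n → ℕ) × (Fin n → ℕ)) := by
    intro p q h
    simp only [Prod.mk.injEq, and_true] at h
    exact funext fun m => Prod.ext (congrFun h.1 m) (congrFun h.2 m)
  refine HasSum.tsum_eq ((hinj.hasSum_iff ?_).mp ?_)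
  · rintro ⟨k, l, s, s'⟩ hp
    simp only [tmsvState]
    by_cases hs : x.1 = s
    · by_cases hs' : y.1 = s'
      · exact absurd ⟨fun m => (k m, l m), by simp [hs, hs']⟩ hp
      · simp [tmsvAmp_of_ne n nS hs']
    · simp [tmsvAmp_of_ne n nS hs]
  · refine (hasSum_krausAmpPow hB h0 h1 x y).congr_fun fun p => ?_
    simp only [Function.comp, tmsvState, tmsvAmp_self, Complex.conj_ofReal, ← Complex.ofReal_mul]
    congr 1
    have e : (∏ m, √(boseEinstein (nB / (1 - t)) (p m).1)) *
        (∏ m, √(boseEinstein (nB / (1 - t)) (p m).1)) =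
          thermalPow n (nB / (1 - t)) fun m => (p m).1 := by
      rw [← Finset.prod_mul_distrib]
      exact Finset.prod_congr rfl fun m _ => Real.mul_self_sqrt (boseEinstein_nonneg hN _)
    rw [krausAmpPow_eq, krausAmpPow_eq]
    linear_combination (-(∏ m, √(boseEinstein nS (x.1 m))) * (∏ m, √(boseEinstein nS (y.1 m))) *
      beamsplitterAmpPow n t x.2 (fun m => (p m).2) x.1 (fun m => (p m).1) *
      beamsplitterAmpPow n t y.2 (fun m => (p m).2) y.1 fun m => (p m).1) * e

theorem outputState_nonneg (hB : 0 ≤ nB) (h0 : 0 ≤ t) (h1 : t < 1)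
    {S : ℓ²(FockLabel n, ℂ) →L[ℂ] ℓ²(FockLabel n, ℂ)} (hS : HasMatrix S (outputState n nB nS t)) :
    0 ≤ S :=
  hS.nonneg_of_gram (krausAmpPow (nB / (1 - t)) nS t) fun x y => by
    rw [outputState_eq_fockState hB h0 h1]
    exact hasSum_krausAmpPow hB h0 h1 x y

theorem FockLabel.sum_modes (x y : FockLabel n) :
    ∑ m, (x.1 m + x.2 m + y.1 m + y.2 m) = x.size + y.size := by
  simp only [size, Finset.sum_add_distrib]
  ring

theorem abs_fockState_le {ϱ : ℝ}
    (h : ∀ i r i' r', |modeState nB nS t i r i' r'| ≤ ϱ ^ (i + r + i' + r')) (x y : FockLabel n) :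
    |fockState nB nS t x y| ≤ ϱ ^ (x.size + y.size) := by
  rw [fockState, Finset.abs_prod, ← FockLabel.sum_modes, ← Finset.prod_pow_eq_pow_sum]
  exact Finset.prod_le_prod (fun _ _ => abs_nonneg _) fun m _ => h _ _ _ _

/-- Every term lowers the total photon number by two, costing `ϱ⁻²`, and its square roots are at
most linear in that number. -/
theorem abs_squeezedThermalDeriv_le {ϱ : ℝ} (h0 : 0 < ϱ) {g : ℕ → ℕ → ℕ → ℕ → ℝ}
    (h : ∀ i r i' r', |g i r i' r'| ≤ ϱ ^ (i + r + i' + r')) (A' B' : ℝ) (i r i' r' : ℕ) :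
    |squeezedThermalDeriv A' B' g i r i' r'| ≤ (2 * |A'| + |B'|) / ϱ ^ 2 *
      ((1 + (i + r + i' + r' : ℕ)) * ϱ ^ (i + r + i' + r')) := by
  set s := i + r + i' + r' with hs
  have key : ∀ p q : ℕ, ∀ z : ℝ, p + q ≤ s → (p ≠ 0 → q ≠ 0 → |z| * ϱ ^ 2 ≤ ϱ ^ s) →
      |√(p : ℝ) * √(q : ℝ) * z| ≤ (1 + (s : ℝ)) * ϱ ^ s / ϱ ^ 2 := by
    intro p q z hpq hz
    rcases Nat.eq_zero_or_pos p with rfl | hp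
    · simp; positivity
    rcases Nat.eq_zero_or_pos q with rfl | hq
    · simp; positivity
    have hz' := hz hp.ne' hq.ne'
    rw [le_div_iff₀ (by positivity), abs_mul, mul_assoc]
    refine mul_le_mul ?_ hz' (by positivity) (by positivity)
    rw [abs_of_nonneg (by positivity)]
    have : ((p + q : ℕ) : ℝ) ≤ s := by exact_mod_cast hpq
    push_cast at this
    nlinarith [sq_nonneg (√(p : ℝ) - √(q : ℝ)), Real.sq_sqrt (Nat.cast_nonneg (α := ℝ) p),
      Real.sq_sqrt (Nat.cast_nonneg (α := ℝ) q), (Nat.cast_nonneg (α := ℝ) p),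
      (Nat.cast_nonneg (α := ℝ) q)]
  have hg : ∀ a b c d : ℕ, a + b + c + d + 2 = s → |g a b c d| * ϱ ^ 2 ≤ ϱ ^ s := by
    intro a b c d hsum
    rw [← hsum, pow_add]
    exact mul_le_mul_of_nonneg_right (h _ _ _ _) (by positivity)
  have k1 := key i r (g (i - 1) (r - 1) i' r') (by omega) fun _ _ => hg _ _ _ _ (by omega)
  have k2 := key i' r' (g i r (i' - 1) (r' - 1)) (by omega) fun _ _ => hg _ _ _ _ (by omega)
  have k3 := key i i' (g (i - 1) r (i' - 1) r') (by omega) fun _ _ => hg _ _ _ _ (by omega)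
  unfold squeezedThermalDeriv
  calc _ ≤ |A'| * ((1 + (s : ℝ)) * ϱ ^ s / ϱ ^ 2 + (1 + (s : ℝ)) * ϱ ^ s / ϱ ^ 2) +
        |B'| * ((1 + (s : ℝ)) * ϱ ^ s / ϱ ^ 2) := by
        refine (abs_add_le _ _).trans (add_le_add ?_ ?_)
        · rw [abs_mul]
          exact mul_le_mul_of_nonneg_left ((abs_add_le _ _).trans (add_le_add k1 k2)) (abs_nonneg _)
        · rw [abs_mul]
          exact mul_le_mul_of_nonneg_left k3 (abs_nonneg _)
    _ = _ := by ring

/-- The derivative of the Fock matrix in terms of the velocities of the two parameters. -/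
noncomputable def fockStateDeriv (A' B' nB nS t : ℝ) (x y : FockLabel n) : ℝ :=
  ∑ m, (∏ j ∈ Finset.univ.erase m, modeState nB nS t (x.1 j) (x.2 j) (y.1 j) (y.2 j)) *
    squeezedThermalDeriv A' B' (modeState nB nS t) (x.1 m) (x.2 m) (y.1 m) (y.2 m)

theorem abs_fockStateDeriv_le {ϱ : ℝ} (h0 : 0 < ϱ)
    (h : ∀ i r i' r', |modeState nB nS t i r i' r'| ≤ ϱ ^ (i + r + i' + r')) (A' B' : ℝ)
    (x y : FockLabel n) :
    |fockStateDeriv A' B' nB nS t x y| ≤ n * ((2 * |A'| + |B'|) / ϱ ^ 2 *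
      ((1 + (x.size + y.size : ℕ)) * ϱ ^ (x.size + y.size))) := by
  have hm : ∀ m ∈ (Finset.univ : Finset (Fin n)),
      |(∏ j ∈ Finset.univ.erase m, modeState nB nS t (x.1 j) (x.2 j) (y.1 j) (y.2 j)) *
        squeezedThermalDeriv A' B' (modeState nB nS t) (x.1 m) (x.2 m) (y.1 m) (y.2 m)| ≤
      (2 * |A'| + |B'|) / ϱ ^ 2 * ((1 + (x.size + y.size : ℕ)) * ϱ ^ (x.size + y.size)) := by
    intro m _
    have hsum := FockLabel.sum_modes x y
    have hle : x.1 m + x.2 m + y.1 m + y.2 m ≤ x.size + y.size := by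
      have h1 := x.mode_le_size m
      have h2 := y.mode_le_size m
      omega
    have hle' : ((x.1 m + x.2 m + y.1 m + y.2 m : ℕ) : ℝ) ≤ (x.size + y.size : ℕ) := by
      exact_mod_cast hle
    rw [abs_mul, Finset.abs_prod]
    calc _ ≤ (∏ j ∈ Finset.univ.erase m, ϱ ^ (x.1 j + x.2 j + y.1 j + y.2 j)) *
          ((2 * |A'| + |B'|) / ϱ ^ 2 * ((1 + (x.1 m + x.2 m + y.1 m + y.2 m : ℕ)) *
            ϱ ^ (x.1 m + x.2 m + y.1 m + y.2 m))) := by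
          refine mul_le_mul (Finset.prod_le_prod (fun _ _ => abs_nonneg _) fun j _ => h _ _ _ _)
            (abs_squeezedThermalDeriv_le h0 h A' B' _ _ _ _) (abs_nonneg _)
            (Finset.prod_nonneg fun _ _ => by positivity)
      _ = (2 * |A'| + |B'|) / ϱ ^ 2 * ((1 + (x.1 m + x.2 m + y.1 m + y.2 m : ℕ)) *
            ϱ ^ (x.size + y.size)) := by
          rw [← hsum, ← Finset.prod_pow_eq_pow_sum, ← Finset.prod_erase_mul _ _ (Finset.mem_univ m)]
          ring
      _ ≤ _ := by gcongr
  refine (Finset.abs_sum_le_sum_abs _ _).trans ((Finset.sum_le_sum hm).trans (le_of_eq ?_))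
  rw [Finset.sum_const, Finset.card_univ, Fintype.card_fin, nsmul_eq_mul]

theorem exists_fockWeight_bound {ϱ : ℝ} (h0 : 0 < ϱ) (h1 : ϱ < 1) (N : ℕ) : ∃ C : ℝ,
    ∀ x y : FockLabel n, fockWeight x ^ N * fockWeight y ^ N *
      ((1 + (x.size + y.size : ℕ)) * ϱ ^ (x.size + y.size)) ≤ C := by
  obtain ⟨C, hC⟩ := exists_pow_mul_geometric_le h0 h1 (N + N + 1)
  refine ⟨C, fun x y => le_trans ?_ (hC (x.size + y.size))⟩
  rw [pow_succ, pow_add _ N N, mul_assoc _ (1 + ((x.size + y.size : ℕ) : ℝ))]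
  have hx : fockWeight x ≤ 1 + ((x.size + y.size : ℕ) : ℝ) := by
    unfold fockWeight; push_cast; linarith [(Nat.cast_nonneg y.size : (0 : ℝ) ≤ y.size)]
  have hy : fockWeight y ≤ 1 + ((x.size + y.size : ℕ) : ℝ) := by
    unfold fockWeight; push_cast; linarith [(Nat.cast_nonneg x.size : (0 : ℝ) ≤ x.size)]
  have hx0 := isSummableWeight_fockWeight.pos x
  have hy0 := isSummableWeight_fockWeight.pos y
  refine mul_le_mul_of_nonneg_right ?_ (by positivity)
  gcongr

/-- In the term of pair `m` all other pairs contribute their trace, which is one. -/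
theorem hasSum_localOp_fockState (hB : 0 ≤ nB) (hS : 0 ≤ nS) (h0 : 0 < t) (h1 : t < 1)
    (c₀ c₁ c₂ c₃ : ℝ) :
    HasSum (fun x : FockLabel n => localOp (quadraticCoeff c₀ c₁ c₂ c₃) quadraticShift
      (fun y => (fockState nB nS t y x : ℂ)) x)
      ((n * (c₀ + c₁ * nS + c₂ * (nS * t + nB) +
        2 * c₃ * (√(nS / (1 + nS)) * √t * (1 + nS))) : ℝ) : ℂ) := by
  have hm : ∀ m : Fin n, HasSum (fun x : FockLabel n =>
      (∏ j ∈ Finset.univ.erase m, modeState nB nS t (x.1 j) (x.2 j) (x.1 j) (x.2 j)) *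
        quadraticOp c₀ c₁ c₂ c₃ (fun i r => modeState nB nS t i r (x.1 m) (x.2 m)) (x.1 m) (x.2 m))
      (c₀ + c₁ * nS + c₂ * (nS * t + nB) + 2 * c₃ * (√(nS / (1 + nS)) * √t * (1 + nS))) := by
    intro m
    have hf : ∀ j : Fin n, HasSum (fun p : ℕ × ℕ => if j = m then
        quadraticOp c₀ c₁ c₂ c₃ (fun i r => modeState nB nS t i r p.1 p.2) p.1 p.2
        else modeState nB nS t p.1 p.2 p.1 p.2)
        (if j = m then
          c₀ + c₁ * nS + c₂ * (nS * t + nB) + 2 * c₃ * (√(nS / (1 + nS)) * √t * (1 + nS))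
          else 1) := by
      intro j
      split_ifs
      · exact hasSum_quadraticOp_modeState hB hS h0 h1 _ _ _ _
      · exact hasSum_modeState_diag hB hS h0.le h1
    have h := hasSum_fock_prod hf
    rw [Finset.prod_ite_eq' Finset.univ m, if_pos (Finset.mem_univ m)] at h
    refine h.congr_fun fun x => ?_
    rw [← Finset.prod_erase_mul _ _ (Finset.mem_univ m), if_pos rfl]
    congr 1
    exact Finset.prod_congr rfl fun j hj => (if_neg (Finset.ne_of_mem_erase hj)).symm
  have h := hasSum_sum (s := Finset.univ) fun m _ => hm m
  rw [Finset.sum_const, Finset.card_univ, Fintype.card_fin, nsmul_eq_mul] at h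
  refine (Complex.hasSum_ofReal.mpr h).congr_fun fun x => ?_
  exact localOp_quadratic_prod c₀ c₁ c₂ c₃
    (fun j i r => modeState nB nS t i r (x.1 j) (x.2 j)) x

end OutputState

/-! ### The quantum Fisher information -/

section Main

variable {n : ℕ} {nB nS θ t : ℝ}

theorem hasDerivAt_fockState (hB : 0 ≤ nB) (hS : 0 ≤ nS) {U : Set ℝ} (hU : IsOpen U)
    (hU0 : ∀ t ∈ U, 0 < t ∧ t < 1) (x y : FockLabel n) (ht : t ∈ U) :
    HasDerivAt (fun t => fockState nB nS t x y)
      (fockStateDeriv (√(nS / (1 + nS)) * (1 / (2 * √t)) / (1 + nB))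
        (nS / (1 + nS) * (-1) / (1 + nB)) nB nS t x y) t := by
  have hm : ∀ m ∈ (Finset.univ : Finset (Fin n)), HasDerivAt
      (fun t => modeState nB nS t (x.1 m) (x.2 m) (y.1 m) (y.2 m))
      (squeezedThermalDeriv (√(nS / (1 + nS)) * (1 / (2 * √t)) / (1 + nB))
        (nS / (1 + nS) * (-1) / (1 + nB)) (modeState nB nS t) (x.1 m) (x.2 m) (y.1 m) (y.2 m)) t :=
    fun m _ => hasDerivAt_squeezedThermal (c := (1 + nS)⁻¹ * (1 + nB)⁻¹) hU
      (fun t ht => isSqueezedThermal_modeState hB hS (hU0 t ht).1.le (hU0 t ht).2)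
      (A' := fun t => √(nS / (1 + nS)) * (1 / (2 * √t)) / (1 + nB))
      (B' := fun _ => nS / (1 + nS) * (-1) / (1 + nB))
      (fun t ht => ((Real.hasDerivAt_sqrt (hU0 t ht).1.ne').const_mul _).div_const _)
      (fun t _ => ((((hasDerivAt_id t).const_sub 1).add_const nB).const_mul _).div_const _)
      (fun t ht => modeState_zero hB hS (hU0 t ht).1.le (hU0 t ht).2) _ _ _ _ ht
  exact HasDerivAt.fun_finsetProd hm

/-- The coefficient of `ab + a†b†` in the symmetric logarithmic derivative. -/
noncomputable def sldSqueeze (nB nS θ : ℝ) : ℝ :=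
  √(nS / (1 + nS)) * (1 + nB) * (1 + nS) /
    (√θ * (1 - θ + nB) * (nB + 1 + nS * (2 * nB + 1 - θ)))

/-- The constant and the probe number coefficient in the symmetric logarithmic derivative. -/
noncomputable def sldProbe (nB nS θ : ℝ) : ℝ :=
  -(sldSqueeze nB nS θ * (√(nS / (1 + nS)) * √θ / (1 + nB)))

/-- The idler number coefficient in the symmetric logarithmic derivative. -/
noncomputable def sldIdler (nB nS θ : ℝ) : ℝ := sldProbe nB nS θ - 1 / (1 - θ + nB)

/-- Condition `h₃` of `IsSqueezedThermal.quadraticOp_add` with `u = √λ`, `v = √θ`. The other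
conditions give `c₀ = c₂ = -c₃ A` and `c₁ = B'/B - c₃ A`, so it reads `c₃ (1 - A² + B D) = 2 A' - A
B'/B`, which fixes `sldSqueeze`. -/
theorem sld_squeeze_identity {u v nB nS e d : ℝ} (hu : u ^ 2 = nS / (1 + nS)) (hv : v ≠ 0)
    (hB : 1 + nB ≠ 0) (hS : 1 + nS ≠ 0) (he : e ≠ 0) (hd : d ≠ 0) (he' : e = 1 - v ^ 2 + nB)
    (hd' : d = nB + 1 + nS * (2 * nB + 1 - v ^ 2)) :
    u * v / (1 + nB) *
        (-(u * (1 + nB) * (1 + nS) / (v * e * d) * (u * v / (1 + nB))) - 1 / e) +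
      u * v / (1 + nB) * -(u * (1 + nB) * (1 + nS) / (v * e * d) * (u * v / (1 + nB))) +
      u * (1 + nB) * (1 + nS) / (v * e * d) *
        (1 + (u * v / (1 + nB)) ^ 2 + nS / (1 + nS) * e / (1 + nB) * (nB / (1 + nB))) =
    2 * (u * (1 / (2 * v)) / (1 + nB)) := by
  have hu' : u ^ 2 * (1 + nS) = nS := by rw [hu, div_mul_cancel₀ _ hS]
  rw [← hu]
  have h : (1 + nS) * ((1 + nB) ^ 2 + u ^ 2 * (e * nB - v ^ 2)) = d * (1 + nB) := by
    rw [hd', he']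
    linear_combination (nB * (1 - v ^ 2 + nB) - v ^ 2) * hu'
  have h' : e + v ^ 2 = 1 + nB := by rw [he']; ring
  field_simp
  linear_combination u * (h - d * h')

/-- The left side is the derivative at `t = θ` of the `t`-dependent part `c₂ (nS t + nB) + 2 c₃ √λ
√t (1 + nS)` of the expectation of one pair, with frozen coefficients. -/
theorem qfi_identity {u v nB nS e d : ℝ} (hu : u ^ 2 = nS / (1 + nS)) (hv : v ≠ 0)
    (hB : 1 + nB ≠ 0) (hS : 1 + nS ≠ 0) (he : e ≠ 0) (hd : d ≠ 0) :
    -(u * (1 + nB) * (1 + nS) / (v * e * d) * (u * v / (1 + nB))) * (nS * 1) +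
      2 * (u * (1 + nB) * (1 + nS) / (v * e * d)) * (u * (1 / (2 * v)) * (1 + nS)) =
    nS * (nB + 1 + (1 - v ^ 2) * nS + nB * nS) / (v ^ 2 * e * d) := by
  have hu' : u ^ 2 * (1 + nS) = nS := by rw [hu, div_mul_cancel₀ _ hS]
  field_simp
  linear_combination -(nS * v ^ 2 - (1 + nB) * (1 + nS)) * hu'

theorem two_mul_fockStateDeriv (hB : 0 ≤ nB) (hS : 0 < nS) (h0 : 0 < θ) (h1 : θ < 1)
    (x y : FockLabel n) :
    (2 * fockStateDeriv (√(nS / (1 + nS)) * (1 / (2 * √θ)) / (1 + nB))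
        (nS / (1 + nS) * (-1) / (1 + nB)) nB nS θ x y : ℂ) =
      localOp (quadraticCoeff (sldProbe nB nS θ) (sldIdler nB nS θ) (sldProbe nB nS θ)
        (sldSqueeze nB nS θ)) quadraticShift (fun z => (fockState nB nS θ z y : ℂ)) x +
      localOp (quadraticCoeff (sldProbe nB nS θ) (sldIdler nB nS θ) (sldProbe nB nS θ)
        (sldSqueeze nB nS θ)) quadraticShift (fun z => (fockState nB nS θ x z : ℂ)) y := by
  have e1 : 0 < 1 - θ + nB := by linarith
  have e2 : 0 < nB + 1 + nS * (2 * nB + 1 - θ) := by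
    have : 0 < 2 * nB + 1 - θ := by linarith
    positivity
  have hB1 : (0 : ℝ) < 1 + nB := by positivity
  have hS1 : (0 : ℝ) < 1 + nS := by positivity
  have hv : 0 < √θ := Real.sqrt_pos.mpr h0
  have hv2 : √θ ^ 2 = θ := Real.sq_sqrt h0.le
  have hu2 : √(nS / (1 + nS)) ^ 2 = nS / (1 + nS) := Real.sq_sqrt (by positivity)
  have key := (isSqueezedThermal_modeState (t := θ) hB hS.le h0.le h1).quadraticOp_add
    (c₀ := sldProbe nB nS θ) (c₁ := sldIdler nB nS θ) (c₂ := sldProbe nB nS θ)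
    (c₃ := sldSqueeze nB nS θ) (A' := √(nS / (1 + nS)) * (1 / (2 * √θ)) / (1 + nB))
    (B' := nS / (1 + nS) * (-1) / (1 + nB)) (by unfold sldProbe; ring) (by unfold sldProbe; ring)
    (by unfold sldIdler sldProbe; field_simp; ring)
    (sld_squeeze_identity hu2 hv.ne' hB1.ne' hS1.ne' e1.ne' e2.ne' (by rw [hv2]) (by rw [hv2]))
  have h1 := localOp_quadratic_prod (sldProbe nB nS θ) (sldIdler nB nS θ) (sldProbe nB nS θ)
    (sldSqueeze nB nS θ) (fun j i r => modeState nB nS θ i r (y.1 j) (y.2 j)) x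
  have h2 := localOp_quadratic_prod (sldProbe nB nS θ) (sldIdler nB nS θ) (sldProbe nB nS θ)
    (sldSqueeze nB nS θ) (fun j => modeState nB nS θ (x.1 j) (x.2 j)) y
  simp only [fockState]
  rw [h1, h2, ← Complex.ofReal_add, ← Finset.sum_add_distrib, ← Complex.ofReal_ofNat,
    ← Complex.ofReal_mul, fockStateDeriv, Finset.mul_sum]
  congr 1
  refine Finset.sum_congr rfl fun m _ => ?_
  rw [← mul_add, key]
  ring

theorem hasQFI_outputState (n : ℕ) (hB : 0 ≤ nB) (hS : 0 < nS) (h0 : 0 < θ) (h1 : θ < 1) :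
    HasQFI (outputState n nB nS) θ
      (n * (nS * (nB + 1 + (1 - θ) * nS + nB * nS) /
        (θ * (nB + 1 - θ) * (nB + 1 + nS * (2 * nB + 1 - θ))))) := by
  obtain ⟨ϱ, ε, hϱ0, hϱ1, hε, hU⟩ := exists_decay_rate hB hS.le h0 h1
  have hU0 : ∀ t ∈ Metric.ball θ ε, 0 < t ∧ t < 1 := fun t ht =>
    ⟨by linarith [(hU t ht).1], (hU t ht).2.1⟩
  refine hasQFI_of_hasDerivAt_trace
    (isSymmLocal_quadratic (sldProbe nB nS θ) (sldIdler nB nS θ) (sldProbe nB nS θ)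
      (sldSqueeze nB nS θ)) isSummableWeight_fockWeight Metric.isOpen_ball
    (convex_ball θ ε).isPreconnected (Metric.mem_ball_self hε)
    (fun t ht x y => outputState_eq_fockState hB (hU0 t ht).1.le (hU0 t ht).2 x y)
    (fun x y t ht => (hasDerivAt_fockState hB hS.le Metric.isOpen_ball hU0 x y ht).ofReal_comp)
    (fun t ht N => ?_) (fun N => ?_) (fun x y => ?_)
    (fun x y => two_mul_fockStateDeriv hB hS h0 h1 x y)
    (fun t ht => hasSum_localOp_fockState hB hS.le (hU0 t ht).1 (hU0 t ht).2 _ _ _ _) ?_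
  · obtain ⟨C, hC⟩ := exists_fockWeight_bound (n := n) hϱ0 hϱ1 N
    refine ⟨C, fun x y => le_trans ?_ (hC x y)⟩
    have hw : 0 ≤ fockWeight x ^ N * fockWeight y ^ N := mul_nonneg
      (isSummableWeight_fockWeight.pow_pos N x).le (isSummableWeight_fockWeight.pow_pos N y).le
    refine mul_le_mul_of_nonneg_left ?_ hw
    rw [Complex.norm_real, Real.norm_eq_abs]
    refine (abs_fockState_le (hU t ht).2.2 x y).trans (le_mul_of_one_le_left (by positivity) ?_)
    exact le_add_of_nonneg_right (Nat.cast_nonneg _)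
  · obtain ⟨C, hC⟩ := exists_fockWeight_bound (n := n) hϱ0 hϱ1 N
    -- The velocity of `A` decreases in `t`, and `t > θ / 2` on the ball, so its value at `θ / 2` is
    -- a uniform bound.
    set a := √(nS / (1 + nS)) * (1 / (2 * √(θ / 2))) / (1 + nB) with ha
    set b := nS / (1 + nS) * (-1) / (1 + nB) with hb
    refine ⟨n * ((2 * a + |b|) / ϱ ^ 2 * C), fun t ht x y => ?_⟩
    have hw : 0 ≤ fockWeight x ^ N * fockWeight y ^ N := mul_nonneg
      (isSummableWeight_fockWeight.pow_pos N x).le (isSummableWeight_fockWeight.pow_pos N y).le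
    have hA : |√(nS / (1 + nS)) * (1 / (2 * √t)) / (1 + nB)| ≤ a := by
      rw [abs_of_nonneg (by positivity), ha]
      have : 0 < √(θ / 2) := Real.sqrt_pos.mpr (by positivity)
      have h2 := (hU t ht).1.le
      gcongr
    rw [Complex.norm_real, Real.norm_eq_abs]
    refine (mul_le_mul_of_nonneg_left (abs_fockStateDeriv_le hϱ0 (hU t ht).2.2 _ b x y) hw).trans ?_
    have ha0 : 0 ≤ a := (abs_nonneg _).trans hA
    calc _ = n * ((2 * |√(nS / (1 + nS)) * (1 / (2 * √t)) / (1 + nB)| + |b|) / ϱ ^ 2 *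
          (fockWeight x ^ N * fockWeight y ^ N *
            ((1 + (x.size + y.size : ℕ)) * ϱ ^ (x.size + y.size)))) := by ring
      _ ≤ _ := by
        have := hC x y
        gcongr
  · congr 1
    exact Finset.prod_congr rfl fun m _ =>
      (isSqueezedThermal_modeState hB hS.le h0.le h1).symm _ _ _ _
  · have e1 : 0 < 1 - θ + nB := by linarith
    have e2 : 0 < nB + 1 + nS * (2 * nB + 1 - θ) := by
      have : 0 < 2 * nB + 1 - θ := by linarith
      positivity
    have hv : 0 < √θ := Real.sqrt_pos.mpr h0
    have h2 := (((((hasDerivAt_id θ).const_mul nS).add_const nB).const_mul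
      (sldProbe nB nS θ)).const_add (sldProbe nB nS θ + sldIdler nB nS θ * nS)).add
      ((((Real.hasDerivAt_sqrt h0.ne').const_mul √(nS / (1 + nS))).mul_const
        (1 + nS)).const_mul (2 * sldSqueeze nB nS θ))
    have hu2 : √(nS / (1 + nS)) ^ 2 = nS / (1 + nS) := Real.sq_sqrt (by positivity)
    have e := qfi_identity hu2 hv.ne' (by positivity : 1 + nB ≠ 0) (by positivity) e1.ne' e2.ne'
    rw [Real.sq_sqrt h0.le, show 1 - θ + nB = nB + 1 - θ by ring] at e
    rw [← e, show nB + 1 - θ = 1 - θ + nB by ring]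
    exact h2.const_mul (n : ℝ)

end Main

/-! ### The closed form and the limit of weak probes -/

theorem theorem1 (n : ℕ) (nB θ : ℝ) (hnB : 0 ≤ nB) (hθ₀ : 0 < θ) (hθ₁ : θ < 1) :
    (∀ nS : ℝ, 0 < nS → ∀ J : ℝ, HasQFI (outputState n nB nS) θ J ↔
      J = n * (nS * (nB + 1 + (1 - θ) * nS + nB * nS) /
        (θ * (nB + 1 - θ) * (nB + 1 + nS * (2 * nB + 1 - θ))))) ∧
    Tendsto (fun nS : ℝ => qfi (outputState n nB nS) θ / nS) (𝓝[>] 0)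
      (𝓝 (n / (θ * (nB + 1 - θ)))) := by
  have main : ∀ nS : ℝ, 0 < nS → ∀ J : ℝ, HasQFI (outputState n nB nS) θ J ↔
      J = n * (nS * (nB + 1 + (1 - θ) * nS + nB * nS) /
        (θ * (nB + 1 - θ) * (nB + 1 + nS * (2 * nB + 1 - θ)))) := by
    intro nS hS J
    have h := hasQFI_outputState n hnB hS hθ₀ hθ₁
    refine ⟨fun hJ => hJ.unique (fun S hS => outputState_nonneg hnB hθ₀.le hθ₁ hS) h, ?_⟩
    rintro rfl
    exact h
  refine ⟨main, ?_⟩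
  have hcont : Tendsto (fun nS : ℝ => n * ((nB + 1 + (1 - θ) * nS + nB * nS) /
      (θ * (nB + 1 - θ) * (nB + 1 + nS * (2 * nB + 1 - θ))))) (𝓝[>] 0)
      (𝓝 (n * ((nB + 1 + (1 - θ) * 0 + nB * 0) /
      (θ * (nB + 1 - θ) * (nB + 1 + 0 * (2 * nB + 1 - θ)))))) := by
    have e1 : nB + 1 - θ ≠ 0 := by linarith
    have e2 : nB + 1 + 0 * (2 * nB + 1 - θ) ≠ 0 := by linarith
    have hc : ContinuousAt (fun nS : ℝ => n * ((nB + 1 + (1 - θ) * nS + nB * nS) /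
        (θ * (nB + 1 - θ) * (nB + 1 + nS * (2 * nB + 1 - θ))))) 0 :=
      ContinuousAt.mul continuousAt_const (ContinuousAt.div (by fun_prop) (by fun_prop)
        (mul_ne_zero (mul_ne_zero hθ₀.ne' e1) e2))
    exact hc.tendsto.mono_left nhdsWithin_le_nhds
  have e : (n : ℝ) * ((nB + 1 + (1 - θ) * 0 + nB * 0) /
      (θ * (nB + 1 - θ) * (nB + 1 + 0 * (2 * nB + 1 - θ)))) = n / (θ * (nB + 1 - θ)) := by
    have e1 : nB + 1 - θ ≠ 0 := by linarith
    have e2 : nB + 1 ≠ 0 := by linarith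
    rw [mul_zero, mul_zero, zero_mul, add_zero, add_zero]
    field_simp
  rw [e] at hcont
  refine hcont.congr' ?_
  filter_upwards [self_mem_nhdsWithin] with nS hS
  have hS' : 0 < nS := hS
  -- For `nS > 0` existence rules out the default value `0`, and uniqueness identifies the chosen
  -- value.
  have hex : ∃ J, HasQFI (outputState n nB nS) θ J := ⟨_, (main nS hS' _).mpr rfl⟩
  rw [qfi, dif_pos hex, (main nS hS' _).mp hex.choose_spec]
  field_simp
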